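/- **Thermodynamic limits for the annealed Ising model on $\mathrm{GRG}_N(\boldsymbol w)$.** *Setting.* For every $N\ge1$ let $\boldsymbol w=(w_i)_{i\in[N]}$ be deterministic weights $w_i=w_i^{(N)}>0$, and $\ell_N=\sum_{i\in[N]}w_i$. The generalized random graph $\mathrm{GRG}_N(\boldsymbol w)$ has vertex set $[N]$ and contains each edge $ij$, $i<j$, independently with probability $p_{ij}=\frac{w_iw_j}{\ell_N+w_iw_j}$; $Q_N$ denotes its law and the corresponding expectation. Assume that there is a real random variable $W$ with $\mathbb E[W]<\infty$, $\mathbb E[W^2]<\infty$, $\mathbb E[W]>0$ such that, as $N\to\infty$: the weight of a uniformly chosen vertex of $[N]$ converges in distribution to $W$; $\frac1N\sum_iw_i\to\mathbb E[W]$; $\frac1N\sum_iw_i^2\to\mathbb E[W^2]$. Put $\nu=\mathbb E[W^2]/\mathbb E[W]$. For $\beta\ge0$, $B\in\mathbb R$, $\sigma\in\{-1,1\}^N$ and a graph $G$ on $[N]$ with edge set $E$ let $$b_G(\sigma)=\exp\Big[\beta\sum_{ij\in E}\sigma_i\sigma_j+B\sum_{i\in[N]}\sigma_i\Big],\quad Z_N(\beta,B)=\sum_\sigma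 b_G(\sigma),\quad \widetilde P_N(\sigma)=\frac{Q_N(b_G(\sigma))}{Q_N(Z_N(\beta,B))},\quad S_N=\sum_{i\in[N]}\sigma_i .$$ The annealed pressure, magnetization and susceptibility are $\widetilde\psi_N(\beta,B)=\frac1N\log Q_N(Z_N(\beta,B))$, $\widetilde M_N(\beta,B)=\widetilde P_N(S_N/N)$ and $\widetilde\chi_N(\beta,B)=\frac{\partial}{\partial B}\widetilde M_N(\beta,B)$. The (averaged) quenched magnetization is $M^{\rm qu}_N(\beta,B)=Q_N\big(\sum_\sigma \frac{b_G(\sigma)}{Z_N(\beta,B)}\frac{S_N}{N}\big)$. For a sequence of magnetizations $m_N$, the critical inverse temperature is $\inf\{\beta>0: m(\beta,0^+)>0\}\in[0,\infty]$ (with $\inf\emptyset=\infty$), the infimum being over the $\beta>0$ for which $m(\beta,B)=\lim_Nm_N(\beta,B)$ exists for all $B>0$ and $m(\beta,0^+)=\lim_{B\to0^+}m(\beta,B)$ exists and is positive; $\beta_c^{\rm an}$ and $\beta_c^{\rm qu}$ are the values for $\widetilde M_N$ and $M_N^{\rm qu}$. Let $$\mathcal U^{\rm an}=\{(\beta,B):\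 \beta\ge0,\ B\ne0\ \text{ or }\ 0<\beta<\beta_c^{\rm an},\ B=0\}.$$ Further let $$\beta_{ij}=\tfrac12\log\frac{e^{\beta}p_{ij}+1-p_{ij}}{e^{-\beta}p_{ij}+1-p_{ij}},\qquad C_{ij}\cosh(\beta_{ij})=p_{ij}\cosh\beta+1-p_{ij}\qquad(i,j\in[N]),$$ with $p_{ii}=\frac{w_i^2}{\ell_N+w_i^2}$, and $G_2(\beta)=\prod_{i<j}C_{ij}\prod_{i}e^{-\beta_{ii}/2}$. *Conclusions.* (i) For all $\beta\ge0$ the limit $\alpha(\beta)=\lim_{N\to\infty}\frac1N\log G_2(\beta)$ exists, and for all $\beta\ge0$, $B\in\mathbb R$ the limit $\widetilde\psi(\beta,B)=\lim_{N\to\infty}\widetilde\psi_N(\beta,B)$ exists and $$\widetilde\psi(\beta,B)=\log2+\alpha(\beta)+\mathbb E\Big[\log\cosh\Big(\sqrt{\tfrac{\sinh\beta}{\mathbb E[W]}}\,Wz^*+B\Big)\Big]-\frac{(z^*)^2}2 ,$$ where $z^*=z^*(\beta,B)$ is a point at which $z\mapsto\mathbb E\big[\log\cosh\big(\sqrt{\sinh(\beta)/\mathbb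 E[W]}\,Wz+B\big)\big]-z^2/2$ attains its maximum over $\mathbb R$; it solves the fixed-point equation $$z=\mathbb E\Big[\tanh\Big(\sqrt{\tfrac{\sinh\beta}{\mathbb E[W]}}\,Wz+B\Big)\sqrt{\tfrac{\sinh\beta}{\mathbb E[W]}}\,W\Big].\qquad(*)$$ (ii) For all $(\beta,B)\in\mathcal U^{\rm an}$ the limit $\widetilde M(\beta,B)=\lim_{N\to\infty}\widetilde M_N(\beta,B)$ exists. For $\beta\ge0$ and $B\ne0$, $\widetilde\psi(\beta,\cdot)$ is differentiable at $B$ and $$\widetilde M(\beta,B)=\frac{\partial}{\partial B}\widetilde\psi(\beta,B)=\mathbb E\Big[\tanh\Big(\sqrt{\tfrac{\sinh\beta}{\mathbb E[W]}}\,Wz^*+B\Big)\Big],$$ where $z^*=z^*(\beta,B)$ is the unique maximizer in (i), equivalently the unique solution of $(*)$ with $Bz\ge0$. (iii) For $0\le\beta\le\beta_c^{\rm an}$, $\lim_{B\to0^+}\widetilde M(\beta,B)=0$; for $\beta>\beta_c^{\rm an}$ this limit exists and is positive. Moreover $\beta_c^{\rm an}=\operatorname{asinh}(1/\nu)$. In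 particular, if $\nu>1$, then $\beta_c^{\rm an}<\beta_c^{\rm qu}$, and also $\beta_c^{\rm an}<\operatorname{atanh}(1/\nu)$. (iv) For all $(\beta,B)\in\mathcal U^{\rm an}$, $\widetilde\psi(\beta,\cdot)$ is differentiable near $B$ and twice differentiable at $B$, and $\lim_{N\to\infty}\widetilde\chi_N(\beta,B)$ exists and equals $\frac{\partial^2}{\partial B^2}\widetilde\psi(\beta,B)$. -/

import Mathlib

open MeasureTheory Filter Topology Finset

noncomputable section

namespace AnnealedGRG

section FiniteVolume

open scoped Classical

variable {N : ℕ}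

/-- The total weight `ℓ_N`. -/
def totalWeight (w : Fin N → ℝ) : ℝ := ∑ i, w i

/-- `p_ij = w_i w_j / (ℓ_N + w_i w_j)`; for `i = j` this is the conventional value `p_ii`, which is
not used by the random graph itself. -/
def edgeProb (w : Fin N → ℝ) (i j : Fin N) : ℝ :=
  w i * w j / (totalWeight w + w i * w j)

/-- The probability that the generalized random graph with weights `w` equals `G`: every edge
`ij`, `i < j`, is present with probability `p_ij`, independently of all the others. -/
def graphProb (w : Fin N → ℝ) (G : SimpleGraph (Fin N)) : ℝ :=
  ∏ i, ∏ j ∈ Ioi i, if G.Adj i j then edgeProb w i j else 1 - edgeProb w i j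

/-- Expectation `Q_N(f)` with respect to the law of the generalized random graph. -/
def graphExpect (w : Fin N → ℝ) (f : SimpleGraph (Fin N) → ℝ) : ℝ :=
  ∑ G, graphProb w G * f G

/-- Spin configurations: `ℤˣ = {1, -1}`. -/
abbrev Spins (N : ℕ) : Type := Fin N → ℤˣ

/-- The real number `σ_i ∈ {1, -1}`. -/
def spin (σ : Spins N) (i : Fin N) : ℝ := ((σ i : ℤ) : ℝ)

/-- The total spin `S_N`. -/
def totalSpin (σ : Spins N) : ℝ := ∑ i, spin σ i

/-- The Boltzmann weight `exp (β ∑_{ij ∈ E} σ_i σ_j + B ∑_i σ_i)`, each edge counted once. -/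
def boltzmann (G : SimpleGraph (Fin N)) (β B : ℝ) (σ : Spins N) : ℝ :=
  Real.exp (β * (∑ i, ∑ j ∈ Ioi i, if G.Adj i j then spin σ i * spin σ j else 0)
    + B * ∑ i, spin σ i)

/-- The partition function `Z_N(β, B)` on the graph `G`. -/
def partitionFn (G : SimpleGraph (Fin N)) (β B : ℝ) : ℝ := ∑ σ, boltzmann G β B σ

/-- The annealed measure of a spin configuration. -/
def annealedProb (w : Fin N → ℝ) (β B : ℝ) (σ : Spins N) : ℝ :=
  graphExpect w (fun G => boltzmann G β B σ) / graphExpect w (fun G => partitionFn G β B)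

/-- The annealed pressure. -/
def annealedPressure (w : Fin N → ℝ) (β B : ℝ) : ℝ :=
  1 / (N : ℝ) * Real.log (graphExpect w (fun G => partitionFn G β B))

/-- The annealed magnetization. -/
def annealedMagn (w : Fin N → ℝ) (β B : ℝ) : ℝ :=
  ∑ σ, annealedProb w β B σ * (totalSpin σ / N)

/-- The annealed susceptibility, the derivative of the annealed magnetization in `B`. -/
def annealedSusc (w : Fin N → ℝ) (β B : ℝ) : ℝ := deriv (fun b => annealedMagn w β b) B

/-- The magnetization under the averaged quenched measure: the average over the random graph of
the Boltzmann--Gibbs expectation of `S_N / N`. -/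
def quenchedMagn (w : Fin N → ℝ) (β B : ℝ) : ℝ :=
  graphExpect w (fun G => ∑ σ, boltzmann G β B σ / partitionFn G β B * (totalSpin σ / N))

/-- The effective coupling `β_ij`. -/
def effCoupling (w : Fin N → ℝ) (β : ℝ) (i j : Fin N) : ℝ :=
  1 / 2 * Real.log ((Real.exp β * edgeProb w i j + (1 - edgeProb w i j)) /
    (Real.exp (-β) * edgeProb w i j + (1 - edgeProb w i j)))

/-- The constant `C_ij`, given by `C_ij cosh β_ij = p_ij cosh β + (1 - p_ij)`. -/
def effConst (w : Fin N → ℝ) (β : ℝ) (i j : Fin N) : ℝ :=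
  (edgeProb w i j * Real.cosh β + (1 - edgeProb w i j)) / Real.cosh (effCoupling w β i j)

/-- The prefactor `∏_{i<j} C_ij ∏_i exp (-β_ii / 2)`. -/
def prefactor (w : Fin N → ℝ) (β : ℝ) : ℝ :=
  (∏ i, ∏ j ∈ Ioi i, effConst w β i j) * ∏ i, Real.exp (-(effCoupling w β i i) / 2)

end FiniteVolume

/-- The critical inverse temperature `inf {β > 0 : m(β, 0+) > 0}` of a sequence `m_N(β, B)` of
magnetizations, where `m(β, B) = lim_N m_N(β, B)` and `m(β, 0+) = lim_{B → 0+} m(β, B)`.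
It is an extended real number, `+∞` if the set is empty. -/
def criticalInvTemp (m : ℕ → ℝ → ℝ → ℝ) : EReal :=
  sInf ((fun b : ℝ => (b : EReal)) '' {β : ℝ | 0 < β ∧ ∃ M : ℝ → ℝ,
    (∀ B, 0 < B → Tendsto (fun N => m N β B) atTop (𝓝 (M B))) ∧
    ∃ m₀, 0 < m₀ ∧ Tendsto M (𝓝[>] 0) (𝓝 m₀)})

/-- The annealed critical inverse temperature. -/
def betaAn (w : (N : ℕ) → Fin N → ℝ) : EReal := criticalInvTemp (fun N => annealedMagn (w N))

/-- The quenched critical inverse temperature. -/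
def betaQu (w : (N : ℕ) → Fin N → ℝ) : EReal := criticalInvTemp (fun N => quenchedMagn (w N))

/-- The annealed uniqueness regime. -/
def uniquenessRegime (w : (N : ℕ) → Fin N → ℝ) : Set (ℝ × ℝ) :=
  {x | (0 ≤ x.1 ∧ x.2 ≠ 0) ∨ (0 < x.1 ∧ (x.1 : EReal) < betaAn w ∧ x.2 = 0)}

section Limit

variable {Ω : Type*} [MeasurableSpace Ω]

/-- The weight regularity condition, with limiting weight `W`. In `tendsto_dist` the weight of a
uniformly chosen vertex of `Fin (n + 1)` converges in distribution to `W`. -/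
structure WeightRegularity (w : (N : ℕ) → Fin N → ℝ) (W : Ω → ℝ) (P : Measure Ω)
    [IsProbabilityMeasure P] : Prop where
  tendsto_dist : TendstoInDistribution (fun n : ℕ => w (n + 1)) atTop W
    (fun n : ℕ => (PMF.uniformOfFintype (Fin (n + 1))).toMeasure) P
  integrable : Integrable W P
  tendsto_mean : Tendsto (fun N : ℕ => 1 / (N : ℝ) * ∑ i, w N i) atTop (𝓝 (∫ ω, W ω ∂P))
  integrable_sq : Integrable (fun ω => W ω ^ 2) P
  tendsto_sq : Tendsto (fun N : ℕ => 1 / (N : ℝ) * ∑ i, w N i ^ 2) atTop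
    (𝓝 (∫ ω, W ω ^ 2 ∂P))
  mean_pos : 0 < ∫ ω, W ω ∂P

/-- `ν = E[W²] / E[W]`. -/
def nu (W : Ω → ℝ) (P : Measure Ω) : ℝ := (∫ ω, W ω ^ 2 ∂P) / ∫ ω, W ω ∂P

/-- `√(sinh β / E[W])`. -/
def scale (W : Ω → ℝ) (P : Measure Ω) (β : ℝ) : ℝ := √(Real.sinh β / ∫ ω, W ω ∂P)

/-- `E[log cosh (√(sinh β / E[W]) W z + B)] - z² / 2`. -/
def varFn (W : Ω → ℝ) (P : Measure Ω) (β B z : ℝ) : ℝ :=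
  (∫ ω, Real.log (Real.cosh (scale W P β * W ω * z + B)) ∂P) - z ^ 2 / 2

/-- The right-hand side of the fixed-point equation:
`E[tanh (√(sinh β / E[W]) W z + B) √(sinh β / E[W]) W]`. -/
def fixedPointMap (W : Ω → ℝ) (P : Measure Ω) (β B z : ℝ) : ℝ :=
  ∫ ω, Real.tanh (scale W P β * W ω * z + B) * (scale W P β * W ω) ∂P

end Limit

end AnnealedGRG

end

open AnnealedGRG

namespace AnnealedGRG
open scoped Classical

section Pairs

variable {N : ℕ}

/-- The set of pairs `i < j`. -/
def pairs (N : ℕ) : Finset (Fin N × Fin N) := univ.filter fun e => e.1 < e.2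

theorem mem_pairs {e : Fin N × Fin N} : e ∈ pairs N ↔ e.1 < e.2 := by simp [pairs]

theorem sum_Ioi_eq_sum_pairs {M : Type*} [AddCommMonoid M] (f : Fin N → Fin N → M) :
    ∑ i, ∑ j ∈ Ioi i, f i j = ∑ e ∈ pairs N, f e.1 e.2 := by
  rw [pairs, Finset.sum_filter, Fintype.sum_prod_type]
  refine Finset.sum_congr rfl fun i _ => ?_
  rw [← Finset.sum_filter]
  exact Finset.sum_congr (by ext j; simp) fun _ _ => rfl

theorem prod_Ioi_eq_prod_pairs {M : Type*} [CommMonoid M] (f : Fin N → Fin N → M) :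
    ∏ i, ∏ j ∈ Ioi i, f i j = ∏ e ∈ pairs N, f e.1 e.2 := by
  rw [pairs, Finset.prod_filter, Fintype.prod_prod_type]
  refine Finset.prod_congr rfl fun i _ => ?_
  rw [← Finset.prod_filter]
  exact Finset.prod_congr (by ext j; simp) fun _ _ => rfl

/-- The graph with a given set of edges `i < j`. -/
def graphOfPairs (s : Finset (Fin N × Fin N)) : SimpleGraph (Fin N) where
  Adj i j := (i < j ∧ (i, j) ∈ s) ∨ (j < i ∧ (j, i) ∈ s)
  symm := ⟨fun _ _ h => h.symm⟩
  loopless := ⟨fun i h => by simp at h⟩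

theorem sum_graph_eq_sum_pairs {M : Type*} [AddCommMonoid M] (f : SimpleGraph (Fin N) → M) :
    ∑ G, f G = ∑ s ∈ (pairs N).powerset, f (graphOfPairs s) := by
  symm
  refine Finset.sum_bij (fun s _ => graphOfPairs s) (fun _ _ => Finset.mem_univ _) ?_ ?_
    (fun _ _ => rfl)
  · intro s hs t ht h
    ext e
    rw [Finset.mem_powerset] at hs ht
    have key : ∀ u : Finset (Fin N × Fin N), u ⊆ pairs N →
        (e ∈ u ↔ e.1 < e.2 ∧ (graphOfPairs u).Adj e.1 e.2) := by
      intro u hu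
      constructor
      · intro he
        have := mem_pairs.1 (hu he)
        exact ⟨this, Or.inl ⟨this, he⟩⟩
      · rintro ⟨h1, h2 | h2⟩
        · exact h2.2
        · exact absurd h1 (not_lt_of_gt h2.1)
    rw [key s hs, key t ht, h]
  · intro G _
    refine ⟨(pairs N).filter fun e => G.Adj e.1 e.2, by simp, ?_⟩
    ext i j
    simp only [graphOfPairs, Finset.mem_filter, mem_pairs]
    constructor
    · rintro (h | h)
      · exact h.2.2
      · exact h.2.2.symm
    · intro h
      rcases lt_or_gt_of_ne h.ne with h' | h'
      · exact Or.inl ⟨h', h', h⟩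
      · exact Or.inr ⟨h', h', h.symm⟩

theorem graphOfPairs_adj {s : Finset (Fin N × Fin N)} {e : Fin N × Fin N} (he : e ∈ pairs N) :
    (graphOfPairs s).Adj e.1 e.2 ↔ e ∈ s := by
  rw [mem_pairs] at he
  simp [graphOfPairs, he, not_lt_of_gt he]

/-- Summing a product over all pairs over all graphs. -/
theorem sum_graph_prod (f g : Fin N → Fin N → ℝ) :
    ∑ G : SimpleGraph (Fin N), ∏ i, ∏ j ∈ Ioi i, (if G.Adj i j then f i j else g i j)
      = ∏ i, ∏ j ∈ Ioi i, (f i j + g i j) := by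
  simp_rw [prod_Ioi_eq_prod_pairs (N := N)]
  rw [sum_graph_eq_sum_pairs, Finset.prod_add]
  refine Finset.sum_congr rfl fun s hs => ?_
  rw [Finset.mem_powerset] at hs
  rw [Finset.prod_congr rfl fun e he => by rw [graphOfPairs_adj he],
    ← Finset.prod_sdiff hs, mul_comm]
  congr 1
  · exact Finset.prod_congr rfl fun e he => by simp [he]
  · exact Finset.prod_congr rfl fun e he => by simp [(Finset.mem_sdiff.1 he).2]

end Pairs

section Weights

variable {N : ℕ} {w : Fin N → ℝ}

theorem totalWeight_nonneg (hw : ∀ i, 0 < w i) : 0 ≤ totalWeight w :=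
  Finset.sum_nonneg fun i _ => (hw i).le

theorem totalWeight_pos (hw : ∀ i, 0 < w i) (i : Fin N) : 0 < totalWeight w :=
  Finset.sum_pos (fun i _ => hw i) ⟨i, Finset.mem_univ i⟩

/-- The odds `w_i w_j / ℓ_N` of an edge. -/
noncomputable def edgeOdds (w : Fin N → ℝ) (i j : Fin N) : ℝ := w i * w j / totalWeight w

theorem edgeOdds_pos (hw : ∀ i, 0 < w i) (i j : Fin N) : 0 < edgeOdds w i j :=
  div_pos (mul_pos (hw i) (hw j)) (totalWeight_pos hw i)

theorem edgeOdds_comm (i j : Fin N) : edgeOdds w i j = edgeOdds w j i := by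
  rw [edgeOdds, edgeOdds, mul_comm (w i)]

theorem edgeProb_eq (hw : ∀ i, 0 < w i) (i j : Fin N) :
    edgeProb w i j = edgeOdds w i j / (1 + edgeOdds w i j) := by
  have := totalWeight_pos hw i
  have h2 := mul_pos (hw i) (hw j)
  unfold edgeProb edgeOdds
  field_simp

theorem edgeProb_comm (i j : Fin N) : edgeProb w i j = edgeProb w j i := by
  rw [edgeProb, edgeProb, mul_comm (w i)]

theorem edgeProb_pos (hw : ∀ i, 0 < w i) (i j : Fin N) : 0 < edgeProb w i j := by
  have := edgeOdds_pos hw i j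
  rw [edgeProb_eq hw]; positivity

theorem edgeProb_lt_one (hw : ∀ i, 0 < w i) (i j : Fin N) : edgeProb w i j < 1 := by
  have := edgeOdds_pos hw i j
  rw [edgeProb_eq hw, div_lt_one (by positivity)]; linarith

theorem edgeProb_eq_odds_mul (hw : ∀ i, 0 < w i) (i j : Fin N) :
    edgeProb w i j = edgeOdds w i j * (1 - edgeProb w i j) := by
  have := edgeOdds_pos hw i j
  rw [edgeProb_eq hw]; field_simp; ring

theorem edgeProb_le_odds (hw : ∀ i, 0 < w i) (i j : Fin N) :
    edgeProb w i j ≤ edgeOdds w i j := by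
  have h1 := edgeProb_eq_odds_mul hw i j
  have := edgeOdds_pos hw i j
  have := edgeProb_pos hw i j
  nlinarith

theorem odds_sub_edgeProb_le (hw : ∀ i, 0 < w i) (i j : Fin N) :
    edgeOdds w i j - edgeProb w i j ≤ edgeOdds w i j ^ 2 := by
  have h1 := edgeProb_eq_odds_mul hw i j
  have h2 := edgeProb_le_odds hw i j
  have := edgeOdds_pos hw i j
  nlinarith

theorem graphProb_nonneg (hw : ∀ i, 0 < w i) (G : SimpleGraph (Fin N)) : 0 ≤ graphProb w G := by
  refine Finset.prod_nonneg fun i _ => Finset.prod_nonneg fun j _ => ?_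
  have := edgeProb_pos hw i j
  have := edgeProb_lt_one hw i j
  split_ifs <;> linarith

/-- The probability of adding an edge to a graph. -/
theorem graphProb_eq_odds_mul (hw : ∀ i, 0 < w i) {a b : Fin N} (hab : a ≠ b)
    {G G' : SimpleGraph (Fin N)} (h : ¬ G.Adj a b) (h' : G'.Adj a b)
    (hG : ∀ i j, s(i, j) ≠ s(a, b) → (G'.Adj i j ↔ G.Adj i j)) :
    graphProb w G' = edgeOdds w a b * graphProb w G := by
  wlog hlt : a < b generalizing a b
  · rw [edgeOdds_comm]
    exact this hab.symm (fun h1 => h h1.symm) h'.symm (fun i j hij => hG i j (by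
      rwa [Sym2.eq_swap (a := a)])) (lt_of_le_of_ne (not_lt.1 hlt) hab.symm)
  unfold graphProb
  rw [prod_Ioi_eq_prod_pairs, prod_Ioi_eq_prod_pairs]
  have hmem : (a, b) ∈ pairs N := mem_pairs.2 hlt
  rw [← Finset.mul_prod_erase _ _ hmem, ← Finset.mul_prod_erase _ _ hmem, if_pos h', if_neg h,
    ← mul_assoc, ← edgeProb_eq_odds_mul hw]
  congr 1
  refine Finset.prod_congr rfl fun e he => ?_
  rw [Finset.mem_erase, mem_pairs] at he
  have : s(e.1, e.2) ≠ s(a, b) := by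
    intro h0
    rcases Sym2.eq_iff.1 h0 with h1 | h1
    · exact he.1 (Prod.ext h1.1 h1.2)
    · exact absurd he.2 (by rw [h1.1, h1.2]; exact not_lt_of_gt hlt)
  simp only [hG e.1 e.2 this]

end Weights

section Annealed

variable {N : ℕ} {w : Fin N → ℝ}

theorem spin_eq (σ : Spins N) (i : Fin N) : spin σ i = 1 ∨ spin σ i = -1 := by
  unfold spin
  rcases Int.units_eq_one_or (σ i) with h | h <;> simp [h]

theorem spin_mul_eq (σ : Spins N) (i j : Fin N) :
    spin σ i * spin σ j = 1 ∨ spin σ i * spin σ j = -1 := by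
  rcases spin_eq σ i with h | h <;> rcases spin_eq σ j with h' | h' <;> simp [h, h']

theorem spin_mul_self (σ : Spins N) (i : Fin N) : spin σ i * spin σ i = 1 := by
  rcases spin_eq σ i with h | h <;> simp [h]

theorem abs_spin (σ : Spins N) (i : Fin N) : |spin σ i| = 1 := by
  rcases spin_eq σ i with h | h <;> simp [h]

theorem spin_neg (σ : Spins N) (i : Fin N) : spin (-σ) i = -spin σ i := by
  simp [spin]

theorem totalSpin_neg (σ : Spins N) : totalSpin (-σ) = -totalSpin σ := by
  simp [totalSpin, spin_neg]

/-- The weight of a spin configuration, averaged over the graph, at zero field. -/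
noncomputable def annealedWeight (w : Fin N → ℝ) (β : ℝ) (σ : Spins N) : ℝ :=
  ∏ i, ∏ j ∈ Ioi i, (1 + edgeProb w i j * (Real.exp (β * (spin σ i * spin σ j)) - 1))

theorem one_add_edgeProb_mul_pos (hw : ∀ i, 0 < w i) (i j : Fin N) (x : ℝ) :
    0 < 1 + edgeProb w i j * (Real.exp x - 1) := by
  have h1 := edgeProb_pos hw i j
  have h2 := edgeProb_lt_one hw i j
  have := mul_pos h1 (Real.exp_pos x)
  linarith

theorem annealedWeight_pos (hw : ∀ i, 0 < w i) (β : ℝ) (σ : Spins N) :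
    0 < annealedWeight w β σ :=
  Finset.prod_pos fun _ _ => Finset.prod_pos fun _ _ => one_add_edgeProb_mul_pos hw _ _ _

theorem annealedWeight_neg (β : ℝ) (σ : Spins N) :
    annealedWeight w β (-σ) = annealedWeight w β σ := by
  simp [annealedWeight, spin_neg]

theorem graphExpect_boltzmann (β B : ℝ) (σ : Spins N) :
    graphExpect w (fun G => boltzmann G β B σ)
      = annealedWeight w β σ * Real.exp (B * totalSpin σ) := by
  unfold graphExpect graphProb boltzmann annealedWeight
  simp_rw [Real.exp_add, ← mul_assoc, ← Finset.sum_mul]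
  congr 1
  have := sum_graph_prod (fun i j => edgeProb w i j * Real.exp (β * (spin σ i * spin σ j)))
    (fun i j => 1 - edgeProb w i j)
  refine Eq.trans ?_ (this.trans ?_)
  · refine Finset.sum_congr rfl fun G _ => ?_
    simp_rw [Finset.mul_sum, Real.exp_sum, ← Finset.prod_mul_distrib]
    refine Finset.prod_congr rfl fun i _ => Finset.prod_congr rfl fun j _ => ?_
    split_ifs <;> simp
  · exact Finset.prod_congr rfl fun i _ => Finset.prod_congr rfl fun j _ => by ring_nf

/-- The moments `∑_σ A(σ) S^k e^{B S}` of a weight `A`. -/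
noncomputable def fieldMoment (A : Spins N → ℝ) (k : ℕ) (B : ℝ) : ℝ :=
  ∑ σ, A σ * Real.exp (B * totalSpin σ) * totalSpin σ ^ k

theorem graphExpect_partitionFn (β B : ℝ) :
    graphExpect w (fun G => partitionFn G β B) = fieldMoment (annealedWeight w β) 0 B := by
  unfold fieldMoment
  simp_rw [pow_zero, mul_one, ← graphExpect_boltzmann]
  unfold graphExpect partitionFn
  simp_rw [Finset.mul_sum]
  exact Finset.sum_comm

theorem annealedMagn_eq (β B : ℝ) : annealedMagn w β B =
    fieldMoment (annealedWeight w β) 1 B / fieldMoment (annealedWeight w β) 0 B / N := by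
  unfold annealedMagn annealedProb
  simp_rw [graphExpect_boltzmann, graphExpect_partitionFn]
  rw [show fieldMoment (annealedWeight w β) 1 B = ∑ σ, annealedWeight w β σ *
    Real.exp (B * totalSpin σ) * totalSpin σ ^ 1 from rfl, Finset.sum_div, Finset.sum_div]
  exact Finset.sum_congr rfl fun σ _ => by ring

theorem fieldMoment_zero_pos {A : Spins N → ℝ} (hA : ∀ σ, 0 < A σ) (B : ℝ) :
    0 < fieldMoment A 0 B := by
  unfold fieldMoment
  refine Finset.sum_pos (fun σ _ => ?_) ⟨1, Finset.mem_univ _⟩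
  have := hA σ
  rw [pow_zero]; positivity

theorem hasDerivAt_fieldMoment (A : Spins N → ℝ) (k : ℕ) (B : ℝ) :
    HasDerivAt (fieldMoment A k) (fieldMoment A (k + 1) B) B := by
  unfold fieldMoment
  refine HasDerivAt.fun_sum fun σ _ => ?_
  have h1 := (((hasDerivAt_id B).mul_const (totalSpin σ)).exp.const_mul (A σ)).mul_const
    (totalSpin σ ^ k)
  refine h1.congr_deriv ?_
  simp only [id]; ring

theorem hasDerivAt_fieldMoment_div {A : Spins N → ℝ} (hA : ∀ σ, 0 < A σ) (B : ℝ) :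
    HasDerivAt (fun B => fieldMoment A 1 B / fieldMoment A 0 B)
      (fieldMoment A 2 B / fieldMoment A 0 B - (fieldMoment A 1 B / fieldMoment A 0 B) ^ 2) B := by
  have h0 := (fieldMoment_zero_pos hA B).ne'
  refine ((hasDerivAt_fieldMoment A 1 B).div (hasDerivAt_fieldMoment A 0 B) h0).congr_deriv ?_
  field_simp

theorem fieldMoment_neg {A : Spins N → ℝ} (hA : ∀ σ, A (-σ) = A σ) (k : ℕ) (B : ℝ) :
    fieldMoment A k (-B) = (-1) ^ k * fieldMoment A k B := by
  unfold fieldMoment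
  rw [Finset.mul_sum]
  refine Fintype.sum_equiv (Equiv.neg (Spins N)) _ _ fun σ => ?_
  simp only [Equiv.neg_apply, hA, totalSpin_neg]
  rw [neg_pow (totalSpin σ), show ((-1 : ℝ) ^ k * (A σ * Real.exp (B * -totalSpin σ) *
    ((-1) ^ k * totalSpin σ ^ k))) = ((-1 : ℝ) ^ k * (-1) ^ k) *
    (A σ * Real.exp (B * -totalSpin σ) * totalSpin σ ^ k) by ring, ← mul_pow]
  simp

/-- Convexity of the log-partition function in the field, as a tangent inequality. -/
theorem log_fieldMoment_tangent {A : Spins N → ℝ} (hA : ∀ σ, 0 < A σ) (x y : ℝ) :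
    Real.log (fieldMoment A 0 x) + fieldMoment A 1 x / fieldMoment A 0 x * (y - x)
      ≤ Real.log (fieldMoment A 0 y) := by
  have hx := fieldMoment_zero_pos hA x
  set m := fieldMoment A 1 x / fieldMoment A 0 x with hm
  rw [Real.le_log_iff_exp_le (fieldMoment_zero_pos hA y), Real.exp_add, Real.exp_log hx]
  have h1 : fieldMoment A 0 y = ∑ σ, A σ * Real.exp (x * totalSpin σ) *
      Real.exp (m * (y - x)) * Real.exp ((totalSpin σ - m) * (y - x)) := by
    refine Finset.sum_congr rfl fun σ _ => ?_
    rw [pow_zero, mul_one, mul_assoc, mul_assoc, ← Real.exp_add, ← Real.exp_add]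
    congr 2; ring
  have h2 : fieldMoment A 0 x * Real.exp (m * (y - x)) =
      ∑ σ, A σ * Real.exp (x * totalSpin σ) * Real.exp (m * (y - x)) *
        ((totalSpin σ - m) * (y - x) + 1) := by
    have h3 : ∑ σ, A σ * Real.exp (x * totalSpin σ) * Real.exp (m * (y - x)) *
        ((totalSpin σ - m) * (y - x) + 1) = Real.exp (m * (y - x)) *
        ((y - x) * (fieldMoment A 1 x - m * fieldMoment A 0 x) + fieldMoment A 0 x) := by
      unfold fieldMoment
      rw [Finset.mul_sum, ← Finset.sum_sub_distrib, Finset.mul_sum, ← Finset.sum_add_distrib,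
        Finset.mul_sum]
      exact Finset.sum_congr rfl fun σ _ => by ring
    rw [h3, hm, div_mul_cancel₀ _ hx.ne']; ring
  rw [h1, h2]
  refine Finset.sum_le_sum fun σ _ => ?_
  refine mul_le_mul_of_nonneg_left (Real.add_one_le_exp _) ?_
  have := hA σ
  positivity

end Annealed
end AnnealedGRG

namespace AnnealedGRG
open scoped Classical

section GriffithsKellySherman

variable {Γ : Type*} [CommGroup Γ] [Fintype Γ]

/-- Ferromagnetic Gibbs weights on a finite group: products of `exp (J χ)`, where `J ≥ 0` and `χ`
is a real character. -/
inductive Ferro : (Γ → ℝ) → Prop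
  | one : Ferro (fun _ => 1)
  | exp_mul {ρ : Γ → ℝ} {J : ℝ} (hJ : 0 ≤ J) (χ : Γ →* ℝ) (hρ : Ferro ρ) :
      Ferro (fun g => Real.exp (J * χ g) * ρ g)

omit [Fintype Γ] in
theorem Ferro.pos {ρ : Γ → ℝ} (hρ : Ferro ρ) (g : Γ) : 0 < ρ g := by
  induction hρ with
  | one => exact one_pos
  | exp_mul _ _ _ ih => exact mul_pos (Real.exp_pos _) ih

omit [Fintype Γ] in
theorem Ferro.mul {ρ ρ' : Γ → ℝ} (hρ : Ferro ρ) (hρ' : Ferro ρ') :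
    Ferro (fun g => ρ g * ρ' g) := by
  induction hρ with
  | one => simpa using hρ'
  | exp_mul hJ χ _ ih =>
    simp_rw [mul_assoc]
    exact Ferro.exp_mul hJ χ ih

omit [Fintype Γ] in
theorem Ferro.exp_sum {ι : Type*} (s : Finset ι) (J : ι → ℝ) (χ : ι → Γ →* ℝ)
    (hJ : ∀ i ∈ s, 0 ≤ J i) : Ferro (fun g => Real.exp (∑ i ∈ s, J i * χ i g)) := by
  induction s using Finset.induction_on with
  | empty => simpa using Ferro.one
  | insert a s ha ih =>
    simp_rw [Finset.sum_insert ha, Real.exp_add]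
    exact Ferro.exp_mul (hJ a (by simp)) _ (ih fun i hi => hJ i (by simp [hi]))

omit [Fintype Γ] in
theorem char_eq_one_or (h2 : ∀ g : Γ, g * g = 1) (χ : Γ →* ℝ) (g : Γ) : χ g = 1 ∨ χ g = -1 := by
  have : χ g * χ g = 1 := by rw [← map_mul, h2, map_one]
  exact mul_self_eq_one_iff.1 this

omit [Fintype Γ] in
theorem exp_mul_char (h2 : ∀ g : Γ, g * g = 1) (χ : Γ →* ℝ) (J : ℝ) (g : Γ) :
    Real.exp (J * χ g) = Real.cosh J + Real.sinh J * χ g := by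
  rcases char_eq_one_or h2 χ g with h | h
  · rw [h, mul_one, mul_one, Real.cosh_add_sinh]
  · rw [h, mul_neg_one, mul_neg_one, ← sub_eq_add_neg, Real.cosh_sub_sinh]

/-- The first Griffiths inequality. -/
theorem Ferro.sum_char_nonneg (h2 : ∀ g : Γ, g * g = 1) {ρ : Γ → ℝ} (hρ : Ferro ρ)
    (χ : Γ →* ℝ) : 0 ≤ ∑ g, χ g * ρ g := by
  induction hρ generalizing χ with
  | one =>
    simp_rw [mul_one]
    rw [sum_hom_units]
    split_ifs <;> positivity
  | @exp_mul ρ J hJ ψ _ ih =>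
    have h : ∑ g, χ g * (Real.exp (J * ψ g) * ρ g) =
        Real.cosh J * ∑ g, χ g * ρ g + Real.sinh J * ∑ g, (χ * ψ) g * ρ g := by
      rw [Finset.mul_sum, Finset.mul_sum, ← Finset.sum_add_distrib]
      refine Finset.sum_congr rfl fun g _ => ?_
      rw [exp_mul_char h2, MonoidHom.mul_apply]; ring
    rw [h]
    exact add_nonneg (mul_nonneg (Real.cosh_pos J).le (ih χ))
      (mul_nonneg (Real.sinh_nonneg_iff.2 hJ) (ih _))

omit [Fintype Γ] in
theorem Ferro.mul_translate (h2 : ∀ g : Γ, g * g = 1) {ρ : Γ → ℝ} (hρ : Ferro ρ) (t : Γ) :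
    Ferro (fun g => ρ g * ρ (g * t)) := by
  induction hρ with
  | one => simpa using Ferro.one
  | @exp_mul ρ J hJ χ _ ih =>
    have h : 0 ≤ J * (1 + χ t) := by
      rcases char_eq_one_or h2 χ t with h | h <;> rw [h] <;> linarith
    convert Ferro.exp_mul h χ ih using 2 with g
    rw [show J * (1 + χ t) * χ g = J * χ g + J * χ (g * t) by rw [map_mul]; ring, Real.exp_add]
    ring

/-- The second Griffiths inequality. -/
theorem Ferro.sum_char_mul_sum_char_le (h2 : ∀ g : Γ, g * g = 1) {ρ : Γ → ℝ} (hρ : Ferro ρ)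
    (χ ψ : Γ →* ℝ) :
    (∑ g, χ g * ρ g) * (∑ g, ψ g * ρ g) ≤ (∑ g, χ g * ψ g * ρ g) * ∑ g, ρ g := by
  have key : (∑ g, χ g * ψ g * ρ g) * (∑ g, ρ g) - (∑ g, χ g * ρ g) * (∑ g, ψ g * ρ g) =
      ∑ t, (1 - ψ t) * ∑ g, (χ * ψ) g * (ρ g * ρ (g * t)) := by
    have hs : ∀ (a b : Γ → ℝ), (∑ g, a g) * ∑ g, b g = ∑ t, ∑ g, a g * b (g * t) := by
      intro a b
      rw [Finset.sum_mul_sum, Finset.sum_comm' (t' := univ) (s' := fun _ => univ) (by simp),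
        Finset.sum_comm]
      rw [Finset.sum_comm (s := univ) (t := univ) (f := fun t g => a g * b (g * t))]
      refine Finset.sum_congr rfl fun g _ => ?_
      exact (Fintype.sum_equiv (Equiv.mulLeft g) _ _ fun t => rfl).symm
    rw [hs, hs, ← Finset.sum_sub_distrib]
    refine Finset.sum_congr rfl fun t _ => ?_
    rw [← Finset.sum_sub_distrib, Finset.mul_sum]
    refine Finset.sum_congr rfl fun g _ => ?_
    rw [map_mul, MonoidHom.mul_apply]; ring
  have : 0 ≤ ∑ t, (1 - ψ t) * ∑ g, (χ * ψ) g * (ρ g * ρ (g * t)) := by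
    refine Finset.sum_nonneg fun t _ => mul_nonneg ?_
      ((hρ.mul_translate h2 t).sum_char_nonneg h2 _)
    rcases char_eq_one_or h2 ψ t with h | h <;> rw [h] <;> norm_num
  linarith

/-- The Gibbs average of `f` for the weight `ρ`. -/
noncomputable def gibbsAvg (ρ f : Γ → ℝ) : ℝ := (∑ g, f g * ρ g) / ∑ g, ρ g

theorem Ferro.sum_pos {ρ : Γ → ℝ} (hρ : Ferro ρ) : 0 < ∑ g, ρ g :=
  Finset.sum_pos (fun g _ => hρ.pos g) ⟨1, Finset.mem_univ _⟩

theorem Ferro.gibbsAvg_nonneg (h2 : ∀ g : Γ, g * g = 1) {ρ : Γ → ℝ} (hρ : Ferro ρ)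
    (χ : Γ →* ℝ) : 0 ≤ gibbsAvg ρ χ :=
  div_nonneg (hρ.sum_char_nonneg h2 χ) hρ.sum_pos.le

theorem sum_mul_exp_char (h2 : ∀ g : Γ, g * g = 1) (ρ f : Γ → ℝ) (χ : Γ →* ℝ) (J : ℝ) :
    ∑ g, f g * (Real.exp (J * χ g) * ρ g) =
      Real.cosh J * ∑ g, f g * ρ g + Real.sinh J * ∑ g, f g * χ g * ρ g := by
  rw [Finset.mul_sum, Finset.mul_sum, ← Finset.sum_add_distrib]
  refine Finset.sum_congr rfl fun g _ => ?_
  rw [exp_mul_char h2]; ring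

theorem Ferro.gibbsAvg_exp_mul_le (h2 : ∀ g : Γ, g * g = 1) {ρ : Γ → ℝ} (hρ : Ferro ρ) {J : ℝ}
    (hJ : 0 ≤ J) (χ ψ : Γ →* ℝ) :
    gibbsAvg (fun g => Real.exp (J * χ g) * ρ g) ψ ≤
      gibbsAvg ρ ψ + Real.tanh J * gibbsAvg ρ (ψ * χ : Γ →* ℝ) := by
  unfold gibbsAvg
  have hc := Real.cosh_pos J
  have hs := Real.sinh_nonneg_iff.2 hJ
  have hZ := hρ.sum_pos
  have h1 := sum_mul_exp_char h2 ρ ψ χ J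
  have h3 := sum_mul_exp_char h2 ρ (fun _ => 1) χ J
  simp only [one_mul] at h3
  have ha := hρ.sum_char_nonneg h2 ψ
  have hb := hρ.sum_char_nonneg h2 (ψ * χ)
  have hd := hρ.sum_char_nonneg h2 χ
  simp only [MonoidHom.mul_apply] at hb
  simp only [MonoidHom.mul_apply]
  rw [h1, h3, Real.tanh_eq_sinh_div_cosh]
  rw [show (∑ g, ψ g * ρ g) / ∑ g, ρ g + Real.sinh J / Real.cosh J *
    ((∑ g, ψ g * χ g * ρ g) / ∑ g, ρ g) = (Real.cosh J * ∑ g, ψ g * ρ g +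
      Real.sinh J * ∑ g, ψ g * χ g * ρ g) / (Real.cosh J * ∑ g, ρ g) by field_simp]
  refine div_le_div_of_nonneg_left (by positivity) (by positivity) ?_
  have : 0 ≤ Real.sinh J * ∑ g, χ g * ρ g := mul_nonneg hs hd
  linarith

theorem Ferro.gibbsAvg_mono (h2 : ∀ g : Γ, g * g = 1) {ρ ρ' : Γ → ℝ} (hρ : Ferro ρ)
    (hρ' : Ferro ρ') (ψ : Γ →* ℝ) :
    gibbsAvg ρ ψ ≤ gibbsAvg (fun g => ρ' g * ρ g) ψ := by
  induction hρ' with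
  | one => simp
  | @exp_mul ρ' J hJ χ hρ' ih =>
    refine ih.trans ?_
    have h := hρ'.mul hρ
    set τ : Γ → ℝ := fun g => ρ' g * ρ g with hτ
    have e : (fun g => Real.exp (J * χ g) * ρ' g * ρ g) =
        fun g => Real.exp (J * χ g) * τ g := by ext g; rw [hτ]; ring
    rw [e]
    unfold gibbsAvg
    have h1 := sum_mul_exp_char h2 τ ψ χ J
    have h3 := sum_mul_exp_char h2 τ (fun _ => 1) χ J
    simp only [one_mul] at h3
    have hZ := (Ferro.exp_mul hJ χ h).sum_pos
    rw [div_le_div_iff₀ h.sum_pos hZ, h1, h3]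
    have hg := h.sum_char_mul_sum_char_le h2 ψ χ
    have := mul_le_mul_of_nonneg_left hg (Real.sinh_nonneg_iff.2 hJ)
    linarith

end GriffithsKellySherman

section Ising

variable {N : ℕ}

/-- The Gibbs weight of the Ising model with couplings `J i j`, `i < j`, and field `B`. -/
noncomputable def isingWeight (J : Fin N → Fin N → ℝ) (B : ℝ) (σ : Spins N) : ℝ :=
  Real.exp ((∑ i, ∑ j ∈ Ioi i, J i j * (spin σ i * spin σ j)) + B * ∑ i, spin σ i)

/-- The local magnetization. -/
noncomputable def magn (J : Fin N → Fin N → ℝ) (B : ℝ) (i : Fin N) : ℝ :=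
  gibbsAvg (isingWeight J B) (fun σ => spin σ i)

/-- The spin at a vertex, as a character. -/
def spinChar (i : Fin N) : Spins N →* ℝ where
  toFun σ := spin σ i
  map_one' := by simp [spin]
  map_mul' σ τ := by simp [spin]

theorem spins_mul_self (σ : Spins N) : σ * σ = 1 := by
  ext i; simp [Int.units_mul_self]

theorem ferro_isingWeight {J : Fin N → Fin N → ℝ} (hJ : ∀ i j, 0 ≤ J i j) {B : ℝ} (hB : 0 ≤ B) :
    Ferro (isingWeight J B) := by
  have h1 := Ferro.exp_sum (pairs N) (fun e => J e.1 e.2)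
    (fun e => spinChar e.1 * spinChar e.2) (fun e _ => hJ _ _)
  have h2 := Ferro.exp_sum univ (fun _ : Fin N => B) (fun i => spinChar i) (fun _ _ => hB)
  convert h1.mul h2 using 2 with σ
  rw [isingWeight, Real.exp_add, sum_Ioi_eq_sum_pairs, Finset.mul_sum]
  rfl

theorem magn_nonneg {J : Fin N → Fin N → ℝ} (hJ : ∀ i j, 0 ≤ J i j) {B : ℝ} (hB : 0 ≤ B)
    (i : Fin N) : 0 ≤ magn J B i :=
  (ferro_isingWeight hJ hB).gibbsAvg_nonneg spins_mul_self (spinChar i)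

theorem magn_mono {J J' : Fin N → Fin N → ℝ} (hJ : ∀ i j, 0 ≤ J i j)
    (hJJ' : ∀ i j, J i j ≤ J' i j) {B : ℝ} (hB : 0 ≤ B) (i : Fin N) :
    magn J B i ≤ magn J' B i := by
  have h := (ferro_isingWeight hJ hB).gibbsAvg_mono spins_mul_self
    (ferro_isingWeight (J := fun i j => J' i j - J i j)
      (fun i j => sub_nonneg.2 (hJJ' i j)) le_rfl) (spinChar i)
  refine h.trans_eq ?_
  unfold magn
  congr 1
  ext σ
  rw [isingWeight, isingWeight, isingWeight, ← Real.exp_add]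
  congr 1
  rw [zero_mul, add_zero, ← add_assoc, ← Finset.sum_add_distrib]
  congr 1
  refine Finset.sum_congr rfl fun i _ => ?_
  rw [← Finset.sum_add_distrib]
  exact Finset.sum_congr rfl fun j _ => by ring

/-- The effect on the Gibbs weight of changing one coupling. -/
theorem isingWeight_change {J J' : Fin N → Fin N → ℝ} {a b : Fin N} (hab : a ≠ b)
    (hs : ∀ i j, J i j = J j i) (hs' : ∀ i j, J' i j = J' j i)
    (h : ∀ i j, s(i, j) ≠ s(a, b) → J' i j = J i j) (B : ℝ) (σ : Spins N) :
    isingWeight J' B σ =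
      Real.exp ((J' a b - J a b) * (spin σ a * spin σ b)) * isingWeight J B σ := by
  wlog hlt : a < b generalizing a b
  · rw [hs' a b, hs a b, mul_comm (spin σ a)]
    exact this hab.symm (fun i j hij => h i j (by rwa [Sym2.eq_swap (a := a)]))
      (lt_of_le_of_ne (not_lt.1 hlt) hab.symm)
  rw [isingWeight, isingWeight, ← Real.exp_add, ← add_assoc]
  congr 2
  rw [sum_Ioi_eq_sum_pairs, sum_Ioi_eq_sum_pairs]
  have hmem : (a, b) ∈ pairs N := mem_pairs.2 hlt
  rw [← Finset.add_sum_erase _ _ hmem, ← Finset.add_sum_erase _ _ hmem, ← add_assoc]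
  congr 1
  · simp only; ring
  refine Finset.sum_congr rfl fun e he => ?_
  rw [Finset.mem_erase, mem_pairs] at he
  have : s(e.1, e.2) ≠ s(a, b) := by
    intro h0
    rcases Sym2.eq_iff.1 h0 with h1 | h1
    · exact he.1 (Prod.ext h1.1 h1.2)
    · exact absurd he.2 (by rw [h1.1, h1.2]; exact not_lt_of_gt hlt)
  rw [h _ _ this]

/-- The couplings with the coupling between `a` and `b` removed. -/
noncomputable def eraseCoupling (J : Fin N → Fin N → ℝ) (a b : Fin N) (i j : Fin N) : ℝ :=
  if s(i, j) = s(a, b) then 0 else J i j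

/-- The couplings with all couplings between `a` and the complement of `s` removed. -/
noncomputable def restrictCoupling (J : Fin N → Fin N → ℝ) (a : Fin N) (s : Finset (Fin N))
    (i j : Fin N) : ℝ :=
  if (i = a ∧ j ∉ s) ∨ (j = a ∧ i ∉ s) then 0 else J i j

theorem magn_restrictCoupling_empty_le {J : Fin N → Fin N → ℝ} (hJ : ∀ i j, 0 ≤ J i j) {B : ℝ}
    (hB : 0 ≤ B) (a : Fin N) : magn (restrictCoupling J a ∅) B a ≤ Real.tanh B := by
  set K := restrictCoupling J a ∅ with hK
  have hKa : ∀ i j, i = a ∨ j = a → K i j = 0 := by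
    intro i j hij
    rw [hK, restrictCoupling, if_pos (by simpa using hij)]
  have hK0 : ∀ i j, 0 ≤ K i j := by
    intro i j
    rw [hK, restrictCoupling]; split_ifs
    exacts [le_rfl, hJ i j]
  set ρ : Spins N → ℝ := fun σ => Real.exp (∑ e ∈ pairs N, K e.1 e.2 *
    (spinChar e.1 * spinChar e.2) σ) * Real.exp (∑ i ∈ univ.erase a, B * spinChar i σ) with hρ
  have hF : Ferro ρ := (Ferro.exp_sum (pairs N) (fun e => K e.1 e.2)
    (fun e => spinChar e.1 * spinChar e.2) (fun e _ => hK0 _ _)).mul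
    (Ferro.exp_sum (univ.erase a) (fun _ : Fin N => B) (fun i => spinChar i) (fun _ _ => hB))
  have hw : isingWeight K B = fun σ => Real.exp (B * spinChar a σ) * ρ σ := by
    ext σ
    rw [hρ, isingWeight, Real.exp_add, sum_Ioi_eq_sum_pairs, Finset.mul_sum,
      ← Finset.add_sum_erase _ _ (Finset.mem_univ a), Real.exp_add]
    simp only [MonoidHom.mul_apply]
    change _ * (Real.exp (B * spin σ a) * _) = Real.exp (B * spin σ a) * (_ * _)
    rw [mul_left_comm]
    rfl
  have h0 : gibbsAvg ρ (spinChar a) = 0 := by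
    unfold gibbsAvg
    have : ∑ σ, spinChar a σ * ρ σ = -∑ σ, spinChar a σ * ρ σ := by
      rw [← Finset.sum_neg_distrib]
      refine Fintype.sum_equiv (Equiv.mulRight (Pi.mulSingle a (-1 : ℤˣ))) _ _ fun σ => ?_
      have ha : spinChar a (σ * Pi.mulSingle a (-1)) = -spinChar a σ := by
        rw [map_mul]; simp [spinChar, spin]
      have hne : ∀ i ≠ a, spinChar i (σ * Pi.mulSingle a (-1)) = spinChar i σ := by
        intro i hi
        rw [map_mul]; simp [spinChar, spin, hi]
      have hinv : ρ (σ * Pi.mulSingle a (-1)) = ρ σ := by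
        rw [hρ]
        simp only [MonoidHom.mul_apply]
        congr 2
        · refine Finset.sum_congr rfl fun e _ => ?_
          by_cases h : e.1 = a ∨ e.2 = a
          · rw [hKa _ _ h]; ring
          · push Not at h
            rw [hne _ h.1, hne _ h.2]
        · refine Finset.sum_congr rfl fun i hi => ?_
          rw [hne _ (Finset.ne_of_mem_erase hi)]
      simp only [Equiv.coe_mulRight]
      rw [hinv, ha]; ring
    rw [show ∑ σ, spinChar a σ * ρ σ = 0 by linarith, zero_div]
  have h := hF.gibbsAvg_exp_mul_le spins_mul_self hB (spinChar a) (spinChar a)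
  have h1 : gibbsAvg ρ (spinChar a * spinChar a : Spins N →* ℝ) = 1 := by
    unfold gibbsAvg
    simp only [MonoidHom.mul_apply]
    have : ∀ σ : Spins N, spinChar a σ * spinChar a σ = 1 := fun σ => spin_mul_self σ a
    simp only [this, one_mul]
    exact div_self hF.sum_pos.ne'
  rw [h0, h1, mul_one, zero_add, ← hw] at h
  exact h

/-- The local magnetization is bounded in terms of the local magnetizations at the other
vertices, each with one coupling removed. -/
theorem magn_le_tanh_add_sum {J : Fin N → Fin N → ℝ} (hJ : ∀ i j, 0 ≤ J i j)
    (hs : ∀ i j, J i j = J j i) {B : ℝ} (hB : 0 ≤ B) (a : Fin N) :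
    magn J B a ≤ Real.tanh B +
      ∑ j ∈ univ.erase a, Real.tanh (J a j) * magn (eraseCoupling J a j) B j := by
  have hR0 : ∀ s i j, 0 ≤ restrictCoupling J a s i j := by
    intro s i j
    rw [restrictCoupling]; split_ifs
    exacts [le_rfl, hJ i j]
  have hRs : ∀ s i j, restrictCoupling J a s i j = restrictCoupling J a s j i := by
    intro s i j
    simp only [restrictCoupling, hs i j, or_comm]
  have key : ∀ s ⊆ univ.erase a, magn (restrictCoupling J a s) B a ≤ Real.tanh B +
      ∑ j ∈ s, Real.tanh (J a j) * magn (eraseCoupling J a j) B j := by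
    intro s
    induction s using Finset.induction_on with
    | empty =>
      intro _
      rw [Finset.sum_empty, add_zero]
      exact magn_restrictCoupling_empty_le hJ hB a
    | insert b s hb ih =>
      intro hbs
      have hba : b ≠ a := Finset.ne_of_mem_erase (hbs (Finset.mem_insert_self b s))
      have has : a ∉ s := fun h => by simpa using hbs (Finset.mem_insert_of_mem h)
      have ih := ih fun i hi => hbs (Finset.mem_insert_of_mem hi)
      rw [Finset.sum_insert hb]
      have hch : ∀ i j, s(i, j) ≠ s(a, b) →
          restrictCoupling J a (insert b s) i j = restrictCoupling J a s i j := by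
        intro i j hij
        have h1 : ¬(i = a ∧ j = b) := fun h => hij (by rw [h.1, h.2])
        have h2 : ¬(j = a ∧ i = b) := fun h => hij (by rw [h.1, h.2, Sym2.eq_swap])
        unfold restrictCoupling
        congr 1
        simp only [Finset.mem_insert, eq_iff_iff]
        tauto
      have e1 : restrictCoupling J a (insert b s) a b = J a b := by
        simp [restrictCoupling, hba]
      have e2 : restrictCoupling J a s a b = 0 := by
        simp [restrictCoupling, hb]
      have hwt : isingWeight (restrictCoupling J a (insert b s)) B = fun σ =>
          Real.exp (J a b * (spinChar a * spinChar b : Spins N →* ℝ) σ) *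
            isingWeight (restrictCoupling J a s) B σ := by
        ext σ
        rw [isingWeight_change hba.symm (hRs s) (hRs (insert b s)) hch, e1, e2, sub_zero]
        rfl
      have h := (ferro_isingWeight (hR0 s) hB).gibbsAvg_exp_mul_le spins_mul_self (hJ a b)
        (spinChar a * spinChar b) (spinChar a)
      rw [← hwt] at h
      have e3 : (spinChar a * (spinChar a * spinChar b) : Spins N →* ℝ) = spinChar b := by
        refine MonoidHom.ext fun σ => ?_
        simp only [MonoidHom.mul_apply]
        rw [← mul_assoc, show spinChar a σ * spinChar a σ = 1 from spin_mul_self σ a, one_mul]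
      rw [e3] at h
      have h' : magn (restrictCoupling J a (insert b s)) B a ≤
          magn (restrictCoupling J a s) B a +
            Real.tanh (J a b) * magn (restrictCoupling J a s) B b := h
      have hm : magn (restrictCoupling J a s) B b ≤ magn (eraseCoupling J a b) B b := by
        refine magn_mono (hR0 s) (fun i j => ?_) hB b
        unfold eraseCoupling
        split_ifs with hij
        · rcases Sym2.eq_iff.1 hij with ⟨rfl, rfl⟩ | ⟨rfl, rfl⟩
          · exact e2.le
          · rw [hRs]; exact e2.le
        · unfold restrictCoupling
          split_ifs
          exacts [hJ i j, le_rfl]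
      have ht : 0 ≤ Real.tanh (J a b) := by
        rw [Real.tanh_eq_sinh_div_cosh]
        exact div_nonneg (Real.sinh_nonneg_iff.2 (hJ a b)) (Real.cosh_pos _).le
      have := mul_le_mul_of_nonneg_left hm ht
      linarith
  have hw : isingWeight (restrictCoupling J a (univ.erase a)) B = isingWeight J B := by
    ext σ
    rw [isingWeight, isingWeight, sum_Ioi_eq_sum_pairs, sum_Ioi_eq_sum_pairs]
    congr 2
    refine Finset.sum_congr rfl fun e he => ?_
    rw [mem_pairs] at he
    have : restrictCoupling J a (univ.erase a) e.1 e.2 = J e.1 e.2 := by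
      rw [restrictCoupling, if_neg]
      simp only [Finset.mem_erase, Finset.mem_univ, and_true, not_not]
      rintro (h | h)
      · exact he.ne (h.1.trans h.2.symm)
      · exact he.ne (h.2.trans h.1.symm)
    rw [this]
  have h := key (univ.erase a) subset_rfl
  rwa [magn, hw] at h

end Ising

section MeanFieldBound

variable {N : ℕ} {w : Fin N → ℝ}

/-- A linear inequality for local magnetizations on a rank-one graph, summed up. -/
theorem mean_le_of_linear_bound (hw : ∀ i, 0 < w i) {m : Fin N → ℝ} {T c : ℝ}
    (hc : 0 ≤ c) (hc1 : c * ((∑ i, w i ^ 2) / totalWeight w) < 1)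
    (hm : ∀ i, m i ≤ T + c * ∑ j, edgeOdds w i j * m j) (hN : 0 < N) :
    (∑ i, m i) / N ≤
      T * (1 + c * (totalWeight w / N) / (1 - c * ((∑ i, w i ^ 2) / totalWeight w))) := by
  have hl := totalWeight_pos hw ⟨0, hN⟩
  have hN' : (0 : ℝ) < N := by exact_mod_cast hN
  set ℓ := totalWeight w with hℓ
  set Y := ∑ j, w j * m j with hY
  set ν := (∑ i, w i ^ 2) / ℓ with hν
  have h1 : ∀ i, m i ≤ T + c * (w i * (Y / ℓ)) := by
    intro i
    refine (hm i).trans_eq ?_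
    rw [hY, Finset.sum_div, Finset.mul_sum (s := univ) (a := w i)]
    congr 2
    exact Finset.sum_congr rfl fun j _ => by rw [edgeOdds]; ring
  have h2 : Y ≤ T * ℓ + c * ν * Y := by
    calc Y ≤ ∑ i, w i * (T + c * (w i * (Y / ℓ))) :=
          Finset.sum_le_sum fun i _ => mul_le_mul_of_nonneg_left (h1 i) (hw i).le
      _ = T * ∑ i, w i + c * (Y / ℓ) * ∑ i, w i ^ 2 := by
          rw [Finset.mul_sum, Finset.mul_sum, ← Finset.sum_add_distrib]
          exact Finset.sum_congr rfl fun i _ => by ring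
      _ = T * ℓ + c * ν * Y := by rw [hν, hℓ, totalWeight]; ring
  have h3 : Y ≤ T * ℓ / (1 - c * ν) := by
    rw [le_div_iff₀ (by linarith)]; linarith
  have h4 : ∑ i, m i ≤ T * N + c * Y := by
    calc ∑ i, m i ≤ ∑ i, (T + c * (w i * (Y / ℓ))) := Finset.sum_le_sum fun i _ => h1 i
      _ = T * N + c * (Y / ℓ) * ∑ i, w i := by
          rw [Finset.sum_add_distrib, Finset.mul_sum]
          simp only [Finset.sum_const, Finset.card_univ, Fintype.card_fin, nsmul_eq_mul]
          rw [mul_comm (N : ℝ)]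
          congr 1
          exact Finset.sum_congr rfl fun i _ => by ring
      _ = T * N + c * Y := by
          rw [show ∑ i, w i = ℓ from rfl]; field_simp
  have h5 := mul_le_mul_of_nonneg_left h3 hc
  rw [div_le_iff₀ hN']
  have hd : 0 < 1 - c * ν := by linarith
  calc ∑ i, m i ≤ T * N + c * (T * ℓ / (1 - c * ν)) := by linarith
    _ = _ := by field_simp

theorem sum_erase_le_of_edgeOdds (hw : ∀ i, 0 < w i) {m : Fin N → ℝ} (hm : ∀ i, 0 ≤ m i)
    (a : Fin N) : ∑ j ∈ univ.erase a, edgeOdds w a j * m j ≤ ∑ j, edgeOdds w a j * m j :=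
  Finset.sum_le_sum_of_subset_of_nonneg (Finset.erase_subset _ _)
    fun j _ _ => mul_nonneg (edgeOdds_pos hw a j).le (hm j)

theorem tanh_nonneg {x : ℝ} (hx : 0 ≤ x) : 0 ≤ Real.tanh x := by
  rw [Real.tanh_eq_sinh_div_cosh]
  exact div_nonneg (Real.sinh_nonneg_iff.2 hx) (Real.cosh_pos _).le

/-- The couplings of the Ising model on a graph. -/
noncomputable def graphCoupling (G : SimpleGraph (Fin N)) (β : ℝ) (i j : Fin N) : ℝ :=
  if G.Adj i j then β else 0

theorem graphCoupling_nonneg (G : SimpleGraph (Fin N)) {β : ℝ} (hβ : 0 ≤ β) (i j : Fin N) :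
    0 ≤ graphCoupling G β i j := by
  unfold graphCoupling; split_ifs
  exacts [hβ, le_rfl]

theorem boltzmann_eq (G : SimpleGraph (Fin N)) (β B : ℝ) :
    boltzmann G β B = isingWeight (graphCoupling G β) B := by
  ext σ
  rw [boltzmann, isingWeight, Finset.mul_sum]
  congr 2
  refine Finset.sum_congr rfl fun i _ => ?_
  rw [Finset.mul_sum]
  refine Finset.sum_congr rfl fun j _ => ?_
  unfold graphCoupling
  split_ifs <;> simp

theorem sum_graphProb (w : Fin N → ℝ) : ∑ G, graphProb w G = 1 := by
  unfold graphProb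
  rw [sum_graph_prod]
  simp

theorem quenchedMagn_eq (w : Fin N → ℝ) (β B : ℝ) : quenchedMagn w β B =
    (∑ i, ∑ G, graphProb w G * magn (graphCoupling G β) B i) / N := by
  unfold quenchedMagn graphExpect
  rw [Finset.sum_comm, Finset.sum_div]
  refine Finset.sum_congr rfl fun G _ => ?_
  rw [← Finset.mul_sum, mul_div_assoc]
  congr 1
  unfold magn gibbsAvg partitionFn totalSpin
  rw [← Finset.sum_div, Finset.sum_comm, Finset.sum_div, Finset.sum_div]
  refine Finset.sum_congr rfl fun σ _ => ?_
  rw [boltzmann_eq, ← Finset.sum_mul]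
  ring

/-- At high temperature, the averaged quenched magnetization is at most linear in the field. -/
theorem quenchedMagn_le (hw : ∀ i, 0 < w i) {β B : ℝ} (hβ : 0 ≤ β) (hB : 0 ≤ B) (hN : 0 < N)
    (h1 : Real.tanh β * ((∑ i, w i ^ 2) / totalWeight w) < 1) :
    quenchedMagn w β B ≤ Real.tanh B * (1 + Real.tanh β * (totalWeight w / N) /
      (1 - Real.tanh β * ((∑ i, w i ^ 2) / totalWeight w))) := by
  rw [quenchedMagn_eq]
  have hm0 : ∀ (G : SimpleGraph (Fin N)) i, 0 ≤ graphProb w G * magn (graphCoupling G β) B i :=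
    fun G i => mul_nonneg (graphProb_nonneg hw G) (magn_nonneg (graphCoupling_nonneg G hβ) hB i)
  refine mean_le_of_linear_bound hw (tanh_nonneg hβ) h1 (fun a => ?_) hN
  have hstep : ∀ j ∈ univ.erase a, ∑ G : SimpleGraph (Fin N), graphProb w G *
      (Real.tanh (graphCoupling G β a j) * magn (eraseCoupling (graphCoupling G β) a j) B j) ≤
      Real.tanh β * (edgeOdds w a j * ∑ G, graphProb w G * magn (graphCoupling G β) B j) := by
    intro j hj
    have haj : a ≠ j := (Finset.ne_of_mem_erase hj).symm
    set S : Finset (SimpleGraph (Fin N)) := univ.filter fun G => G.Adj a j with hS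
    have hE : ∀ G : SimpleGraph (Fin N),
        eraseCoupling (graphCoupling G β) a j = graphCoupling (G.deleteEdges {s(a, j)}) β := by
      intro G
      ext x y
      unfold eraseCoupling graphCoupling
      by_cases h : s(x, y) = s(a, j) <;> simp [h, SimpleGraph.deleteEdges_adj]
    have hinj : Set.InjOn (fun G : SimpleGraph (Fin N) => G.deleteEdges {s(a, j)}) S := by
      intro G hG G' hG' h
      simp only [hS, Finset.coe_filter, Finset.mem_univ, true_and, Set.mem_ofPred_eq] at hG hG'
      ext x y
      have hxy : (G.deleteEdges {s(a, j)}).Adj x y ↔ (G'.deleteEdges {s(a, j)}).Adj x y := by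
        rw [show G.deleteEdges {s(a, j)} = G'.deleteEdges {s(a, j)} from h]
      simp only [SimpleGraph.deleteEdges_adj, Set.mem_singleton_iff] at hxy
      by_cases h' : s(x, y) = s(a, j)
      · rw [← SimpleGraph.mem_edgeSet, ← SimpleGraph.mem_edgeSet, h']
        exact iff_of_true hG hG'
      · simpa [h'] using hxy
    calc ∑ G : SimpleGraph (Fin N), graphProb w G *
        (Real.tanh (graphCoupling G β a j) * magn (eraseCoupling (graphCoupling G β) a j) B j)
        = ∑ G ∈ S, Real.tanh β * (edgeOdds w a j * (graphProb w (G.deleteEdges {s(a, j)}) *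
            magn (graphCoupling (G.deleteEdges {s(a, j)}) β) B j)) := by
          rw [hS, Finset.sum_filter]
          refine Finset.sum_congr rfl fun G _ => ?_
          rw [hE]
          by_cases hG : G.Adj a j
          · rw [if_pos hG, graphProb_eq_odds_mul hw haj (G := G.deleteEdges {s(a, j)}) (G' := G)
              (by simp [SimpleGraph.deleteEdges_adj]) hG
              (fun x y hxy => by simp [SimpleGraph.deleteEdges_adj, hxy])]
            simp only [graphCoupling, if_pos hG]
            ring
          · rw [if_neg hG]; simp [graphCoupling, hG]
      _ = ∑ G ∈ S.image (fun G => G.deleteEdges {s(a, j)}), Real.tanh β * (edgeOdds w a j *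
            (graphProb w G * magn (graphCoupling G β) B j)) := by
          rw [Finset.sum_image hinj]
      _ ≤ ∑ G, Real.tanh β * (edgeOdds w a j *
            (graphProb w G * magn (graphCoupling G β) B j)) := by
          refine Finset.sum_le_sum_of_subset_of_nonneg (Finset.subset_univ _) fun G _ _ => ?_
          exact mul_nonneg (tanh_nonneg hβ) (mul_nonneg (edgeOdds_pos hw a j).le (hm0 G j))
      _ = _ := by rw [← Finset.mul_sum, ← Finset.mul_sum]
  calc ∑ G, graphProb w G * magn (graphCoupling G β) B a
      ≤ ∑ G, graphProb w G * (Real.tanh B + ∑ j ∈ univ.erase a,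
          Real.tanh (graphCoupling G β a j) * magn (eraseCoupling (graphCoupling G β) a j) B j) :=
        Finset.sum_le_sum fun G _ => mul_le_mul_of_nonneg_left
          (magn_le_tanh_add_sum (graphCoupling_nonneg G hβ)
            (fun i j => by simp only [graphCoupling, G.adj_comm]) hB a) (graphProb_nonneg hw G)
    _ = Real.tanh B + ∑ j ∈ univ.erase a, ∑ G : SimpleGraph (Fin N), graphProb w G *
          (Real.tanh (graphCoupling G β a j) *
            magn (eraseCoupling (graphCoupling G β) a j) B j) := by
        simp_rw [mul_add, Finset.sum_add_distrib, ← Finset.sum_mul, sum_graphProb, one_mul,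
          Finset.mul_sum]
        rw [Finset.sum_comm]
    _ ≤ Real.tanh B + ∑ j ∈ univ.erase a, Real.tanh β * (edgeOdds w a j *
          ∑ G, graphProb w G * magn (graphCoupling G β) B j) := by
        gcongr with j hj
        exact hstep j hj
    _ ≤ _ := by
        rw [← Finset.mul_sum]
        refine add_le_add_right (mul_le_mul_of_nonneg_left ?_ (tanh_nonneg hβ)) _
        · exact sum_erase_le_of_edgeOdds hw (fun j => Finset.sum_nonneg fun G _ => hm0 G j) a

end MeanFieldBound

section EffectiveCoupling

variable {N : ℕ} {w : Fin N → ℝ}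

theorem effCoupling_eq (hw : ∀ i, 0 < w i) (β : ℝ) (i j : Fin N) : effCoupling w β i j =
    (Real.log (1 + edgeProb w i j * (Real.exp β - 1)) -
      Real.log (1 + edgeProb w i j * (Real.exp (-β) - 1))) / 2 := by
  rw [← Real.log_div (one_add_edgeProb_mul_pos hw i j _).ne'
    (one_add_edgeProb_mul_pos hw i j _).ne', effCoupling]
  rw [show Real.exp β * edgeProb w i j + (1 - edgeProb w i j) =
    1 + edgeProb w i j * (Real.exp β - 1) by ring,
    show Real.exp (-β) * edgeProb w i j + (1 - edgeProb w i j) =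
    1 + edgeProb w i j * (Real.exp (-β) - 1) by ring]
  ring

theorem effConst_eq (hw : ∀ i, 0 < w i) (β : ℝ) (i j : Fin N) : effConst w β i j =
    Real.exp ((Real.log (1 + edgeProb w i j * (Real.exp β - 1)) +
      Real.log (1 + edgeProb w i j * (Real.exp (-β) - 1))) / 2) := by
  have hu := one_add_edgeProb_mul_pos hw i j β
  have hv := one_add_edgeProb_mul_pos hw i j (-β)
  rw [effConst, div_eq_iff (Real.cosh_pos _).ne', effCoupling_eq hw]
  set u := 1 + edgeProb w i j * (Real.exp β - 1) with hu'
  set v := 1 + edgeProb w i j * (Real.exp (-β) - 1) with hv'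
  rw [Real.cosh_eq β, Real.cosh_eq ((Real.log u - Real.log v) / 2),
    ← mul_div_assoc (Real.exp ((Real.log u + Real.log v) / 2)), mul_add, ← Real.exp_add,
    ← Real.exp_add, show (Real.log u + Real.log v) / 2 + (Real.log u - Real.log v) / 2 = Real.log u by ring,
    show (Real.log u + Real.log v) / 2 + -((Real.log u - Real.log v) / 2) = Real.log v by ring,
    Real.exp_log hu, Real.exp_log hv]
  rw [hu', hv']; ring

theorem effConst_mul_exp (hw : ∀ i, 0 < w i) (β : ℝ) (i j : Fin N) (σ : Spins N) :
    effConst w β i j * Real.exp (effCoupling w β i j * (spin σ i * spin σ j)) =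
      1 + edgeProb w i j * (Real.exp (β * (spin σ i * spin σ j)) - 1) := by
  have hu := one_add_edgeProb_mul_pos hw i j β
  have hv := one_add_edgeProb_mul_pos hw i j (-β)
  rw [effConst_eq hw, effCoupling_eq hw, ← Real.exp_add]
  rcases spin_mul_eq σ i j with h | h
  · rw [h, mul_one, mul_one, ← add_div, show ∀ a b : ℝ, (a + b + (a - b)) / 2 = a by intros; ring,
      Real.exp_log hu]
  · rw [h, mul_neg_one, mul_neg_one, show ∀ a b : ℝ, (a + b) / 2 + -((a - b) / 2) = b by
      intros; ring, Real.exp_log hv]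

theorem effCoupling_comm (β : ℝ) (i j : Fin N) : effCoupling w β i j = effCoupling w β j i := by
  rw [effCoupling, effCoupling, edgeProb_comm]

theorem effCoupling_nonneg (hw : ∀ i, 0 < w i) {β : ℝ} (hβ : 0 ≤ β) (i j : Fin N) :
    0 ≤ effCoupling w β i j := by
  rw [effCoupling_eq hw]
  have hv := one_add_edgeProb_mul_pos hw i j (-β)
  have : Real.log (1 + edgeProb w i j * (Real.exp (-β) - 1)) ≤
      Real.log (1 + edgeProb w i j * (Real.exp β - 1)) := by
    refine Real.log_le_log hv ?_
    have := edgeProb_pos hw i j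
    have : Real.exp (-β) ≤ Real.exp β := Real.exp_le_exp.2 (by linarith)
    gcongr
  linarith

theorem tanh_effCoupling_le (hw : ∀ i, 0 < w i) {β : ℝ} (hβ : 0 ≤ β) (i j : Fin N) :
    Real.tanh (effCoupling w β i j) ≤ Real.sinh β * edgeOdds w i j := by
  have hu := one_add_edgeProb_mul_pos hw i j β
  have hv := one_add_edgeProb_mul_pos hw i j (-β)
  have hp := edgeProb_pos hw i j
  have hs := Real.sinh_nonneg_iff.2 hβ
  have hC : effConst w β i j ≠ 0 := by rw [effConst_eq hw]; exact (Real.exp_pos _).ne'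
  have h1 : effConst w β i j * Real.exp (effCoupling w β i j) =
      1 + edgeProb w i j * (Real.exp β - 1) := by
    rw [effConst_eq hw, effCoupling_eq hw, ← Real.exp_add, ← add_div,
      show ∀ a b : ℝ, (a + b + (a - b)) / 2 = a by intros; ring, Real.exp_log hu]
  have h2 : effConst w β i j * Real.exp (-effCoupling w β i j) =
      1 + edgeProb w i j * (Real.exp (-β) - 1) := by
    rw [effConst_eq hw, effCoupling_eq hw, ← Real.exp_add,
      show ∀ a b : ℝ, (a + b) / 2 + -((a - b) / 2) = b by intros; ring, Real.exp_log hv]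
  have hch : Real.cosh β = (Real.exp β + Real.exp (-β)) / 2 := Real.cosh_eq β
  have hsh : Real.sinh β = (Real.exp β - Real.exp (-β)) / 2 := Real.sinh_eq β
  have h3 : Real.tanh (effCoupling w β i j) = (edgeProb w i j * Real.sinh β) /
      (1 + edgeProb w i j * (Real.cosh β - 1)) := by
    rw [Real.tanh_eq_sinh_div_cosh, ← mul_div_mul_left _ _ hC, Real.sinh_eq, Real.cosh_eq,
      mul_div_assoc', mul_div_assoc', mul_sub, mul_add, h1, h2, hch, hsh]
    congr 1 <;> ring
  have h4 : 1 ≤ 1 + edgeProb w i j * (Real.cosh β - 1) := by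
    have := mul_nonneg hp.le (sub_nonneg.2 (Real.one_le_cosh β))
    linarith
  rw [h3]
  calc _ ≤ edgeProb w i j * Real.sinh β := div_le_self (by positivity) h4
    _ ≤ edgeOdds w i j * Real.sinh β := mul_le_mul_of_nonneg_right (edgeProb_le_odds hw i j) hs
    _ = _ := mul_comm _ _

/-- The annealed model is an Ising model with couplings `β_ij`. -/
theorem annealedWeight_mul_exp (hw : ∀ i, 0 < w i) (β B : ℝ) (σ : Spins N) :
    annealedWeight w β σ * Real.exp (B * totalSpin σ) =
      (∏ i, ∏ j ∈ Ioi i, effConst w β i j) * isingWeight (effCoupling w β) B σ := by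
  unfold isingWeight annealedWeight totalSpin
  rw [Real.exp_add, ← mul_assoc]
  congr 1
  simp_rw [Real.exp_sum, ← Finset.prod_mul_distrib, effConst_mul_exp hw]

theorem annealedMagn_eq_magn (hw : ∀ i, 0 < w i) (β B : ℝ) :
    annealedMagn w β B = (∑ i, magn (effCoupling w β) B i) / N := by
  rw [annealedMagn_eq]
  congr 1
  unfold fieldMoment magn gibbsAvg
  simp_rw [annealedWeight_mul_exp hw, pow_one, pow_zero, mul_one]
  rw [← Finset.sum_div, Finset.sum_comm, ← Finset.mul_sum]
  simp_rw [mul_assoc, ← Finset.mul_sum]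
  rw [mul_div_mul_left]
  · congr 1
    refine Finset.sum_congr rfl fun σ _ => ?_
    rw [totalSpin, ← Finset.sum_mul, mul_comm]
  · refine Finset.prod_ne_zero_iff.2 fun i _ => Finset.prod_ne_zero_iff.2 fun j _ => ?_
    rw [effConst_eq hw]; exact (Real.exp_pos _).ne'

/-- In the subcritical regime, the annealed magnetization is at most linear in the field. -/
theorem annealedMagn_le (hw : ∀ i, 0 < w i) {β B : ℝ} (hβ : 0 ≤ β) (hB : 0 ≤ B) (hN : 0 < N)
    (h1 : Real.sinh β * ((∑ i, w i ^ 2) / totalWeight w) < 1) :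
    annealedMagn w β B ≤ Real.tanh B * (1 + Real.sinh β * (totalWeight w / N) /
      (1 - Real.sinh β * ((∑ i, w i ^ 2) / totalWeight w))) := by
  rw [annealedMagn_eq_magn hw]
  have hJ := effCoupling_nonneg hw hβ
  have hs := Real.sinh_nonneg_iff.2 hβ
  have hm0 : ∀ i, 0 ≤ magn (effCoupling w β) B i := magn_nonneg hJ hB
  refine mean_le_of_linear_bound hw hs h1 (fun a => ?_) hN
  refine (magn_le_tanh_add_sum hJ (effCoupling_comm β) hB a).trans ?_
  gcongr
  calc _ ≤ ∑ j ∈ univ.erase a, Real.sinh β * (edgeOdds w a j * magn (effCoupling w β) B j) := by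
        refine Finset.sum_le_sum fun j _ => ?_
        rw [← mul_assoc]
        have h0 : ∀ x y, 0 ≤ eraseCoupling (effCoupling w β) a j x y := by
          intro x y
          unfold eraseCoupling; split_ifs
          exacts [le_rfl, hJ x y]
        refine mul_le_mul (tanh_effCoupling_le hw hβ a j) (magn_mono h0 (fun x y => ?_) hB j)
          (magn_nonneg h0 hB j) (mul_nonneg hs (edgeOdds_pos hw a j).le)
        unfold eraseCoupling; split_ifs
        exacts [hJ x y, le_rfl]
    _ ≤ _ := by
        rw [← Finset.mul_sum]
        exact mul_le_mul_of_nonneg_left (sum_erase_le_of_edgeOdds hw hm0 a) hs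

end EffectiveCoupling
end AnnealedGRG

namespace AnnealedGRG
open scoped Classical

section GriffithsHurstSherman

/-- The spins of four replicas at one site. -/
abbrev FourSpins : Type := ℤˣ × ℤˣ × ℤˣ × ℤˣ

/-- The rotated spins of four replicas. -/
def rotSpin (k : Fin 4) (q : FourSpins) : ℝ :=
  match k with
  | 0 => ((q.1 : ℤ) : ℝ) + ((q.2.1 : ℤ) : ℝ) + ((q.2.2.1 : ℤ) : ℝ) + ((q.2.2.2 : ℤ) : ℝ)
  | 1 => ((q.1 : ℤ) : ℝ) + ((q.2.1 : ℤ) : ℝ) - ((q.2.2.1 : ℤ) : ℝ) - ((q.2.2.2 : ℤ) : ℝ)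
  | 2 => ((q.1 : ℤ) : ℝ) - ((q.2.1 : ℤ) : ℝ) + ((q.2.2.1 : ℤ) : ℝ) - ((q.2.2.2 : ℤ) : ℝ)
  | 3 => -((q.1 : ℤ) : ℝ) + ((q.2.1 : ℤ) : ℝ) + ((q.2.2.1 : ℤ) : ℝ) - ((q.2.2.2 : ℤ) : ℝ)

theorem sum_rotSpin_nonneg (n : Fin 4 → ℕ) : 0 ≤ ∑ q : FourSpins, ∏ k, rotSpin k q ^ n k := by
  simp only [Fintype.sum_prod_type, Fin.prod_univ_four, UnitsInt.univ, rotSpin]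
  rw [Finset.sum_pair (by decide)]
  simp only [Finset.sum_pair (show (1 : ℤˣ) ≠ -1 by decide)]
  generalize n 0 = a
  generalize n 1 = b
  generalize n 2 = c
  generalize n 3 = d
  norm_num
  simp only [neg_pow (4 : ℝ), neg_pow (2 : ℝ)]
  have hz : ∀ m : ℕ, (0 : ℝ) ≤ 0 ^ m := fun m => by positivity
  have ha := hz a
  have hb := hz b
  have hc := hz c
  have hd := hz d
  generalize (0 : ℝ) ^ a = za at *
  generalize (0 : ℝ) ^ b = zb at *
  generalize (0 : ℝ) ^ c = zc at *
  generalize (0 : ℝ) ^ d = zd at *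
  rcases neg_one_pow_eq_or ℝ a with h1 | h1 <;> rcases neg_one_pow_eq_or ℝ b with h2 | h2 <;>
    rcases neg_one_pow_eq_or ℝ c with h3 | h3 <;> rcases neg_one_pow_eq_or ℝ d with h4 | h4 <;>
    rw [h1, h2, h3, h4] <;> ring_nf <;> positivity

variable {N : ℕ}

/-- Monomials in the rotated spins. -/
def rotMonomial (n : Fin N → Fin 4 → ℕ) (τ : Fin N → FourSpins) : ℝ :=
  ∏ i, ∏ k, rotSpin k (τ i) ^ n i k

theorem rotMonomial_add (n m : Fin N → Fin 4 → ℕ) (τ : Fin N → FourSpins) :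
    rotMonomial (n + m) τ = rotMonomial n τ * rotMonomial m τ := by
  simp only [rotMonomial, Pi.add_apply, pow_add, Finset.prod_mul_distrib]

theorem rotMonomial_single (i : Fin N) (k : Fin 4) (τ : Fin N → FourSpins) :
    rotMonomial (Pi.single i (Pi.single k 1)) τ = rotSpin k (τ i) := by
  unfold rotMonomial
  rw [Finset.prod_eq_single i, Finset.prod_eq_single k]
  · simp
  · intro l _ hl; simp [hl]
  · simp
  · intro j _ hj; simp [hj]
  · simp

/-- Functions whose product with every monomial has nonnegative sum. -/
def RotPos (f : (Fin N → FourSpins) → ℝ) : Prop :=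
  ∀ n : Fin N → Fin 4 → ℕ, 0 ≤ ∑ τ, f τ * rotMonomial n τ

theorem RotPos.one : RotPos (fun _ : Fin N → FourSpins => 1) := by
  intro n
  simp only [one_mul, rotMonomial]
  have := Finset.prod_univ_sum (fun _ : Fin N => (univ : Finset FourSpins))
    (fun i q => ∏ k, rotSpin k q ^ n i k)
  rw [Fintype.piFinset_univ] at this
  rw [← this]
  exact Finset.prod_nonneg fun i _ => sum_rotSpin_nonneg (n i)

theorem RotPos.exp_mul {f : (Fin N → FourSpins) → ℝ} (hf : RotPos f) {J : ℝ} (hJ : 0 ≤ J)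
    (m : Fin N → Fin 4 → ℕ) : RotPos (fun τ => Real.exp (J * rotMonomial m τ) * f τ) := by
  intro n
  have hs : ∀ τ, HasSum (fun k : ℕ => (J * rotMonomial m τ) ^ k / (k.factorial : ℝ) *
      f τ * rotMonomial n τ) (Real.exp (J * rotMonomial m τ) * f τ * rotMonomial n τ) := by
    intro τ
    have := NormedSpace.expSeries_div_hasSum_exp (J * rotMonomial m τ)
    rw [← Real.exp_eq_exp_ℝ] at this
    exact (this.mul_right _).mul_right _
  have h := hasSum_sum (s := univ) fun τ _ => hs τ
  refine h.nonneg fun k => ?_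
  have hk : ∀ k : ℕ, ∀ τ, rotMonomial (k • m + n) τ = rotMonomial m τ ^ k * rotMonomial n τ := by
    intro k τ
    induction k with
    | zero => simp
    | succ k ih =>
      rw [add_smul, one_smul, add_right_comm, rotMonomial_add, ih]; ring
  have h2 : ∑ τ, (J * rotMonomial m τ) ^ k / (k.factorial : ℝ) * f τ * rotMonomial n τ =
      J ^ k / (k.factorial : ℝ) * ∑ τ, f τ * rotMonomial (k • m + n) τ := by
    rw [Finset.mul_sum]
    refine Finset.sum_congr rfl fun τ _ => ?_
    rw [hk, mul_pow]; ring
  rw [h2]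
  exact mul_nonneg (by positivity) (hf _)

theorem RotPos.exp_sum_mul {ι : Type*} (s : Finset ι) {f : (Fin N → FourSpins) → ℝ}
    (hf : RotPos f) {J : ι → ℝ} (hJ : ∀ i, 0 ≤ J i) (m : ι → Fin N → Fin 4 → ℕ) :
    RotPos (fun τ => Real.exp (∑ i ∈ s, J i * rotMonomial (m i) τ) * f τ) := by
  induction s using Finset.induction_on with
  | empty => simpa using hf
  | insert a s ha ih =>
    have := ih.exp_mul (hJ a) (m a)
    simp_rw [Finset.sum_insert ha, Real.exp_add, mul_assoc]
    exact this

/-- The four replicas of a configuration. -/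
def fourSpinsEquiv (N : ℕ) :
    (Fin N → FourSpins) ≃ Spins N × Spins N × Spins N × Spins N where
  toFun τ := (fun i => (τ i).1, fun i => (τ i).2.1, fun i => (τ i).2.2.1, fun i => (τ i).2.2.2)
  invFun p i := (p.1 i, p.2.1 i, p.2.2.1 i, p.2.2.2 i)
  left_inv _ := rfl
  right_inv _ := rfl

theorem four_isingWeight (J : Fin N → Fin N → ℝ) (B : ℝ) (a b c d : Spins N) :
    isingWeight J B a * isingWeight J B b * isingWeight J B c * isingWeight J B d =
      Real.exp (∑ x ∈ pairs N ×ˢ (univ : Finset (Fin 4)), J x.1.1 x.1.2 / 4 *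
        rotMonomial (Pi.single x.1.1 (Pi.single x.2 1) + Pi.single x.1.2 (Pi.single x.2 1))
          ((fourSpinsEquiv N).symm (a, b, c, d))) *
      (Real.exp (∑ i, B * rotMonomial (Pi.single i (Pi.single 0 1))
          ((fourSpinsEquiv N).symm (a, b, c, d))) * 1) := by
  unfold isingWeight
  rw [← Real.exp_add, ← Real.exp_add, ← Real.exp_add, mul_one, ← Real.exp_add]
  congr 1
  simp only [rotMonomial_add, rotMonomial_single, Finset.sum_product, Fin.sum_univ_four,
    sum_Ioi_eq_sum_pairs (N := N), ← Finset.mul_sum]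
  have h1 : ∑ i, rotSpin 0 ((fourSpinsEquiv N).symm (a, b, c, d) i) =
      ∑ i, spin a i + ∑ i, spin b i + ∑ i, spin c i + ∑ i, spin d i := by
    rw [← Finset.sum_add_distrib, ← Finset.sum_add_distrib, ← Finset.sum_add_distrib]
    rfl
  have h2 : ∀ f : Fin N × Fin N → ℝ, ∀ g h k l : Fin N × Fin N → ℝ,
      (∀ e, f e = g e + h e + k e + l e) → ∑ e ∈ pairs N, f e = ∑ e ∈ pairs N, g e +
        ∑ e ∈ pairs N, h e + ∑ e ∈ pairs N, k e + ∑ e ∈ pairs N, l e := by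
    intro f g h k l hf
    rw [← Finset.sum_add_distrib, ← Finset.sum_add_distrib, ← Finset.sum_add_distrib]
    exact Finset.sum_congr rfl fun e _ => hf e
  have h3 := h2 (fun e => J e.1 e.2 / 4 *
      (rotSpin 0 ((fourSpinsEquiv N).symm (a, b, c, d) e.1) *
        rotSpin 0 ((fourSpinsEquiv N).symm (a, b, c, d) e.2) +
      rotSpin 1 ((fourSpinsEquiv N).symm (a, b, c, d) e.1) *
        rotSpin 1 ((fourSpinsEquiv N).symm (a, b, c, d) e.2) +
      rotSpin 2 ((fourSpinsEquiv N).symm (a, b, c, d) e.1) *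
        rotSpin 2 ((fourSpinsEquiv N).symm (a, b, c, d) e.2) +
      rotSpin 3 ((fourSpinsEquiv N).symm (a, b, c, d) e.1) *
        rotSpin 3 ((fourSpinsEquiv N).symm (a, b, c, d) e.2)))
    (fun e => J e.1 e.2 * (spin a e.1 * spin a e.2))
    (fun e => J e.1 e.2 * (spin b e.1 * spin b e.2))
    (fun e => J e.1 e.2 * (spin c e.1 * spin c e.2))
    (fun e => J e.1 e.2 * (spin d e.1 * spin d e.2)) (by
    intro e
    change J e.1 e.2 / 4 * ((spin a e.1 + spin b e.1 + spin c e.1 + spin d e.1) *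
        (spin a e.2 + spin b e.2 + spin c e.2 + spin d e.2) +
      (spin a e.1 + spin b e.1 - spin c e.1 - spin d e.1) *
        (spin a e.2 + spin b e.2 - spin c e.2 - spin d e.2) +
      (spin a e.1 - spin b e.1 + spin c e.1 - spin d e.1) *
        (spin a e.2 - spin b e.2 + spin c e.2 - spin d e.2) +
      (-spin a e.1 + spin b e.1 + spin c e.1 - spin d e.1) *
        (-spin a e.2 + spin b e.2 + spin c e.2 - spin d e.2)) = _
    ring)
  rw [h1, h3]
  ring

theorem sum_four_nonneg {J : Fin N → Fin N → ℝ} (hJ : ∀ i j, 0 ≤ J i j) {B : ℝ} (hB : 0 ≤ B) :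
    0 ≤ ∑ p : Spins N × Spins N × Spins N × Spins N,
      isingWeight J B p.1 * isingWeight J B p.2.1 * isingWeight J B p.2.2.1 *
        isingWeight J B p.2.2.2 *
      ((totalSpin p.1 + totalSpin p.2.1 - totalSpin p.2.2.1 - totalSpin p.2.2.2) *
        (totalSpin p.1 - totalSpin p.2.1 + totalSpin p.2.2.1 - totalSpin p.2.2.2) *
        (-totalSpin p.1 + totalSpin p.2.1 + totalSpin p.2.2.1 - totalSpin p.2.2.2)) := by
  obtain ⟨f, hf⟩ : ∃ f : (Fin N → FourSpins) → ℝ, f = fun τ =>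
    Real.exp (∑ x ∈ pairs N ×ˢ (univ : Finset (Fin 4)), J x.1.1 x.1.2 / 4 *
      rotMonomial (Pi.single x.1.1 (Pi.single x.2 1) + Pi.single x.1.2 (Pi.single x.2 1)) τ) *
    (Real.exp (∑ i, B * rotMonomial (Pi.single i (Pi.single 0 1)) τ) * 1) := ⟨_, rfl⟩
  have hpos : RotPos f := by
    rw [hf]
    exact (RotPos.one.exp_sum_mul univ (fun _ : Fin N => hB) _).exp_sum_mul _
      (J := fun x : (Fin N × Fin N) × Fin 4 => J x.1.1 x.1.2 / 4)
      (fun x => div_nonneg (hJ _ _) (by norm_num)) _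
  have e : ∀ p : Spins N × Spins N × Spins N × Spins N,
      isingWeight J B p.1 * isingWeight J B p.2.1 * isingWeight J B p.2.2.1 *
        isingWeight J B p.2.2.2 *
      ((totalSpin p.1 + totalSpin p.2.1 - totalSpin p.2.2.1 - totalSpin p.2.2.2) *
        (totalSpin p.1 - totalSpin p.2.1 + totalSpin p.2.2.1 - totalSpin p.2.2.2) *
        (-totalSpin p.1 + totalSpin p.2.1 + totalSpin p.2.2.1 - totalSpin p.2.2.2)) =
      ∑ i, ∑ j, ∑ l, f ((fourSpinsEquiv N).symm p) *
        rotMonomial (Pi.single i (Pi.single 1 1) + Pi.single j (Pi.single 2 1) +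
          Pi.single l (Pi.single 3 1)) ((fourSpinsEquiv N).symm p) := by
    rintro ⟨a, b, c, d⟩
    have hw : isingWeight J B a * isingWeight J B b * isingWeight J B c * isingWeight J B d =
        f ((fourSpinsEquiv N).symm (a, b, c, d)) := by
      rw [hf]; exact four_isingWeight J B a b c d
    rw [hw]
    simp only [rotMonomial_add, rotMonomial_single, ← Finset.mul_sum, ← Finset.sum_mul]
    congr 1
    unfold totalSpin
    simp only [← Finset.sum_add_distrib, ← Finset.sum_sub_distrib, ← Finset.sum_neg_distrib]
    rfl
  rw [Finset.sum_congr rfl fun p _ => e p, Finset.sum_comm]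
  refine Finset.sum_nonneg fun i _ => ?_
  rw [Finset.sum_comm]
  refine Finset.sum_nonneg fun j _ => ?_
  rw [Finset.sum_comm]
  refine Finset.sum_nonneg fun l _ => ?_
  have h := (fourSpinsEquiv N).symm.sum_comp (fun τ => f τ *
    rotMonomial (Pi.single i (Pi.single 1 1) + Pi.single j (Pi.single 2 1) +
      Pi.single l (Pi.single 3 1)) τ)
  rw [h]
  exact hpos _

/-- The third cumulant of four independent replicas. -/
theorem sum_four_eq {Γ : Type*} [Fintype Γ] (ρ S : Γ → ℝ) (m : ℕ → ℝ)
    (hm : ∀ k, m k = ∑ g, ρ g * S g ^ k) :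
    ∑ p : Γ × Γ × Γ × Γ, ρ p.1 * ρ p.2.1 * ρ p.2.2.1 * ρ p.2.2.2 *
      ((S p.1 + S p.2.1 - S p.2.2.1 - S p.2.2.2) * (S p.1 - S p.2.1 + S p.2.2.1 - S p.2.2.2) *
        (-S p.1 + S p.2.1 + S p.2.2.1 - S p.2.2.2)) =
      -4 * m 0 * (m 3 * m 0 ^ 2 - 3 * m 2 * m 1 * m 0 + 2 * m 1 ^ 3) := by
  have lin : ∀ (F : Γ → ℝ) (c0 c1 c2 c3 : ℝ),
      (∀ g, F g = ρ g * (c0 + c1 * S g + c2 * S g ^ 2 + c3 * S g ^ 3)) →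
      ∑ g, F g = c0 * m 0 + c1 * m 1 + c2 * m 2 + c3 * m 3 := by
    intro F c0 c1 c2 c3 hF
    simp only [hm, Finset.mul_sum, ← Finset.sum_add_distrib]
    refine Finset.sum_congr rfl fun g _ => ?_
    rw [hF]; ring
  simp only [Fintype.sum_prod_type]
  have h1 : ∀ a b c, ∑ d, ρ a * ρ b * ρ c * ρ d * ((S a + S b - S c - S d) *
      (S a - S b + S c - S d) * (-S a + S b + S c - S d)) = ρ a * ρ b * ρ c *
      (-m 3 + (S a + S b + S c) * m 2 +
        (S a ^ 2 + S b ^ 2 + S c ^ 2 - 2 * (S a * S b + S a * S c + S b * S c)) * m 1 +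
        (S a + S b - S c) * (S a - S b + S c) * (-S a + S b + S c) * m 0) := by
    intro a b c
    rw [lin _ (ρ a * ρ b * ρ c * ((S a + S b - S c) * (S a - S b + S c) * (-S a + S b + S c)))
      (ρ a * ρ b * ρ c *
        (S a ^ 2 + S b ^ 2 + S c ^ 2 - 2 * (S a * S b + S a * S c + S b * S c)))
      (ρ a * ρ b * ρ c * (S a + S b + S c)) (-(ρ a * ρ b * ρ c)) (fun d => by ring)]
    ring
  simp only [h1]
  have h2 : ∀ a b, ∑ c, ρ a * ρ b * ρ c *
      (-m 3 + (S a + S b + S c) * m 2 +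
        (S a ^ 2 + S b ^ 2 + S c ^ 2 - 2 * (S a * S b + S a * S c + S b * S c)) * m 1 +
        (S a + S b - S c) * (S a - S b + S c) * (-S a + S b + S c) * m 0) = ρ a * ρ b *
      ((-m 3 + (S a + S b) * m 2 + (S a - S b) ^ 2 * m 1 -
        (S a + S b) * (S a - S b) ^ 2 * m 0) * m 0 +
        (m 2 - 2 * (S a + S b) * m 1 + (S a - S b) ^ 2 * m 0) * m 1 +
        (m 1 + (S a + S b) * m 0) * m 2 - m 0 * m 3) := by
    intro a b
    rw [lin _ (ρ a * ρ b * (-m 3 + (S a + S b) * m 2 + (S a - S b) ^ 2 * m 1 -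
        (S a + S b) * (S a - S b) ^ 2 * m 0))
      (ρ a * ρ b * (m 2 - 2 * (S a + S b) * m 1 + (S a - S b) ^ 2 * m 0))
      (ρ a * ρ b * (m 1 + (S a + S b) * m 0)) (-(ρ a * ρ b * m 0)) (fun c => by ring)]
    ring
  simp only [h2]
  have h3 : ∀ a, ∑ b, ρ a * ρ b *
      ((-m 3 + (S a + S b) * m 2 + (S a - S b) ^ 2 * m 1 -
        (S a + S b) * (S a - S b) ^ 2 * m 0) * m 0 +
        (m 2 - 2 * (S a + S b) * m 1 + (S a - S b) ^ 2 * m 0) * m 1 +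
        (m 1 + (S a + S b) * m 0) * m 2 - m 0 * m 3) = ρ a *
      (-3 * m 0 ^ 2 * m 3 + 6 * m 0 * m 1 * m 2 - 2 * m 1 ^ 3 +
        (3 * m 0 ^ 2 * m 2 - 6 * m 0 * m 1 ^ 2) * S a + 3 * m 0 ^ 2 * m 1 * S a ^ 2 -
        m 0 ^ 3 * S a ^ 3) := by
    intro a
    rw [lin _ (ρ a * (-2 * m 0 * m 3 + 2 * m 1 * m 2 + 2 * S a * m 0 * m 2 - 2 * S a * m 1 ^ 2 +
        2 * S a ^ 2 * m 0 * m 1 - S a ^ 3 * m 0 ^ 2))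
      (ρ a * (2 * m 0 * m 2 - 2 * m 1 ^ 2 - 4 * S a * m 0 * m 1 + S a ^ 2 * m 0 ^ 2))
      (ρ a * (2 * m 0 * m 1 + S a * m 0 ^ 2)) (-(ρ a * m 0 ^ 2)) (fun b => by ring)]
    ring
  simp only [h3]
  rw [lin _ (-3 * m 0 ^ 2 * m 3 + 6 * m 0 * m 1 * m 2 - 2 * m 1 ^ 3)
    (3 * m 0 ^ 2 * m 2 - 6 * m 0 * m 1 ^ 2) (3 * m 0 ^ 2 * m 1) (-m 0 ^ 3) (fun a => by ring)]
  ring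

/-- The Griffiths–Hurst–Sherman inequality for the total spin. -/
theorem third_cumulant_nonpos {J : Fin N → Fin N → ℝ} (hJ : ∀ i j, 0 ≤ J i j) {B : ℝ}
    (hB : 0 ≤ B) {m : ℕ → ℝ} (hm : ∀ k, m k = ∑ σ, isingWeight J B σ * totalSpin σ ^ k) :
    m 3 * m 0 ^ 2 - 3 * m 2 * m 1 * m 0 + 2 * m 1 ^ 3 ≤ 0 := by
  have h := sum_four_nonneg hJ hB
  rw [sum_four_eq _ _ m hm] at h
  have h0 : 0 < m 0 := by
    rw [hm]
    simpa using (ferro_isingWeight hJ hB).sum_pos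
  by_contra hc
  push Not at hc
  have := mul_pos h0 hc
  linarith

end GriffithsHurstSherman

section Concavity

variable {N : ℕ} {w : Fin N → ℝ}

theorem fieldMoment_ghs (hw : ∀ i, 0 < w i) {β B : ℝ} (hβ : 0 ≤ β) (hB : 0 ≤ B)
    {m : ℕ → ℝ} (hm : ∀ k, m k = fieldMoment (annealedWeight w β) k B) :
    m 3 * m 0 ^ 2 - 3 * m 2 * m 1 * m 0 + 2 * m 1 ^ 3 ≤ 0 := by
  set C := ∏ i, ∏ j ∈ Ioi i, effConst w β i j with hC
  have hC0 : 0 < C := Finset.prod_pos fun i _ => Finset.prod_pos fun j _ => by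
    rw [effConst_eq hw]; exact Real.exp_pos _
  have h := third_cumulant_nonpos (effCoupling_nonneg hw hβ) hB
    (m := fun k => ∑ σ, isingWeight (effCoupling w β) B σ * totalSpin σ ^ k) (fun _ => rfl)
  have hk : ∀ k, m k = C * ∑ σ, isingWeight (effCoupling w β) B σ * totalSpin σ ^ k := by
    intro k
    rw [hm, fieldMoment, Finset.mul_sum]
    refine Finset.sum_congr rfl fun σ _ => ?_
    rw [annealedWeight_mul_exp hw, mul_assoc]
  simp only [hk]
  have := mul_nonpos_of_nonneg_of_nonpos (pow_pos hC0 3).le h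
  refine le_trans (le_of_eq ?_) this
  ring

theorem hasDerivAt_annealedMagn (hw : ∀ i, 0 < w i) (β B : ℝ) :
    HasDerivAt (annealedMagn w β) (annealedSusc w β B) B := by
  have h := (hasDerivAt_fieldMoment_div (annealedWeight_pos hw β) B).div_const (N : ℝ)
  have e : annealedMagn w β = fun B => fieldMoment (annealedWeight w β) 1 B /
      fieldMoment (annealedWeight w β) 0 B / N := funext (annealedMagn_eq β)
  have h' : DifferentiableAt ℝ (annealedMagn w β) B := by rw [e]; exact h.differentiableAt
  exact h'.hasDerivAt

theorem concaveOn_annealedMagn (hw : ∀ i, 0 < w i) {β : ℝ} (hβ : 0 ≤ β) :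
    ConcaveOn ℝ (Set.Ici 0) (annealedMagn w β) := by
  have hA := annealedWeight_pos hw β
  set A := annealedWeight w β with hAdef
  have e : annealedMagn w β = fun B => fieldMoment A 1 B / fieldMoment A 0 B / N :=
    funext (annealedMagn_eq β)
  have e1 : deriv (annealedMagn w β) = fun B =>
      (fieldMoment A 2 B / fieldMoment A 0 B -
        (fieldMoment A 1 B / fieldMoment A 0 B) ^ 2) / N := by
    rw [e]
    exact funext fun B => ((hasDerivAt_fieldMoment_div hA B).div_const (N : ℝ)).deriv
  have h2 : ∀ B, HasDerivAt (deriv (annealedMagn w β))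
      ((fieldMoment A 3 B * fieldMoment A 0 B ^ 2 -
        3 * fieldMoment A 2 B * fieldMoment A 1 B * fieldMoment A 0 B +
        2 * fieldMoment A 1 B ^ 3) / fieldMoment A 0 B ^ 3 / N) B := by
    intro B
    rw [e1]
    have h0 := (fieldMoment_zero_pos hA B).ne'
    have d := (((hasDerivAt_fieldMoment A 2 B).div (hasDerivAt_fieldMoment A 0 B) h0).sub
      ((hasDerivAt_fieldMoment_div hA B).pow 2)).div_const (N : ℝ)
    refine d.congr_deriv ?_
    congr 1
    norm_num
    field_simp
    ring
  refine concaveOn_of_deriv2_nonpos (convex_Ici 0) ?_ ?_ ?_ ?_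
  · exact fun B _ => (hasDerivAt_annealedMagn hw β B).continuousAt.continuousWithinAt
  · exact fun B _ => (hasDerivAt_annealedMagn hw β B).differentiableAt.differentiableWithinAt
  · exact fun B _ => (h2 B).differentiableAt.differentiableWithinAt
  · intro B hB
    rw [interior_Ici] at hB
    rw [Function.iterate_succ, Function.iterate_one, Function.comp_apply, (h2 B).deriv]
    refine div_nonpos_of_nonpos_of_nonneg (div_nonpos_of_nonpos_of_nonneg ?_
      (pow_pos (fieldMoment_zero_pos hA B) 3).le) (Nat.cast_nonneg N)
    exact fieldMoment_ghs hw hβ (le_of_lt hB) (m := fun k => fieldMoment A k B) fun _ => rfl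

/-- Concavity of the annealed magnetization, as a tangent inequality. -/
theorem annealedMagn_tangent (hw : ∀ i, 0 < w i) {β : ℝ} (hβ : 0 ≤ β) {x y : ℝ} (hx : 0 ≤ x)
    (hy : 0 ≤ y) :
    annealedMagn w β y ≤ annealedMagn w β x + annealedSusc w β x * (y - x) := by
  have hc := concaveOn_annealedMagn hw hβ
  have hd := hasDerivAt_annealedMagn hw β x
  rcases lt_trichotomy x y with h | rfl | h
  · have := hc.slope_le_of_hasDerivAt hx hy h hd
    rw [slope_def_field, div_le_iff₀ (by linarith)] at this
    linarith
  · simp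
  · have := hc.le_slope_of_hasDerivAt hy hx h hd
    rw [slope_def_field, le_div_iff₀ (by linarith)] at this
    linarith

theorem annealedMagn_neg (β B : ℝ) : annealedMagn w β (-B) = -annealedMagn w β B := by
  rw [annealedMagn_eq, annealedMagn_eq, fieldMoment_neg (annealedWeight_neg β),
    fieldMoment_neg (annealedWeight_neg β)]
  ring

theorem annealedSusc_neg (hw : ∀ i, 0 < w i) (β B : ℝ) :
    annealedSusc w β (-B) = annealedSusc w β B := by
  have h := (hasDerivAt_annealedMagn hw β (-B)).scomp B (hasDerivAt_neg B)
  have e : annealedMagn w β ∘ Neg.neg = -annealedMagn w β := funext (annealedMagn_neg β)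
  rw [e] at h
  have := h.unique (hasDerivAt_annealedMagn hw β B).neg
  simp only [neg_smul, one_smul, neg_inj] at this
  exact this

end Concavity
end AnnealedGRG

namespace AnnealedGRG
set_option linter.unusedSectionVars false

section Tanh

theorem hasDerivAt_tanh (x : ℝ) : HasDerivAt Real.tanh (1 / Real.cosh x ^ 2) x := by
  have h := (Real.hasDerivAt_sinh x).div (Real.hasDerivAt_cosh x) (Real.cosh_pos x).ne'
  have e : Real.tanh = Real.sinh / Real.cosh := funext Real.tanh_eq_sinh_div_cosh
  rw [e]
  refine h.congr_deriv ?_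
  congr 1
  nlinarith [Real.cosh_sq x]

theorem continuous_tanh : Continuous Real.tanh :=
  continuous_iff_continuousAt.2 fun x => (hasDerivAt_tanh x).continuousAt

theorem one_div_cosh_sq_le (x : ℝ) : 1 / Real.cosh x ^ 2 ≤ 1 := by
  have := Real.one_le_cosh x
  rw [div_le_one (by positivity)]
  nlinarith

theorem continuous_one_div_cosh_sq : Continuous fun x => 1 / Real.cosh x ^ 2 :=
  continuous_const.div (Real.continuous_cosh.pow 2) fun x => (pow_pos (Real.cosh_pos x) 2).ne'

theorem lipschitzWith_tanh : LipschitzWith 1 Real.tanh := by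
  refine lipschitzWith_of_nnnorm_deriv_le (fun x => (hasDerivAt_tanh x).differentiableAt) fun x => ?_
  rw [(hasDerivAt_tanh x).deriv, ← NNReal.coe_le_coe, coe_nnnorm, Real.norm_of_nonneg (by positivity)]
  exact one_div_cosh_sq_le x

theorem abs_tanh_sub_le (u v : ℝ) : |Real.tanh v - Real.tanh u| ≤ |v - u| := by
  simpa [Real.dist_eq] using lipschitzWith_tanh.dist_le_mul v u

theorem abs_tanh_le_one (x : ℝ) : |Real.tanh x| ≤ 1 := (Real.abs_tanh_lt_one x).le

theorem tanh_le_self {x : ℝ} (hx : 0 ≤ x) : Real.tanh x ≤ x := by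
  have := abs_tanh_sub_le 0 x
  simp only [Real.tanh_zero, sub_zero, abs_of_nonneg hx] at this
  exact (le_abs_self _).trans this

theorem tanh_mono : StrictMono Real.tanh :=
  strictMono_of_hasDerivAt_pos (f' := fun x => 1 / Real.cosh x ^ 2) hasDerivAt_tanh
    fun x => by have := Real.cosh_pos x; positivity

theorem tanh_pos {x : ℝ} (hx : 0 < x) : 0 < Real.tanh x := by
  simpa using tanh_mono hx

theorem tanh_lt_self {x : ℝ} (hx : 0 < x) : Real.tanh x < x := by
  rw [Real.tanh_eq_sinh_div_cosh, div_lt_iff₀ (Real.cosh_pos x)]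
  have hmono : StrictMonoOn (fun x => x * Real.cosh x - Real.sinh x) (Set.Ici 0) := by
    refine strictMonoOn_of_deriv_pos (convex_Ici 0) (by fun_prop) fun x hx => ?_
    rw [interior_Ici] at hx
    have h := ((hasDerivAt_id x).mul (Real.hasDerivAt_cosh x)).sub (Real.hasDerivAt_sinh x)
    have e : deriv (fun x => x * Real.cosh x - Real.sinh x) x = x * Real.sinh x := by
      refine (h.congr_deriv ?_).deriv
      simp
    rw [e]
    exact mul_pos hx (Real.sinh_pos_iff.2 hx)
  have := hmono (Set.mem_Ici.2 le_rfl) (Set.mem_Ici.2 hx.le) hx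
  simp at this
  linarith

theorem sinh_le_mul_cosh {x : ℝ} (hx : 0 ≤ x) : Real.sinh x ≤ x * Real.cosh x := by
  have := tanh_le_self hx
  rwa [Real.tanh_eq_sinh_div_cosh, div_le_iff₀ (Real.cosh_pos x)] at this

/-- Concavity of `tanh` on the half-line, as a tangent inequality. -/
theorem tanh_tangent {u v : ℝ} (hu : 0 ≤ u) (hv : 0 ≤ v) :
    Real.tanh v ≤ Real.tanh u + 1 / Real.cosh u ^ 2 * (v - u) := by
  have cu := Real.cosh_pos u
  have cv := Real.cosh_pos v
  have key : Real.sinh (v - u) * Real.cosh u ≤ (v - u) * Real.cosh v := by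
    rcases le_total u v with h | h
    · have h0 : 0 ≤ v - u := by linarith
      have e : Real.cosh v = Real.cosh (v - u) * Real.cosh u + Real.sinh (v - u) * Real.sinh u := by
        rw [← Real.cosh_add]; congr 1; ring
      have h1 := mul_le_mul_of_nonneg_right (sinh_le_mul_cosh h0) cu.le
      have h2 : 0 ≤ (v - u) * (Real.sinh (v - u) * Real.sinh u) :=
        mul_nonneg h0 (mul_nonneg (Real.sinh_nonneg_iff.2 h0) (Real.sinh_nonneg_iff.2 hu))
      rw [e]; linarith
    · have h0 : 0 ≤ u - v := by linarith
      have e : Real.sinh (v - u) = -Real.sinh (u - v) := by rw [← Real.sinh_neg]; congr 1; ring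
      have h1 : u - v ≤ Real.sinh (u - v) := Real.self_le_sinh_iff.2 h0
      have h2 : Real.cosh v ≤ Real.cosh u :=
        Real.cosh_le_cosh.2 (by rwa [abs_of_nonneg hv, abs_of_nonneg hu])
      have h3 := mul_le_mul h1 h2 cv.le (h0.trans h1)
      rw [e]; linarith
  have e2 : Real.tanh v - Real.tanh u = Real.sinh (v - u) / (Real.cosh u * Real.cosh v) := by
    rw [Real.tanh_eq_sinh_div_cosh, Real.tanh_eq_sinh_div_cosh, Real.sinh_sub]
    field_simp
  have : Real.sinh (v - u) / (Real.cosh u * Real.cosh v) ≤ 1 / Real.cosh u ^ 2 * (v - u) := by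
    rw [div_le_iff₀ (by positivity)]
    calc Real.sinh (v - u) = Real.sinh (v - u) * Real.cosh u / Real.cosh u := by field_simp
      _ ≤ (v - u) * Real.cosh v / Real.cosh u := by gcongr
      _ = _ := by field_simp
  linarith

/-- Convexity of `log cosh`, as a tangent inequality. -/
theorem log_cosh_tangent (u v : ℝ) :
    Real.log (Real.cosh u) + Real.tanh u * (v - u) ≤ Real.log (Real.cosh v) := by
  have cu := Real.cosh_pos u
  rw [Real.le_log_iff_exp_le (Real.cosh_pos v), Real.exp_add, Real.exp_log cu]
  set h := v - u with hh
  set t := Real.tanh u with ht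
  have ht1 := abs_le.1 (abs_tanh_le_one u)
  have hc := convexOn_exp.2 (Set.mem_univ h) (Set.mem_univ (-h))
    (show 0 ≤ (1 + t) / 2 by linarith) (show 0 ≤ (1 - t) / 2 by linarith) (by ring)
  simp only [smul_eq_mul] at hc
  rw [show (1 + t) / 2 * h + (1 - t) / 2 * -h = t * h by ring] at hc
  have e : Real.cosh v = Real.cosh u * ((1 + t) / 2 * Real.exp h + (1 - t) / 2 * Real.exp (-h)) := by
    rw [show v = u + h by rw [hh]; ring, Real.cosh_add, ht, Real.tanh_eq_sinh_div_cosh,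
      Real.cosh_eq h, Real.sinh_eq h]
    field_simp
    ring
  rw [e]
  exact mul_le_mul_of_nonneg_left hc cu.le

theorem hasDerivAt_log_cosh (x : ℝ) :
    HasDerivAt (fun x => Real.log (Real.cosh x)) (Real.tanh x) x := by
  rw [Real.tanh_eq_sinh_div_cosh]
  exact (Real.hasDerivAt_cosh x).log (Real.cosh_pos x).ne'

theorem continuous_log_cosh : Continuous fun x => Real.log (Real.cosh x) :=
  continuous_iff_continuousAt.2 fun x => (hasDerivAt_log_cosh x).continuousAt

theorem abs_log_cosh_sub_le (u v : ℝ) :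
    |Real.log (Real.cosh v) - Real.log (Real.cosh u)| ≤ |v - u| := by
  have h : ∀ u v : ℝ, Real.log (Real.cosh u) - Real.log (Real.cosh v) ≤ |v - u| := by
    intro u v
    have h1 := log_cosh_tangent u v
    have h2 : |Real.tanh u * (v - u)| ≤ |v - u| := by
      rw [abs_mul]
      exact mul_le_of_le_one_left (abs_nonneg _) (abs_tanh_le_one u)
    have := neg_abs_le (Real.tanh u * (v - u))
    linarith
  rw [abs_le]
  have h1 := h u v
  have h2 := h v u
  rw [abs_sub_comm] at h2
  constructor <;> linarith

theorem log_cosh_nonneg (x : ℝ) : 0 ≤ Real.log (Real.cosh x) := Real.log_nonneg (Real.one_le_cosh x)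

theorem log_cosh_le_abs (x : ℝ) : Real.log (Real.cosh x) ≤ |x| := by
  have := abs_log_cosh_sub_le 0 x
  simp only [Real.cosh_zero, Real.log_one, sub_zero] at this
  exact (le_abs_self _).trans this

/-- The slope of `tanh` between two points. -/
noncomputable def tanhSlope (u v : ℝ) : ℝ :=
  if v = u then 1 / Real.cosh u ^ 2 else (Real.tanh v - Real.tanh u) / (v - u)

theorem tanhSlope_mul (u v : ℝ) : tanhSlope u v * (v - u) = Real.tanh v - Real.tanh u := by
  unfold tanhSlope
  split_ifs with h
  · rw [h]; simp
  · exact div_mul_cancel₀ _ (sub_ne_zero.2 h)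

theorem abs_tanhSlope_le (u v : ℝ) : |tanhSlope u v| ≤ 1 := by
  unfold tanhSlope
  split_ifs with h
  · rw [abs_of_nonneg (by positivity)]; exact one_div_cosh_sq_le u
  · rw [abs_div]
    exact div_le_one_of_le₀ (abs_tanh_sub_le u v) (abs_nonneg _)

theorem measurable_tanhSlope : Measurable fun p : ℝ × ℝ => tanhSlope p.1 p.2 := by
  unfold tanhSlope
  have ht := continuous_tanh.measurable
  have hc := Real.continuous_cosh.measurable
  refine Measurable.ite (measurableSet_eq_fun measurable_snd measurable_fst) ?_ ?_
  · exact ((hc.comp measurable_fst).pow_const 2).const_div 1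
  · exact ((ht.comp measurable_snd).sub (ht.comp measurable_fst)).div
      (measurable_snd.sub measurable_fst)

theorem tendsto_tanhSlope (u : ℝ) :
    Tendsto (tanhSlope u) (𝓝 u) (𝓝 (1 / Real.cosh u ^ 2)) := by
  have h := continuousAt_dslope_same.2 (hasDerivAt_tanh u).differentiableAt
  have e : tanhSlope u = dslope Real.tanh u := by
    ext v
    unfold tanhSlope
    split_ifs with hv
    · rw [hv, dslope_same, (hasDerivAt_tanh u).deriv]
    · rw [dslope_of_ne _ hv, slope_def_field]
  rw [e]
  have h2 := h.tendsto
  rwa [dslope_same, (hasDerivAt_tanh u).deriv] at h2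

end Tanh

section FixedPoint

variable {Ω : Type*} [MeasurableSpace Ω]

/-- A nonnegative random variable with finite second moment. -/
structure NonnegSq (X : Ω → ℝ) (P : Measure Ω) : Prop where
  nonneg : ∀ᵐ ω ∂P, 0 ≤ X ω
  integrable : Integrable X P
  integrable_sq : Integrable (fun ω => X ω ^ 2) P

variable (P : Measure Ω) (X : Ω → ℝ)

/-- `E[log cosh (X z + B)] - z² / 2`. -/
noncomputable def cwFn (B z : ℝ) : ℝ :=
  (∫ ω, Real.log (Real.cosh (X ω * z + B)) ∂P) - z ^ 2 / 2

/-- `E[tanh (X z + B) X]`. -/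
noncomputable def cwMap (B z : ℝ) : ℝ := ∫ ω, Real.tanh (X ω * z + B) * X ω ∂P

/-- `E[tanh (X z + B)]`. -/
noncomputable def cwMagn (B z : ℝ) : ℝ := ∫ ω, Real.tanh (X ω * z + B) ∂P

/-- `E[X² / cosh² (X z + B)]`, the derivative of `cwMap` in `z`. -/
noncomputable def cwSlope (B z : ℝ) : ℝ := ∫ ω, 1 / Real.cosh (X ω * z + B) ^ 2 * X ω ^ 2 ∂P

variable {P X} [IsProbabilityMeasure P]

theorem integrable_bdd_mul {D h : Ω → ℝ} (hD : AEStronglyMeasurable D P) (hb : ∀ ω, |D ω| ≤ 1)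
    (hh : Integrable h P) : Integrable (fun ω => D ω * h ω) P :=
  hh.bdd_mul (c := 1) hD (Eventually.of_forall hb)

theorem tendsto_integral_bdd_mul {ι : Type*} {l : Filter ι} [l.IsCountablyGenerated]
    {D : ι → Ω → ℝ} {D₀ h : Ω → ℝ} (hD : ∀ i, AEStronglyMeasurable (D i) P)
    (hb : ∀ i ω, |D i ω| ≤ 1) (hh : Integrable h P)
    (hlim : ∀ ω, Tendsto (fun i => D i ω) l (𝓝 (D₀ ω))) :
    Tendsto (fun i => ∫ ω, D i ω * h ω ∂P) l (𝓝 (∫ ω, D₀ ω * h ω ∂P)) := by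
  refine tendsto_integral_filter_of_dominated_convergence (fun ω => |h ω|)
    (Eventually.of_forall fun i => (hD i).mul hh.aestronglyMeasurable)
    (Eventually.of_forall fun i => Eventually.of_forall fun ω => ?_) hh.abs
    (Eventually.of_forall fun ω => (hlim ω).mul_const _)
  rw [Real.norm_eq_abs, abs_mul]
  exact mul_le_of_le_one_left (abs_nonneg _) (hb i ω)

namespace NonnegSq

variable (hX : NonnegSq X P)

include hX

theorem aestronglyMeasurable_comp {f : ℝ → ℝ} (hf : Continuous f) (z B : ℝ) :
    AEStronglyMeasurable (fun ω => f (X ω * z + B)) P :=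
  hf.comp_aestronglyMeasurable
    ((hX.integrable.aestronglyMeasurable.mul_const z).add_const B)

theorem integrable_log_cosh (B z : ℝ) :
    Integrable (fun ω => Real.log (Real.cosh (X ω * z + B))) P := by
  refine Integrable.mono' (((hX.integrable.mul_const z).add (integrable_const B)).abs)
    (hX.aestronglyMeasurable_comp continuous_log_cosh z B) (Eventually.of_forall fun ω => ?_)
  rw [Real.norm_of_nonneg (log_cosh_nonneg _)]
  exact log_cosh_le_abs _

theorem integrable_tanh_mul {h : Ω → ℝ} (hh : Integrable h P) (B z : ℝ) :
    Integrable (fun ω => Real.tanh (X ω * z + B) * h ω) P :=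
  integrable_bdd_mul (hX.aestronglyMeasurable_comp continuous_tanh z B)
    (fun _ => abs_tanh_le_one _) hh

theorem integrable_tanh (B z : ℝ) : Integrable (fun ω => Real.tanh (X ω * z + B)) P := by
  simpa using hX.integrable_tanh_mul (integrable_const 1) B z

theorem integrable_slope (B z : ℝ) :
    Integrable (fun ω => 1 / Real.cosh (X ω * z + B) ^ 2 * X ω ^ 2) P :=
  integrable_bdd_mul (hX.aestronglyMeasurable_comp continuous_one_div_cosh_sq z B)
    (fun ω => by rw [abs_of_nonneg (by positivity)]; exact one_div_cosh_sq_le _) hX.integrable_sq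

theorem cwFn_tangent (B z B' z' : ℝ) :
    cwFn P X B z + cwMap P X B z * (z' - z) + cwMagn P X B z * (B' - B) - (z' ^ 2 - z ^ 2) / 2
      ≤ cwFn P X B' z' := by
  have h : (∫ ω, Real.log (Real.cosh (X ω * z + B)) ∂P) + cwMap P X B z * (z' - z) +
      cwMagn P X B z * (B' - B) ≤ ∫ ω, Real.log (Real.cosh (X ω * z' + B')) ∂P := by
    unfold cwMap cwMagn
    rw [← integral_mul_const, ← integral_mul_const, ← integral_add, ← integral_add]
    · refine integral_mono ?_ (hX.integrable_log_cosh B' z') fun ω => ?_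
      · exact ((hX.integrable_log_cosh B z).add
          ((hX.integrable_tanh_mul hX.integrable B z).mul_const _)).add
          ((hX.integrable_tanh B z).mul_const _)
      · refine le_trans (le_of_eq ?_) (log_cosh_tangent (X ω * z + B) (X ω * z' + B'))
        ring
    · exact (hX.integrable_log_cosh B z).add
          ((hX.integrable_tanh_mul hX.integrable B z).mul_const _)
    · exact (hX.integrable_tanh B z).mul_const _
    · exact hX.integrable_log_cosh B z
    · exact (hX.integrable_tanh_mul hX.integrable B z).mul_const _
  unfold cwFn
  linarith

theorem fixed_of_isMaxOn {B z : ℝ} (h : IsMaxOn (cwFn P X B) Set.univ z) :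
    z = cwMap P X B z := by
  set g := cwMap P X B z with hg
  have h1 := hX.cwFn_tangent B z B g
  have h2 : cwFn P X B g ≤ cwFn P X B z := h (Set.mem_univ g)
  rw [← hg] at h1
  have : (g - z) ^ 2 ≤ 0 := by nlinarith
  nlinarith [sq_nonneg (g - z), pow_eq_zero_iff (two_ne_zero) |>.1 (le_antisymm this (sq_nonneg _))]

theorem continuous_cwFn (B : ℝ) : Continuous (cwFn P X B) := by
  unfold cwFn
  refine Continuous.sub (continuous_iff_continuousAt.2 fun z => ?_) (by fun_prop)
  refine tendsto_iff_norm_sub_tendsto_zero.2 ?_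
  refine squeeze_zero (g := fun z' => (∫ ω, |X ω| ∂P) * |z' - z|) (fun _ => norm_nonneg _)
    (fun z' => ?_) ?_
  · rw [← integral_sub (hX.integrable_log_cosh B z') (hX.integrable_log_cosh B z),
      ← integral_mul_const]
    refine norm_integral_le_of_norm_le (hX.integrable.abs.mul_const _)
      (Eventually.of_forall fun ω => ?_)
    rw [Real.norm_eq_abs]
    refine (abs_log_cosh_sub_le _ _).trans_eq ?_
    rw [← abs_mul]; congr 1; ring
  · have : Continuous fun z' : ℝ => (∫ ω, |X ω| ∂P) * |z' - z| := by fun_prop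
    simpa using this.tendsto z

theorem integral_nonneg' : 0 ≤ ∫ ω, X ω ∂P := integral_nonneg_of_ae hX.nonneg

theorem cwFn_le (B z : ℝ) : cwFn P X B z ≤ (∫ ω, X ω ∂P) * |z| + |B| - z ^ 2 / 2 := by
  unfold cwFn
  refine sub_le_sub_right ?_ _
  have : (∫ ω, X ω ∂P) * |z| + |B| = ∫ ω, (X ω * |z| + |B|) ∂P := by
    rw [integral_add (hX.integrable.mul_const _) (integrable_const _), integral_mul_const]
    simp
  rw [this]
  refine integral_mono_ae (hX.integrable_log_cosh B z)
    ((hX.integrable.mul_const _).add (integrable_const _)) ?_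
  filter_upwards [hX.nonneg] with ω hω
  refine (log_cosh_le_abs _).trans ((abs_add_le _ _).trans ?_)
  rw [abs_mul, abs_of_nonneg hω]

theorem exists_isMaxOn (B : ℝ) : ∃ z, IsMaxOn (cwFn P X B) Set.univ z := by
  set m := ∫ ω, X ω ∂P with hm
  have hm0 : 0 ≤ m := hX.integral_nonneg'
  set R := 2 * (m + |B| + 1) with hR
  have hB := abs_nonneg B
  obtain ⟨z, hz, hmax⟩ := (isCompact_Icc (a := -R) (b := R)).exists_isMaxOn
    ⟨0, by constructor <;> linarith⟩ (hX.continuous_cwFn B).continuousOn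
  refine ⟨z, fun y _ => ?_⟩
  change cwFn P X B y ≤ cwFn P X B z
  by_cases hy : y ∈ Set.Icc (-R) R
  · exact hmax hy
  · have h0 : cwFn P X B 0 ≤ cwFn P X B z := hmax ⟨by linarith, by linarith⟩
    have h1 : 0 ≤ cwFn P X B 0 := by
      unfold cwFn
      have : 0 ≤ ∫ ω, Real.log (Real.cosh (X ω * 0 + B)) ∂P :=
        integral_nonneg fun ω => log_cosh_nonneg _
      linarith
    have h2 := hX.cwFn_le B y
    have h3 : R < |y| := by
      by_contra hc
      exact hy (abs_le.1 (not_lt.1 hc))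
    have h4 : y ^ 2 = |y| ^ 2 := (sq_abs y).symm
    rw [h4, ← hm] at h2
    nlinarith

theorem cwMap_tangent {B z z' : ℝ} (hB : 0 ≤ B) (hz : 0 ≤ z) (hz' : 0 ≤ z') :
    cwMap P X B z' ≤ cwMap P X B z + cwSlope P X B z * (z' - z) := by
  unfold cwMap cwSlope
  rw [← integral_mul_const, ← integral_add (hX.integrable_tanh_mul hX.integrable B z)
    ((hX.integrable_slope B z).mul_const _)]
  refine integral_mono_ae (hX.integrable_tanh_mul hX.integrable B z')
    ((hX.integrable_tanh_mul hX.integrable B z).add ((hX.integrable_slope B z).mul_const _)) ?_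
  filter_upwards [hX.nonneg] with ω hω
  have h := mul_le_mul_of_nonneg_right (tanh_tangent (u := X ω * z + B) (v := X ω * z' + B)
    (by positivity) (by positivity)) hω
  refine h.trans_eq ?_
  ring

theorem ae_eq_zero_of_integral_nonpos (h : ∫ ω, X ω ∂P ≤ 0) : ∀ᵐ ω ∂P, X ω = 0 := by
  have := (integral_eq_zero_iff_of_nonneg_ae hX.nonneg hX.integrable).1
    (le_antisymm h hX.integral_nonneg')
  exact this

omit hX [IsProbabilityMeasure P] in
theorem cwMap_zero (B : ℝ) : cwMap P X B 0 = Real.tanh B * ∫ ω, X ω ∂P := by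
  unfold cwMap
  simp_rw [mul_zero, zero_add]
  rw [integral_const_mul]

theorem cwMap_zero_pos_of_slope {B z : ℝ} (hB : 0 < B) (h : 1 ≤ cwSlope P X B z) :
    0 < cwMap P X B 0 := by
  rw [cwMap_zero]
  refine mul_pos (tanh_pos hB) ?_
  by_contra hc
  have h0 := hX.ae_eq_zero_of_integral_nonpos (not_lt.1 hc)
  have : cwSlope P X B z = 0 := by
    unfold cwSlope
    refine integral_eq_zero_of_ae ?_
    filter_upwards [h0] with ω hω
    simp [hω]
  linarith

/-- At a nonnegative fixed point in a positive field the slope is less than one. -/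
theorem cwSlope_lt_one {B z : ℝ} (hB : 0 < B) (hz : 0 ≤ z) (hfix : z = cwMap P X B z) :
    cwSlope P X B z < 1 := by
  by_contra hc
  push Not at hc
  have h := hX.cwMap_tangent hB.le hz le_rfl
  rw [← hfix] at h
  have := hX.cwMap_zero_pos_of_slope hB hc
  nlinarith

/-- Uniqueness of the nonnegative fixed point in a positive field. -/
theorem fixed_unique_of_pos {B z z' : ℝ} (hB : 0 < B) (hz : 0 ≤ z) (hz' : 0 ≤ z')
    (hfix : z = cwMap P X B z) (hfix' : z' = cwMap P X B z') : z = z' := by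
  wlog h : z < z' generalizing z z'
  · rcases lt_or_eq_of_le (not_lt.1 h) with h1 | h1
    · exact (this hz' hz hfix' hfix h1).symm
    · exact h1.symm
  have h1 := hX.cwMap_tangent hB.le hz hz'
  rw [← hfix, ← hfix'] at h1
  have h2 := hX.cwSlope_lt_one hB hz hfix
  nlinarith

omit hX [IsProbabilityMeasure P] in
theorem cwMap_neg (B z : ℝ) : cwMap P X (-B) (-z) = -cwMap P X B z := by
  unfold cwMap
  rw [← integral_neg]
  congr 1
  ext ω
  rw [show X ω * -z + -B = -(X ω * z + B) by ring, Real.tanh_neg, neg_mul]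

omit hX [IsProbabilityMeasure P] in
theorem cwFn_neg (B z : ℝ) : cwFn P X (-B) (-z) = cwFn P X B z := by
  unfold cwFn
  rw [neg_sq]
  congr 2
  ext ω
  rw [show X ω * -z + -B = -(X ω * z + B) by ring, Real.cosh_neg]

omit hX [IsProbabilityMeasure P] in
theorem cwSlope_neg (B z : ℝ) : cwSlope P X (-B) (-z) = cwSlope P X B z := by
  unfold cwSlope
  congr 1
  ext ω
  rw [show X ω * -z + -B = -(X ω * z + B) by ring, Real.cosh_neg]

theorem nonneg_of_isMaxOn {B z : ℝ} (hB : 0 < B) (h : IsMaxOn (cwFn P X B) Set.univ z) :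
    0 ≤ z := by
  by_contra hz
  push Not at hz
  have hfix := hX.fixed_of_isMaxOn h
  have hle : cwFn P X B z ≤ cwFn P X B (-z) := by
    unfold cwFn
    rw [neg_sq]
    refine sub_le_sub_right (integral_mono_ae (hX.integrable_log_cosh B z)
      (hX.integrable_log_cosh B (-z)) ?_) _
    filter_upwards [hX.nonneg] with ω hω
    refine Real.log_le_log (Real.cosh_pos _) (Real.cosh_le_cosh.2 ?_)
    have h1 : X ω * z ≤ 0 := mul_nonpos_of_nonneg_of_nonpos hω hz.le
    rw [mul_neg, abs_of_nonneg (a := -(X ω * z) + B) (by linarith), abs_le]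
    constructor <;> linarith
  have hmax : IsMaxOn (cwFn P X B) Set.univ (-z) := fun y hy => (h hy).trans hle
  have hfix' := hX.fixed_of_isMaxOn hmax
  have hsum : ∫ ω, (Real.tanh (X ω * z + B) * X ω + Real.tanh (X ω * -z + B) * X ω) ∂P = 0 := by
    rw [integral_add (hX.integrable_tanh_mul hX.integrable B z)
      (hX.integrable_tanh_mul hX.integrable B (-z))]
    change cwMap P X B z + cwMap P X B (-z) = 0
    rw [← hfix, ← hfix']; ring
  have hpos : ∀ ω, 0 ≤ X ω → 0 ≤ Real.tanh (X ω * z + B) + Real.tanh (X ω * -z + B) ∧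
      (Real.tanh (X ω * z + B) + Real.tanh (X ω * -z + B)) ≠ 0 := by
    intro ω _
    have : 0 < Real.tanh (X ω * z + B) + Real.tanh (X ω * -z + B) := by
      have h1 := tanh_mono (show -(X ω * -z + B) < X ω * z + B by linarith)
      rw [Real.tanh_neg] at h1
      linarith
    exact ⟨this.le, this.ne'⟩
  have h0 := (integral_eq_zero_iff_of_nonneg_ae (by
      filter_upwards [hX.nonneg] with ω hω
      change 0 ≤ Real.tanh (X ω * z + B) * X ω + Real.tanh (X ω * -z + B) * X ω
      rw [← add_mul]
      exact mul_nonneg (hpos ω hω).1 hω)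
    ((hX.integrable_tanh_mul hX.integrable B z).add
      (hX.integrable_tanh_mul hX.integrable B (-z)))).1 hsum
  have hz0 : cwMap P X B z = 0 := by
    unfold cwMap
    refine integral_eq_zero_of_ae ?_
    filter_upwards [hX.nonneg, h0] with ω hω h1
    change Real.tanh (X ω * z + B) * X ω + Real.tanh (X ω * -z + B) * X ω = 0 at h1
    rw [← add_mul] at h1
    rcases mul_eq_zero.1 h1 with h2 | h2
    · exact absurd h2 (hpos ω hω).2
    · simp [h2]
  linarith

/-- Uniqueness of the zero-field fixed point at or above the critical temperature. -/
theorem eq_zero_of_fixed (hsub : ∫ ω, X ω ^ 2 ∂P ≤ 1) {z : ℝ} (hfix : z = cwMap P X 0 z) :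
    z = 0 := by
  wlog hz : 0 ≤ z generalizing z
  · have := this (z := -z) (by rw [← neg_zero, cwMap_neg, ← hfix]) (by linarith)
    linarith
  by_contra hne
  have hz : 0 < z := lt_of_le_of_ne hz (Ne.symm hne)
  have hint : Integrable (fun ω => (X ω * z - Real.tanh (X ω * z + 0)) * X ω) P := by
    have := (hX.integrable_sq.mul_const z).sub (hX.integrable_tanh_mul hX.integrable 0 z)
    refine this.congr (Eventually.of_forall fun ω => ?_)
    simp only [Pi.sub_apply]; ring
  have hnn : ∀ᵐ ω ∂P, 0 ≤ (X ω * z - Real.tanh (X ω * z + 0)) * X ω := by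
    filter_upwards [hX.nonneg] with ω hω
    rw [add_zero]
    exact mul_nonneg (sub_nonneg.2 (tanh_le_self (by positivity))) hω
  have he : ∫ ω, (X ω * z - Real.tanh (X ω * z + 0)) * X ω ∂P =
      (∫ ω, X ω ^ 2 ∂P) * z - z := by
    have h1 := integral_sub (hX.integrable_sq.mul_const z)
      (hX.integrable_tanh_mul hX.integrable 0 z)
    rw [integral_mul_const, show ∫ ω, Real.tanh (X ω * z + 0) * X ω ∂P = z from hfix.symm] at h1
    rw [← h1]
    congr 1
    ext ω
    ring
  have h0 := (integral_eq_zero_iff_of_nonneg_ae hnn hint).1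
    (le_antisymm (by rw [he]; nlinarith) (integral_nonneg_of_ae hnn))
  have hz0 : cwMap P X 0 z = 0 := by
    unfold cwMap
    refine integral_eq_zero_of_ae ?_
    filter_upwards [hX.nonneg, h0] with ω hω h1
    simp only [Pi.zero_apply] at h1 ⊢
    rcases mul_eq_zero.1 h1 with h2 | h2
    · rcases eq_or_lt_of_le hω with h3 | h3
      · rw [← h3]; simp
      · have := tanh_lt_self (show 0 < X ω * z by positivity)
        rw [add_zero] at h2
        linarith
    · rw [h2, mul_zero]
  rw [hz0] at hfix
  exact hne hfix

end NonnegSq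
end FixedPoint
end AnnealedGRG

namespace AnnealedGRG
set_option linter.unusedSectionVars false

section Maximizer

variable {Ω : Type*} [MeasurableSpace Ω] {P : Measure Ω} [IsProbabilityMeasure P] {X : Ω → ℝ}

/-- If a function has a continuous subgradient at a point, the subgradient is the derivative. -/
theorem hasDerivAt_of_subgradient {f d : ℝ → ℝ} (h : ∀ x y, f x + d x * (y - x) ≤ f y) {x : ℝ}
    (hd : ContinuousAt d x) : HasDerivAt f (d x) x := by
  rw [hasDerivAt_iff_tendsto_slope]
  have hb : ∀ y, |slope f x y - d x| ≤ |d y - d x| ∨ y = x := by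
    intro y
    by_cases hy : y = x
    · exact Or.inr hy
    left
    have h1 := h x y
    have h2 := h y x
    rw [slope_def_field]
    rcases lt_or_gt_of_ne hy with hlt | hlt
    · have hn : y - x < 0 := by linarith
      have e1 : (f y - f x) / (y - x) ≤ d x := by
        rw [div_le_iff_of_neg hn]; linarith
      have e2 : d y ≤ (f y - f x) / (y - x) := by
        rw [le_div_iff_of_neg hn]; linarith
      rw [abs_le]
      have := neg_abs_le (d y - d x)
      constructor
      · linarith
      · have := abs_nonneg (d y - d x); linarith
    · have hn : 0 < y - x := by linarith
      have e1 : d x ≤ (f y - f x) / (y - x) := by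
        rw [le_div_iff₀ hn]; linarith
      have e2 : (f y - f x) / (y - x) ≤ d y := by
        rw [div_le_iff₀ hn]; linarith
      rw [abs_le]
      have := le_abs_self (d y - d x)
      constructor
      · have := abs_nonneg (d y - d x); linarith
      · linarith
  have hlim : Tendsto (fun y => |d y - d x|) (𝓝[≠] x) (𝓝 0) := by
    have h1 : ContinuousAt (fun y => |d y - d x|) x := (hd.sub continuousAt_const).abs
    have h2 := h1.tendsto
    simp only [sub_self, abs_zero] at h2
    exact h2.mono_left nhdsWithin_le_nhds
  rw [tendsto_iff_norm_sub_tendsto_zero]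
  refine squeeze_zero' (Eventually.of_forall fun _ => norm_nonneg _) ?_ hlim
  filter_upwards [self_mem_nhdsWithin] with y hy
  exact (hb y).resolve_right hy

namespace NonnegSq

variable (hX : NonnegSq X P)

include hX

/-- A maximizer of `cwFn`. -/
noncomputable def maximizer (B : ℝ) : ℝ := (hX.exists_isMaxOn B).choose

theorem isMaxOn_maximizer (B : ℝ) : IsMaxOn (cwFn P X B) Set.univ (hX.maximizer B) :=
  (hX.exists_isMaxOn B).choose_spec

theorem maximizer_fixed (B : ℝ) : hX.maximizer B = cwMap P X B (hX.maximizer B) :=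
  hX.fixed_of_isMaxOn (hX.isMaxOn_maximizer B)

theorem isMaxOn_neg {B z : ℝ} (h : IsMaxOn (cwFn P X B) Set.univ z) :
    IsMaxOn (cwFn P X (-B)) Set.univ (-z) := by
  intro y _
  have : cwFn P X B (-y) ≤ cwFn P X B z := h (Set.mem_univ _)
  change cwFn P X (-B) y ≤ cwFn P X (-B) (-z)
  rw [cwFn_neg, ← cwFn_neg B (-y), neg_neg] at *
  exact this

theorem mul_nonneg_of_isMaxOn {B z : ℝ} (h : IsMaxOn (cwFn P X B) Set.univ z) : 0 ≤ B * z := by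
  rcases lt_trichotomy B 0 with hB | rfl | hB
  · have := hX.nonneg_of_isMaxOn (neg_pos.2 hB) (hX.isMaxOn_neg h)
    nlinarith
  · simp
  · exact mul_nonneg hB.le (hX.nonneg_of_isMaxOn hB h)

theorem maximizer_sign (B : ℝ) : 0 ≤ B * hX.maximizer B :=
  hX.mul_nonneg_of_isMaxOn (hX.isMaxOn_maximizer B)

theorem fixed_unique {B z z' : ℝ} (hB : B ≠ 0) (hz : 0 ≤ B * z) (hz' : 0 ≤ B * z')
    (hfix : z = cwMap P X B z) (hfix' : z' = cwMap P X B z') : z = z' := by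
  rcases lt_or_gt_of_ne hB with h | h
  · have := hX.fixed_unique_of_pos (B := -B) (z := -z) (z' := -z') (by linarith) (by nlinarith)
      (by nlinarith) (by rw [cwMap_neg, ← hfix]) (by rw [cwMap_neg, ← hfix'])
    linarith
  · exact hX.fixed_unique_of_pos h (by nlinarith) (by nlinarith) hfix hfix'

theorem eq_maximizer_of_fixed {B : ℝ} (hB : B ≠ 0) (z : ℝ) (hfix : z = cwMap P X B z)
    (hz : 0 ≤ B * z) : z = hX.maximizer B :=
  hX.fixed_unique hB hz (hX.maximizer_sign B) hfix (hX.maximizer_fixed B)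

theorem eq_maximizer_of_isMaxOn {B : ℝ} (hB : B ≠ 0) (z : ℝ)
    (h : IsMaxOn (cwFn P X B) Set.univ z) : z = hX.maximizer B :=
  hX.eq_maximizer_of_fixed hB z (hX.fixed_of_isMaxOn h) (hX.mul_nonneg_of_isMaxOn h)

theorem cwSlope_maximizer_lt_one {B : ℝ} (hB : B ≠ 0) : cwSlope P X B (hX.maximizer B) < 1 := by
  have hs := hX.maximizer_sign B
  have hf := hX.maximizer_fixed B
  rcases lt_or_gt_of_ne hB with h | h
  · rw [← cwSlope_neg]
    exact hX.cwSlope_lt_one (by linarith) (by nlinarith) (by rw [cwMap_neg, ← hf])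
  · exact hX.cwSlope_lt_one h (by nlinarith) hf

/-- The sign-constrained fixed point in the field `B` is unique. -/
def UniqueAt (B : ℝ) : Prop := ∀ z, z = cwMap P X B z → 0 ≤ B * z → z = hX.maximizer B

theorem uniqueAt_of_ne {B : ℝ} (hB : B ≠ 0) : hX.UniqueAt B :=
  fun z hf hz => hX.eq_maximizer_of_fixed hB z hf hz

theorem maximizer_zero (hsub : ∫ ω, X ω ^ 2 ∂P ≤ 1) : hX.maximizer 0 = 0 :=
  hX.eq_zero_of_fixed hsub (hX.maximizer_fixed 0)

theorem uniqueAt_zero (hsub : ∫ ω, X ω ^ 2 ∂P ≤ 1) : hX.UniqueAt 0 := fun _ hf _ =>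
  (hX.eq_zero_of_fixed hsub hf).trans (hX.maximizer_zero hsub).symm

omit hX [IsProbabilityMeasure P] in
theorem cwSlope_zero : cwSlope P X 0 0 = ∫ ω, X ω ^ 2 ∂P := by
  unfold cwSlope; simp

theorem abs_cwMap_le (B z : ℝ) : |cwMap P X B z| ≤ ∫ ω, |X ω| ∂P := by
  rw [← Real.norm_eq_abs]
  unfold cwMap
  refine norm_integral_le_of_norm_le hX.integrable.abs (Eventually.of_forall fun ω => ?_)
  rw [Real.norm_eq_abs, abs_mul]
  exact mul_le_of_le_one_left (abs_nonneg _) (abs_tanh_le_one _)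

omit hX [IsProbabilityMeasure P] in
theorem tendsto_affine {ι : Type*} {l : Filter ι} {z B : ι → ℝ} {z₀ B₀ : ℝ}
    (hz : Tendsto z l (𝓝 z₀)) (hB : Tendsto B l (𝓝 B₀)) (ω : Ω) :
    Tendsto (fun i => X ω * z i + B i) l (𝓝 (X ω * z₀ + B₀)) :=
  (hz.const_mul _).add hB

theorem tendsto_integral_tanh_mul {ι : Type*} {l : Filter ι} [l.IsCountablyGenerated]
    {z B : ι → ℝ} {z₀ B₀ : ℝ} (hz : Tendsto z l (𝓝 z₀)) (hB : Tendsto B l (𝓝 B₀))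
    {h : Ω → ℝ} (hh : Integrable h P) :
    Tendsto (fun i => ∫ ω, Real.tanh (X ω * z i + B i) * h ω ∂P) l
      (𝓝 (∫ ω, Real.tanh (X ω * z₀ + B₀) * h ω ∂P)) :=
  tendsto_integral_bdd_mul (fun _ => hX.aestronglyMeasurable_comp continuous_tanh _ _)
    (fun _ _ => abs_tanh_le_one _) hh fun ω =>
    (continuous_tanh.tendsto _).comp (tendsto_affine hz hB ω)

theorem continuousAt_maximizer {B : ℝ} (hu : hX.UniqueAt B) : ContinuousAt hX.maximizer B := by
  refine tendsto_of_subseq_tendsto fun b hb => ?_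
  have hbdd : ∀ n, hX.maximizer (b n) ∈ Metric.closedBall (0 : ℝ) (∫ ω, |X ω| ∂P) := by
    intro n
    rw [mem_closedBall_zero_iff, Real.norm_eq_abs, hX.maximizer_fixed]
    exact hX.abs_cwMap_le _ _
  obtain ⟨z, -, φ, hφ, hz⟩ := tendsto_subseq_of_bounded Metric.isBounded_closedBall hbdd
  refine ⟨φ, ?_⟩
  have hbφ : Tendsto (b ∘ φ) atTop (𝓝 B) := hb.comp hφ.tendsto_atTop
  have h1 := hX.tendsto_integral_tanh_mul hz hbφ hX.integrable
  have h2 : (fun i => ∫ ω, Real.tanh (X ω * ((fun n => hX.maximizer (b n)) ∘ φ) i +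
      (b ∘ φ) i) * X ω ∂P) = (fun n => hX.maximizer (b n)) ∘ φ :=
    funext fun i => (hX.maximizer_fixed (b (φ i))).symm
  rw [h2] at h1
  have hfix : z = cwMap P X B z := tendsto_nhds_unique hz h1
  have hsign : 0 ≤ B * z :=
    ge_of_tendsto (hbφ.mul hz) (Eventually.of_forall fun n => hX.maximizer_sign (b (φ n)))
  rw [hu z hfix hsign] at hz
  exact hz

/-- The limiting magnetization. -/
noncomputable def limitMagn (B : ℝ) : ℝ := cwMagn P X B (hX.maximizer B)

/-- The limiting pressure, up to a constant. -/
noncomputable def limitPressure (B : ℝ) : ℝ := cwFn P X B (hX.maximizer B)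

theorem tendsto_limitMagn {ι : Type*} {l : Filter ι} [l.IsCountablyGenerated] {b : ι → ℝ} {B : ℝ}
    (hb : Tendsto b l (𝓝 B)) (hu : hX.UniqueAt B) :
    Tendsto (fun i => hX.limitMagn (b i)) l (𝓝 (hX.limitMagn B)) := by
  have h := hX.tendsto_integral_tanh_mul ((hX.continuousAt_maximizer hu).tendsto.comp hb) hb
    (integrable_const (1 : ℝ))
  simp only [mul_one] at h
  exact h

theorem limitPressure_tangent (B B' : ℝ) :
    hX.limitPressure B + hX.limitMagn B * (B' - B) ≤ hX.limitPressure B' := by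
  have h1 := hX.cwFn_tangent B (hX.maximizer B) B' (hX.maximizer B)
  have h2 : cwFn P X B' (hX.maximizer B) ≤ cwFn P X B' (hX.maximizer B') :=
    hX.isMaxOn_maximizer B' (Set.mem_univ _)
  unfold limitPressure limitMagn
  linarith

theorem hasDerivAt_limitPressure {B : ℝ} (hu : hX.UniqueAt B) :
    HasDerivAt hX.limitPressure (hX.limitMagn B) B :=
  hasDerivAt_of_subgradient hX.limitPressure_tangent (hX.tendsto_limitMagn tendsto_id hu)

/-- The limiting susceptibility. -/
noncomputable def limitSusc (B : ℝ) : ℝ :=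
  (∫ ω, 1 / Real.cosh (X ω * hX.maximizer B + B) ^ 2 * X ω ∂P) ^ 2 /
    (1 - cwSlope P X B (hX.maximizer B)) +
  ∫ ω, 1 / Real.cosh (X ω * hX.maximizer B + B) ^ 2 * 1 ∂P

theorem hasDerivAt_limitMagn {B : ℝ} (hu : hX.UniqueAt B)
    (hq : cwSlope P X B (hX.maximizer B) < 1) :
    HasDerivAt hX.limitMagn (hX.limitSusc B) B := by
  set z := hX.maximizer with hz
  set D : ℝ → Ω → ℝ := fun B' ω => tanhSlope (X ω * z B + B) (X ω * z B' + B') with hD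
  have hDm : ∀ B', AEStronglyMeasurable (D B') P := fun B' =>
    (measurable_tanhSlope.comp_aemeasurable
      (((hX.integrable.aemeasurable.mul_const (z B)).add_const B).prodMk
        ((hX.integrable.aemeasurable.mul_const (z B')).add_const B'))).aestronglyMeasurable
  have hDb : ∀ B' ω, |D B' ω| ≤ 1 := fun B' ω => abs_tanhSlope_le _ _
  have hlim : ∀ {h : Ω → ℝ}, Integrable h P → Tendsto (fun B' => ∫ ω, D B' ω * h ω ∂P) (𝓝[≠] B)
      (𝓝 (∫ ω, 1 / Real.cosh (X ω * z B + B) ^ 2 * h ω ∂P)) := by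
    intro h hh
    refine (tendsto_integral_bdd_mul (l := 𝓝 B) hDm hDb hh fun ω => ?_).mono_left
      nhdsWithin_le_nhds
    exact (tendsto_tanhSlope _).comp
      (tendsto_affine (hX.continuousAt_maximizer hu).tendsto tendsto_id ω)
  have a2 := hlim hX.integrable_sq
  have a1 := hlim hX.integrable
  have a0 := hlim (integrable_const (1 : ℝ))
  have hDi : ∀ {h : Ω → ℝ}, Integrable h P → ∀ B', Integrable (fun ω => D B' ω * h ω) P :=
    fun hh B' => integrable_bdd_mul (hDm B') (hDb B') hh
  have e1 : ∀ B', z B' - z B = (z B' - z B) * (∫ ω, D B' ω * X ω ^ 2 ∂P) +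
      (B' - B) * ∫ ω, D B' ω * X ω ∂P := by
    intro B'
    rw [← integral_const_mul, ← integral_const_mul,
      ← integral_add ((hDi hX.integrable_sq B').const_mul _) ((hDi hX.integrable B').const_mul _)]
    conv_lhs => rw [hz, hX.maximizer_fixed B, hX.maximizer_fixed B']
    unfold cwMap
    rw [← integral_sub (hX.integrable_tanh_mul hX.integrable B' _)
      (hX.integrable_tanh_mul hX.integrable B _)]
    congr 1
    ext ω
    rw [← sub_mul, ← hz, ← tanhSlope_mul]
    ring
  have e0 : ∀ B', hX.limitMagn B' - hX.limitMagn B = (z B' - z B) * (∫ ω, D B' ω * X ω ∂P) +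
      (B' - B) * ∫ ω, D B' ω * 1 ∂P := by
    intro B'
    rw [← integral_const_mul, ← integral_const_mul, ← integral_add
      ((hDi hX.integrable B').const_mul _) ((hDi (integrable_const (1 : ℝ)) B').const_mul _)]
    unfold limitMagn cwMagn
    rw [← integral_sub (hX.integrable_tanh B' _) (hX.integrable_tanh B _)]
    congr 1
    ext ω
    rw [← hz, ← tanhSlope_mul]
    ring
  rw [hasDerivAt_iff_tendsto_slope]
  have hne : (1 - cwSlope P X B (z B)) ≠ 0 := by linarith
  have hT := (((a1.pow 2).div (tendsto_const_nhds (x := (1 : ℝ)) |>.sub a2) hne)).add a0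
  refine hT.congr' ?_
  have hev : ∀ᶠ B' in 𝓝[≠] B, (∫ ω, D B' ω * X ω ^ 2 ∂P) < 1 := a2.eventually_lt_const hq
  filter_upwards [hev, self_mem_nhdsWithin] with B' h1 h2
  have hB : B' - B ≠ 0 := sub_ne_zero.2 h2
  have h3 : 1 - ∫ ω, D B' ω * X ω ^ 2 ∂P ≠ 0 := by linarith
  have h4 : z B' - z B = (B' - B) * (∫ ω, D B' ω * X ω ∂P) / (1 - ∫ ω, D B' ω * X ω ^ 2 ∂P) := by
    rw [eq_div_iff h3]
    have := e1 B'
    linarith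
  rw [slope_def_field, e0 B', h4]
  simp only [Pi.div_apply]
  field_simp

theorem monotone_limitMagn : Monotone hX.limitMagn := by
  intro B B' h
  rcases eq_or_lt_of_le h with rfl | h
  · exact le_rfl
  have h1 := hX.limitPressure_tangent B B'
  have h2 := hX.limitPressure_tangent B' B
  nlinarith

theorem limitMagn_zero (hsub : ∫ ω, X ω ^ 2 ∂P ≤ 1) : hX.limitMagn 0 = 0 := by
  unfold limitMagn cwMagn
  rw [hX.maximizer_zero hsub]
  simp

theorem tendsto_limitMagn_zero (hsub : ∫ ω, X ω ^ 2 ∂P ≤ 1) :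
    Tendsto hX.limitMagn (𝓝[>] 0) (𝓝 0) := by
  have h := hX.tendsto_limitMagn (tendsto_id (x := 𝓝[>] (0 : ℝ)) |>.mono_right nhdsWithin_le_nhds)
    (hX.uniqueAt_zero hsub)
  rw [hX.limitMagn_zero hsub] at h
  exact h

theorem limitSusc_zero (hsub : ∫ ω, X ω ^ 2 ∂P ≤ 1) :
    hX.limitSusc 0 = (∫ ω, X ω ∂P) ^ 2 / (1 - ∫ ω, X ω ^ 2 ∂P) + 1 := by
  unfold limitSusc
  rw [hX.maximizer_zero hsub, cwSlope_zero]
  simp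

/-- In the supercritical regime the maximizer stays away from zero. -/
theorem exists_lt_maximizer (hsup : 1 < ∫ ω, X ω ^ 2 ∂P) :
    ∃ c > 0, ∀ B > 0, c < hX.maximizer B := by
  have hlim : Tendsto (fun z => ∫ ω, tanhSlope 0 (X ω * z) * X ω ^ 2 ∂P) (𝓝[>] 0)
      (𝓝 (∫ ω, X ω ^ 2 ∂P)) := by
    have h := tendsto_integral_bdd_mul (l := 𝓝[>] (0 : ℝ)) (P := P)
      (D := fun z ω => tanhSlope 0 (X ω * z)) (D₀ := fun _ => 1)
      (fun z => (measurable_tanhSlope.comp_aemeasurable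
        (aemeasurable_const.prodMk (hX.integrable.aemeasurable.mul_const z))).aestronglyMeasurable)
      (fun z ω => abs_tanhSlope_le _ _) hX.integrable_sq (fun ω => by
        have h0 := tendsto_tanhSlope 0
        simp only [Real.cosh_zero, one_pow, div_one] at h0
        refine h0.comp ?_
        have : Tendsto (fun z => X ω * z) (𝓝 0) (𝓝 (X ω * 0)) := tendsto_id.const_mul _
        rw [mul_zero] at this
        exact this.mono_left nhdsWithin_le_nhds)
    simpa using h
  have hev := hlim.eventually_const_lt hsup
  obtain ⟨c, hc, hcs⟩ := (mem_nhdsGT_iff_exists_Ioc_subset).1 hev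
  refine ⟨c, hc, fun B hB => ?_⟩
  by_contra hle
  push Not at hle
  have hz0 : 0 ≤ hX.maximizer B := by
    have := hX.maximizer_sign B
    nlinarith
  have hEX : 0 < ∫ ω, X ω ∂P := by
    by_contra hn
    have h0 := hX.ae_eq_zero_of_integral_nonpos (not_lt.1 hn)
    have : ∫ ω, X ω ^ 2 ∂P = 0 := integral_eq_zero_of_ae (by
      filter_upwards [h0] with ω hω
      simp [hω])
    linarith
  have hzne : hX.maximizer B ≠ 0 := by
    intro h
    have h1 := hX.maximizer_fixed B
    rw [h, cwMap_zero] at h1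
    have := mul_pos (tanh_pos hB) hEX
    linarith
  have hz : 0 < hX.maximizer B := lt_of_le_of_ne hz0 hzne.symm
  have h1 : 1 < ∫ ω, tanhSlope 0 (X ω * hX.maximizer B) * X ω ^ 2 ∂P := hcs ⟨hz, hle⟩
  have h2 : (∫ ω, tanhSlope 0 (X ω * hX.maximizer B) * X ω ^ 2 ∂P) * hX.maximizer B ≤
      cwMap P X B (hX.maximizer B) := by
    rw [← integral_mul_const]
    unfold cwMap
    refine integral_mono_ae ((integrable_bdd_mul ?_ (fun ω => abs_tanhSlope_le _ _)
      hX.integrable_sq).mul_const _) (hX.integrable_tanh_mul hX.integrable _ _) ?_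
    · exact (measurable_tanhSlope.comp_aemeasurable (aemeasurable_const.prodMk
        (hX.integrable.aemeasurable.mul_const _))).aestronglyMeasurable
    · filter_upwards [hX.nonneg] with ω hω
      have e : tanhSlope 0 (X ω * hX.maximizer B) * X ω ^ 2 * hX.maximizer B =
          Real.tanh (X ω * hX.maximizer B) * X ω := by
        have := tanhSlope_mul 0 (X ω * hX.maximizer B)
        rw [sub_zero, Real.tanh_zero, sub_zero] at this
        rw [← this]; ring
      rw [e]
      exact mul_le_mul_of_nonneg_right (tanh_mono.monotone (by linarith)) hω
  rw [← hX.maximizer_fixed] at h2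
  nlinarith

theorem tendsto_limitMagn_pos (hsup : 1 < ∫ ω, X ω ^ 2 ∂P) :
    ∃ m₀, 0 < m₀ ∧ Tendsto hX.limitMagn (𝓝[>] 0) (𝓝 m₀) := by
  obtain ⟨c, hc, hcz⟩ := hX.exists_lt_maximizer hsup
  have hlow : ∀ B > 0, cwMagn P X 0 c ≤ hX.limitMagn B := by
    intro B hB
    unfold limitMagn cwMagn
    refine integral_mono_ae (hX.integrable_tanh 0 c) (hX.integrable_tanh _ _) ?_
    filter_upwards [hX.nonneg] with ω hω
    refine tanh_mono.monotone ?_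
    have := mul_le_mul_of_nonneg_left (hcz B hB).le hω
    linarith
  have hpos : 0 < cwMagn P X 0 c := by
    have hnn : ∀ᵐ ω ∂P, 0 ≤ Real.tanh (X ω * c + 0) := by
      filter_upwards [hX.nonneg] with ω hω
      rw [add_zero]
      exact tanh_nonneg (by positivity)
    refine lt_of_le_of_ne (integral_nonneg_of_ae hnn) fun h => ?_
    have h0 := (integral_eq_zero_iff_of_nonneg_ae hnn (hX.integrable_tanh 0 c)).1 h.symm
    have : ∫ ω, X ω ^ 2 ∂P = 0 := integral_eq_zero_of_ae (by
      filter_upwards [h0, hX.nonneg] with ω h1 h2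
      simp only [Pi.zero_apply, add_zero] at h1 ⊢
      rcases eq_or_lt_of_le h2 with h3 | h3
      · rw [← h3]; simp
      · exact absurd h1 (tanh_pos (mul_pos h3 hc)).ne')
    linarith
  refine ⟨_, ?_, hX.monotone_limitMagn.tendsto_nhdsGT 0⟩
  refine lt_of_lt_of_le hpos (le_csInf ⟨_, 1, Set.mem_Ioi.2 one_pos, rfl⟩ ?_)
  rintro _ ⟨B, hB, rfl⟩
  exact hlow B hB

end NonnegSq
end Maximizer
end AnnealedGRG

namespace AnnealedGRG

section Empirical

variable {Ω : Type*} [MeasurableSpace Ω] {P : Measure Ω} [IsProbabilityMeasure P] {W : Ω → ℝ}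
  {w : (N : ℕ) → Fin N → ℝ}

/-- The empirical average of `g` over the weights. -/
noncomputable def weightAvg (w : (N : ℕ) → Fin N → ℝ) (g : ℝ → ℝ) (N : ℕ) : ℝ :=
  1 / (N : ℝ) * ∑ i, g (w N i)

theorem weightAvg_mono {g h : ℝ → ℝ} (hgh : ∀ N i, g (w N i) ≤ h (w N i)) (N : ℕ) :
    weightAvg w g N ≤ weightAvg w h N :=
  mul_le_mul_of_nonneg_left (Finset.sum_le_sum fun i _ => hgh N i) (by positivity)

theorem weightAvg_add (g h : ℝ → ℝ) (N : ℕ) :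
    weightAvg w (fun x => g x + h x) N = weightAvg w g N + weightAvg w h N := by
  unfold weightAvg
  rw [Finset.sum_add_distrib, mul_add]

theorem WeightRegularity.tendsto_weightAvg_bounded (hreg : WeightRegularity w W P)
    (g : BoundedContinuousFunction ℝ ℝ) :
    Tendsto (weightAvg w g) atTop (𝓝 (∫ ω, g (W ω) ∂P)) := by
  have h := (ProbabilityMeasure.tendsto_iff_forall_integral_tendsto.1
    hreg.tendsto_dist.tendsto) g
  rw [← tendsto_add_atTop_iff_nat 1]
  convert h using 1
  · ext n
    simp only [ProbabilityMeasure.coe_mk]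
    rw [integral_map (hreg.tendsto_dist.forall_aemeasurable n)
      g.continuous.aestronglyMeasurable, PMF.integral_eq_sum]
    unfold weightAvg
    rw [Finset.mul_sum]
    refine Finset.sum_congr rfl fun i _ => ?_
    have e : ((n : ENNReal) + 1).toReal = (n : ℝ) + 1 := by
      rw [ENNReal.toReal_add (by simp) (by simp)]; simp
    simp [PMF.uniformOfFintype_apply, e]
  · simp only [ProbabilityMeasure.coe_mk]
    rw [integral_map hreg.tendsto_dist.aemeasurable_limit g.continuous.aestronglyMeasurable]

theorem WeightRegularity.ae_nonneg (hreg : WeightRegularity w W P) (hpos : ∀ N i, 0 < w N i) :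
    ∀ᵐ ω ∂P, 0 ≤ W ω := by
  set g : BoundedContinuousFunction ℝ ℝ := BoundedContinuousFunction.ofNormedAddCommGroup
    (fun x => min (max (-x) 0) 1) (by fun_prop) 1 (fun x => by
      rw [Real.norm_of_nonneg (le_min (le_max_right _ _) zero_le_one)]
      exact min_le_right _ _) with hg
  have hgx : ∀ x, g x = min (max (-x) 0) 1 := fun _ => rfl
  have hg0 : ∀ x, 0 ≤ g x := fun x => le_min (le_max_right _ _) zero_le_one
  have h1 := hreg.tendsto_weightAvg_bounded g
  have h2 : weightAvg w g = fun _ => 0 := by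
    ext N
    unfold weightAvg
    rw [Finset.sum_eq_zero fun i _ => ?_, mul_zero]
    rw [hgx, max_eq_right (by linarith [hpos N i]), min_eq_left zero_le_one]
  rw [h2] at h1
  have h3 := tendsto_nhds_unique h1 tendsto_const_nhds
  have hint : Integrable (fun ω => g (W ω)) P :=
    Integrable.of_bound (g.continuous.comp_aestronglyMeasurable
      hreg.integrable.aestronglyMeasurable) 1 (Eventually.of_forall fun ω => by
        rw [Real.norm_of_nonneg (hg0 _)]; exact min_le_right _ _)
  have h4 := (integral_eq_zero_iff_of_nonneg (fun ω => hg0 (W ω)) hint).1 h3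
  filter_upwards [h4] with ω hω
  by_contra hn
  push Not at hn
  have : 0 < g (W ω) := lt_min (lt_max_of_lt_left (by linarith)) one_pos
  exact this.ne' hω

theorem WeightRegularity.eventually_lt_weightAvg (hreg : WeightRegularity w W P) {g : ℝ → ℝ}
    (hg : Continuous g) (hg0 : ∀ x, 0 ≤ g x) (hi : Integrable (fun ω => g (W ω)) P) {c : ℝ}
    (hc : c < ∫ ω, g (W ω) ∂P) : ∀ᶠ N in atTop, c < weightAvg w g N := by
  have hlim : Tendsto (fun n : ℕ => ∫ ω, min (g (W ω)) n ∂P) atTop (𝓝 (∫ ω, g (W ω) ∂P)) := by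
    refine tendsto_integral_of_dominated_convergence (fun ω => g (W ω)) (fun n => ?_) hi
      (fun n => Eventually.of_forall fun ω => ?_) (Eventually.of_forall fun ω => ?_)
    · exact (hg.min continuous_const).comp_aestronglyMeasurable
        hreg.integrable.aestronglyMeasurable
    · rw [Real.norm_of_nonneg (le_min (hg0 _) (Nat.cast_nonneg n))]
      exact min_le_left _ _
    · refine tendsto_const_nhds.congr' ?_
      filter_upwards [eventually_ge_atTop ⌈g (W ω)⌉₊] with n hn
      rw [min_eq_left ((Nat.le_ceil _).trans (by exact_mod_cast hn))]
  obtain ⟨n, hn⟩ := (hlim.eventually_const_lt hc).exists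
  set f : BoundedContinuousFunction ℝ ℝ := BoundedContinuousFunction.ofNormedAddCommGroup
    (fun x => min (g x) n) (by fun_prop) n (fun x => by
      rw [Real.norm_of_nonneg (le_min (hg0 _) (Nat.cast_nonneg n))]
      exact min_le_right _ _) with hf
  filter_upwards [(hreg.tendsto_weightAvg_bounded f).eventually_const_lt hn] with N hN
  exact hN.trans_le (weightAvg_mono (fun M i => min_le_left (g (w M i)) n) N)

/-- Convergence of empirical averages of continuous functions of at most linear growth. -/
theorem WeightRegularity.tendsto_weightAvg (hreg : WeightRegularity w W P)
    (hpos : ∀ N i, 0 < w N i) {g : ℝ → ℝ} (hg : Continuous g) {C : ℝ}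
    (hC : ∀ x, |g x| ≤ C * (1 + |x|)) :
    Tendsto (weightAvg w g) atTop (𝓝 (∫ ω, g (W ω) ∂P)) := by
  have hW := hreg.ae_nonneg hpos
  have hbi : Integrable (fun ω => C * (1 + |W ω|)) P :=
    ((integrable_const 1).add hreg.integrable.abs).const_mul C
  have hgi : Integrable (fun ω => g (W ω)) P :=
    hbi.mono' (hg.comp_aestronglyMeasurable hreg.integrable.aestronglyMeasurable)
      (Eventually.of_forall fun ω => hC _)
  have hb : Tendsto (weightAvg w fun x => C * (1 + |x|)) atTop
      (𝓝 (∫ ω, C * (1 + |W ω|) ∂P)) := by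
    have h1 : ∫ ω, C * (1 + |W ω|) ∂P = C * (1 + ∫ ω, W ω ∂P) := by
      rw [integral_const_mul, integral_add (integrable_const 1) hreg.integrable.abs]
      simp only [integral_const, probReal_univ, smul_eq_mul, mul_one]
      congr 2
      refine integral_congr_ae ?_
      filter_upwards [hW] with ω hω
      exact abs_of_nonneg hω
    rw [h1]
    refine ((tendsto_const_nhds.add hreg.tendsto_mean).const_mul C).congr' ?_
    filter_upwards [eventually_gt_atTop 0] with N hN
    have hN' : (N : ℝ) ≠ 0 := by positivity
    unfold weightAvg
    rw [← Finset.mul_sum, Finset.sum_add_distrib,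
      Finset.sum_congr rfl fun i _ => abs_of_pos (hpos N i)]
    simp only [Finset.sum_const, Finset.card_univ, Fintype.card_fin, nsmul_eq_mul, mul_one]
    field_simp
  have hbg : ∀ x, |g x| ≤ C * (1 + |x|) := hC
  rw [tendsto_order]
  constructor
  · intro c hc
    set ε := ((∫ ω, g (W ω) ∂P) - c) / 2 with hε
    have hε0 : 0 < ε := by rw [hε]; linarith
    have h1 := hreg.eventually_lt_weightAvg (g := fun x => C * (1 + |x|) + g x)
      (by fun_prop) (fun x => by linarith [neg_abs_le (g x), hbg x]) (hbi.add hgi)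
      (c := (∫ ω, C * (1 + |W ω|) ∂P) + (∫ ω, g (W ω) ∂P) - ε)
      (by rw [integral_add hbi hgi]; linarith)
    have h2 := hb.eventually_lt_const (show _ < (∫ ω, C * (1 + |W ω|) ∂P) + ε by linarith)
    filter_upwards [h1, h2] with N h1 h2
    rw [weightAvg_add] at h1
    linarith
  · intro c hc
    set ε := (c - (∫ ω, g (W ω) ∂P)) / 2 with hε
    have hε0 : 0 < ε := by rw [hε]; linarith
    have h1 := hreg.eventually_lt_weightAvg (g := fun x => C * (1 + |x|) - g x)
      (by fun_prop) (fun x => by linarith [le_abs_self (g x), hbg x]) (hbi.sub hgi)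
      (c := (∫ ω, C * (1 + |W ω|) ∂P) - (∫ ω, g (W ω) ∂P) - ε)
      (by rw [integral_sub hbi hgi]; linarith)
    have h2 := hb.eventually_lt_const (show _ < (∫ ω, C * (1 + |W ω|) ∂P) + ε by linarith)
    filter_upwards [h1, h2] with N h1 h2
    have h3 := weightAvg_add (w := w) (fun x => C * (1 + |x|) - g x) g N
    simp only [sub_add_cancel] at h3
    linarith

theorem WeightRegularity.tendsto_totalWeight_div (hreg : WeightRegularity w W P) :
    Tendsto (fun N : ℕ => totalWeight (w N) / N) atTop (𝓝 (∫ ω, W ω ∂P)) := by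
  refine hreg.tendsto_mean.congr fun N => ?_
  rw [totalWeight]; ring

theorem WeightRegularity.tendsto_sq_div_totalWeight (hreg : WeightRegularity w W P) :
    Tendsto (fun N : ℕ => (∑ i, w N i ^ 2) / totalWeight (w N)) atTop (𝓝 (nu W P)) := by
  refine (hreg.tendsto_sq.div hreg.tendsto_mean hreg.mean_pos.ne').congr' ?_
  filter_upwards [eventually_gt_atTop 0] with N hN
  have hN' : (N : ℝ) ≠ 0 := by positivity
  simp only [Pi.div_apply, totalWeight]
  field_simp

end Empirical

section CurieWeiss

variable {N : ℕ}

theorem sum_exp_linear (c : Fin N → ℝ) :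
    ∑ σ : Spins N, Real.exp (∑ i, c i * spin σ i) = ∏ i, (2 * Real.cosh (c i)) := by
  have h := Finset.prod_univ_sum (fun _ : Fin N => (univ : Finset ℤˣ))
    (fun i u => Real.exp (c i * ((u : ℤ) : ℝ)))
  rw [Fintype.piFinset_univ] at h
  simp_rw [Real.exp_sum]
  refine h.symm.trans (Finset.prod_congr rfl fun i _ => ?_)
  rw [UnitsInt.univ, Finset.sum_pair (by decide), Real.cosh_eq]
  push_cast
  rw [mul_one, mul_neg_one]
  ring

/-- The partition function of the Curie–Weiss model with weights `w` and coupling `s`. -/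
noncomputable def cwPartition (w : Fin N → ℝ) (s B : ℝ) : ℝ :=
  ∑ σ : Spins N, Real.exp (s / (2 * totalWeight w) * (∑ i, w i * spin σ i) ^ 2 + B * totalSpin σ)

/-- The finite-volume variational function. -/
noncomputable def cwFinite (w : Fin N → ℝ) (a B z : ℝ) : ℝ :=
  Real.log 2 + 1 / (N : ℝ) * ∑ i, Real.log (Real.cosh (a * w i * z + B)) - z ^ 2 / 2

theorem sum_exp_tilt (w : Fin N → ℝ) (hN : 0 < N) (a B z : ℝ) :
    ∑ σ : Spins N, Real.exp (a * (∑ i, w i * spin σ i) * z + B * totalSpin σ) =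
      Real.exp (N * (cwFinite w a B z + z ^ 2 / 2)) := by
  have hN' : (N : ℝ) ≠ 0 := by positivity
  have h1 : ∀ σ : Spins N, a * (∑ i, w i * spin σ i) * z + B * totalSpin σ =
      ∑ i, (a * w i * z + B) * spin σ i := by
    intro σ
    rw [totalSpin, Finset.mul_sum, Finset.sum_mul, Finset.mul_sum, ← Finset.sum_add_distrib]
    exact Finset.sum_congr rfl fun i _ => by ring
  simp_rw [h1]
  rw [sum_exp_linear]
  have h2 : (N : ℝ) * (cwFinite w a B z + z ^ 2 / 2) =
      ∑ i, (Real.log 2 + Real.log (Real.cosh (a * w i * z + B))) := by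
    rw [cwFinite, Finset.sum_add_distrib, sub_add_cancel, mul_add, ← mul_assoc,
      mul_one_div_cancel hN', one_mul]
    simp only [Finset.sum_const, Finset.card_univ, Fintype.card_fin, nsmul_eq_mul]
  rw [h2, Real.exp_sum]
  refine Finset.prod_congr rfl fun i _ => ?_
  rw [Real.exp_add, Real.exp_log (by norm_num), Real.exp_log (Real.cosh_pos _)]

theorem quadratic_eq (w : Fin N → ℝ) (hN : 0 < N) (hl : 0 < totalWeight w) {s a : ℝ}
    (ha : a ^ 2 = s * N / totalWeight w) (y : ℝ) :
    s / (2 * totalWeight w) * y ^ 2 = N * ((a * y / N) ^ 2 / 2) := by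
  have hN' : (N : ℝ) ≠ 0 := by positivity
  rw [div_pow, mul_pow, ha]
  field_simp

theorem cwPartition_pos (w : Fin N → ℝ) (s B : ℝ) : 0 < cwPartition w s B :=
  Finset.sum_pos (fun _ _ => Real.exp_pos _) ⟨1, Finset.mem_univ _⟩

theorem le_log_cwPartition (w : Fin N → ℝ) (hN : 0 < N) (hl : 0 < totalWeight w) {s a : ℝ}
    (ha : a ^ 2 = s * N / totalWeight w) (B z : ℝ) :
    cwFinite w a B z ≤ 1 / (N : ℝ) * Real.log (cwPartition w s B) := by
  have hN' : (0 : ℝ) < N := by positivity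
  rw [one_div, inv_mul_eq_div, le_div_iff₀ hN', Real.le_log_iff_exp_le (cwPartition_pos w s B)]
  have h1 : Real.exp (cwFinite w a B z * N) =
      ∑ σ : Spins N, Real.exp (a * (∑ i, w i * spin σ i) * z + B * totalSpin σ - N * (z ^ 2 / 2)) := by
    simp_rw [sub_eq_add_neg, Real.exp_add (_ + _), ← Finset.sum_mul]
    rw [sum_exp_tilt w hN, ← Real.exp_add]
    congr 1; ring
  rw [h1]
  refine Finset.sum_le_sum fun σ _ => Real.exp_le_exp.2 ?_
  rw [quadratic_eq w hN hl ha]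
  set y := a * (∑ i, w i * spin σ i) with hy
  have e : y * z = N * ((y / N) * z) := by field_simp
  have h2 : (0 : ℝ) ≤ N * (y / N - z) ^ 2 := by positivity
  rw [e]
  nlinarith

theorem log_cwPartition_le (w : Fin N → ℝ) (hw : ∀ i, 0 < w i) (hN : 0 < N) {s a : ℝ}
    (ha0 : 0 ≤ a) (ha : a ^ 2 = s * N / totalWeight w) (B : ℝ) {R δ F : ℝ}
    (hR : a * (totalWeight w / N) ≤ R) {G : Finset ℝ}
    (hG : ∀ x ∈ Set.Icc (-R) R, ∃ z ∈ G, |x - z| ≤ δ) (hF : ∀ z ∈ G, cwFinite w a B z ≤ F) :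
    1 / (N : ℝ) * Real.log (cwPartition w s B) ≤
      1 / (N : ℝ) * Real.log (#G) + (F + δ ^ 2 / 2) := by
  have hN' : (0 : ℝ) < N := by positivity
  have hl := totalWeight_pos hw ⟨0, hN⟩
  have hx : ∀ σ : Spins N, a * (∑ i, w i * spin σ i) / N ∈ Set.Icc (-R) R := by
    intro σ
    have h1 : |∑ i, w i * spin σ i| ≤ totalWeight w := by
      refine (Finset.abs_sum_le_sum_abs _ _).trans_eq (Finset.sum_congr rfl fun i _ => ?_)
      rw [abs_mul, abs_spin, mul_one, abs_of_pos (hw i)]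
    refine abs_le.1 (le_trans ?_ hR)
    rw [abs_div, abs_mul, abs_of_nonneg ha0, abs_of_pos hN', mul_div_assoc]
    gcongr
  have hGne : 0 < (#G : ℝ) := by
    obtain ⟨z, hz, -⟩ := hG _ (hx 1)
    exact_mod_cast Finset.card_pos.2 ⟨z, hz⟩
  have hle : cwPartition w s B ≤ #G * Real.exp (N * (F + δ ^ 2 / 2)) := by
    calc cwPartition w s B
        ≤ ∑ σ : Spins N, ∑ z ∈ G, Real.exp (a * (∑ i, w i * spin σ i) * z + B * totalSpin σ) *
            Real.exp (N * (δ ^ 2 / 2 - z ^ 2 / 2)) := by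
          refine Finset.sum_le_sum fun σ _ => ?_
          obtain ⟨z, hz, hxz⟩ := hG _ (hx σ)
          refine le_trans ?_ (Finset.single_le_sum (f := fun z =>
            Real.exp (a * (∑ i, w i * spin σ i) * z + B * totalSpin σ) *
            Real.exp (N * (δ ^ 2 / 2 - z ^ 2 / 2))) (fun _ _ => by positivity) hz)
          rw [← Real.exp_add, Real.exp_le_exp, quadratic_eq w hN hl ha]
          set y := a * (∑ i, w i * spin σ i) with hy
          have e : y * z = N * ((y / N) * z) := by field_simp
          have h2 : (y / N - z) ^ 2 ≤ δ ^ 2 := by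
            rw [← sq_abs]
            exact pow_le_pow_left₀ (abs_nonneg _) hxz 2
          have h3 := mul_le_mul_of_nonneg_left h2 hN'.le
          rw [e]
          nlinarith
      _ = ∑ z ∈ G, Real.exp (N * (cwFinite w a B z + δ ^ 2 / 2)) := by
          rw [Finset.sum_comm]
          refine Finset.sum_congr rfl fun z _ => ?_
          rw [← Finset.sum_mul, sum_exp_tilt w hN, ← Real.exp_add]
          congr 1; ring
      _ ≤ ∑ _z ∈ G, Real.exp (N * (F + δ ^ 2 / 2)) := by
          refine Finset.sum_le_sum fun z hz => Real.exp_le_exp.2 ?_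
          have := hF z hz
          gcongr
      _ = #G * Real.exp (N * (F + δ ^ 2 / 2)) := by
          rw [Finset.sum_const, nsmul_eq_mul]
  have h1 := Real.log_le_log (cwPartition_pos w s B) hle
  rw [Real.log_mul hGne.ne' (Real.exp_pos _).ne', Real.log_exp] at h1
  have h2 := mul_le_mul_of_nonneg_left h1 (show 0 ≤ 1 / (N : ℝ) by positivity)
  refine h2.trans_eq ?_
  field_simp

end CurieWeiss

section CurieWeissLimit

variable {Ω : Type*} [MeasurableSpace Ω] {P : Measure Ω} [IsProbabilityMeasure P] {W : Ω → ℝ}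
  {w : (N : ℕ) → Fin N → ℝ}

theorem WeightRegularity.tendsto_scale (hreg : WeightRegularity w W P) (β : ℝ) :
    Tendsto (fun N : ℕ => √(Real.sinh β / (totalWeight (w N) / N))) atTop (𝓝 (scale W P β)) :=
  (Real.continuous_sqrt.tendsto _).comp
    (tendsto_const_nhds.div hreg.tendsto_totalWeight_div hreg.mean_pos.ne')

theorem WeightRegularity.tendsto_cwFinite (hreg : WeightRegularity w W P)
    (hpos : ∀ N i, 0 < w N i) {a : ℕ → ℝ} {a₀ : ℝ} (ha : Tendsto a atTop (𝓝 a₀)) (B z : ℝ) :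
    Tendsto (fun N => cwFinite (w N) (a N) B z) atTop
      (𝓝 (Real.log 2 + cwFn P (fun ω => a₀ * W ω) B z)) := by
  have h1 := hreg.tendsto_weightAvg hpos (g := fun x => Real.log (Real.cosh (a₀ * x * z + B)))
    (continuous_log_cosh.comp (by fun_prop)) (C := |a₀| * |z| + |B|) (fun x => by
      rw [abs_of_nonneg (log_cosh_nonneg _)]
      refine (log_cosh_le_abs _).trans ((abs_add_le _ _).trans ?_)
      rw [abs_mul, abs_mul]
      have := mul_nonneg (mul_nonneg (abs_nonneg a₀) (abs_nonneg z)) zero_le_one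
      have := mul_nonneg (abs_nonneg B) (abs_nonneg x)
      nlinarith)
  have h2 : Tendsto (fun N : ℕ => 1 / (N : ℝ) * ∑ i, Real.log (Real.cosh (a N * w N i * z + B)) -
      weightAvg w (fun x => Real.log (Real.cosh (a₀ * x * z + B))) N) atTop (𝓝 0) := by
    have hb : Tendsto (fun N : ℕ => |a N - a₀| * |z| * (1 / (N : ℝ) * ∑ i, w N i)) atTop
        (𝓝 0) := by
      have := (((ha.sub_const a₀).abs.mul_const |z|)).mul hreg.tendsto_mean
      simpa using this
    refine squeeze_zero_norm (fun N => ?_) hb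
    unfold weightAvg
    rw [← mul_sub, ← Finset.sum_sub_distrib, Real.norm_eq_abs, abs_mul,
      abs_of_nonneg (show 0 ≤ 1 / (N : ℝ) by positivity), mul_left_comm]
    refine mul_le_mul_of_nonneg_left ?_ (by positivity)
    rw [Finset.mul_sum]
    refine (Finset.abs_sum_le_sum_abs _ _).trans (Finset.sum_le_sum fun i _ => ?_)
    refine (abs_log_cosh_sub_le _ _).trans_eq ?_
    rw [show a N * w N i * z + B - (a₀ * w N i * z + B) = (a N - a₀) * z * w N i by ring, abs_mul,
      abs_mul, abs_of_pos (hpos N i)]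
  have h3 := ((h2.add h1).const_add (Real.log 2)).sub_const (z ^ 2 / 2)
  simp only [sub_add_cancel, zero_add] at h3
  unfold cwFn cwFinite
  rw [← add_sub_assoc]
  exact h3

theorem WeightRegularity.nonnegSq (hreg : WeightRegularity w W P) (hpos : ∀ N i, 0 < w N i)
    {a : ℝ} (ha : 0 ≤ a) : NonnegSq (fun ω => a * W ω) P where
  nonneg := by
    filter_upwards [hreg.ae_nonneg hpos] with ω hω
    positivity
  integrable := hreg.integrable.const_mul a
  integrable_sq := by
    simp_rw [mul_pow]
    exact hreg.integrable_sq.const_mul _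

/-- The pressure of the Curie–Weiss model with weights. -/
theorem WeightRegularity.tendsto_log_cwPartition (hreg : WeightRegularity w W P)
    (hpos : ∀ N i, 0 < w N i) {β : ℝ} (hβ : 0 ≤ β) (B : ℝ)
    (hX : NonnegSq (fun ω => scale W P β * W ω) P) :
    Tendsto (fun N : ℕ => 1 / (N : ℝ) * Real.log (cwPartition (w N) (Real.sinh β) B)) atTop
      (𝓝 (Real.log 2 + hX.limitPressure B)) := by
  set a : ℕ → ℝ := fun N => √(Real.sinh β / (totalWeight (w N) / N)) with ha
  have hs := Real.sinh_nonneg_iff.2 hβ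
  have hat : Tendsto a atTop (𝓝 (scale W P β)) := hreg.tendsto_scale β
  have hasq : ∀ N, 0 < N → a N ^ 2 = Real.sinh β * N / totalWeight (w N) := by
    intro N hN
    have hl := totalWeight_nonneg (hpos N)
    rw [ha]
    simp only
    rw [Real.sq_sqrt (by positivity), div_div_eq_mul_div]
  have hlim := fun z => hreg.tendsto_cwFinite hpos hat B z
  rw [tendsto_order]
  constructor
  · intro c hc
    filter_upwards [(hlim (hX.maximizer B)).eventually_const_lt hc, eventually_gt_atTop 0]
      with N h1 hN
    exact h1.trans_le (le_log_cwPartition _ hN (totalWeight_pos (hpos N) ⟨0, hN⟩) (hasq N hN) _ _)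
  · intro c hc
    set F := Real.log 2 + hX.limitPressure B with hF
    set ε := (c - F) / 4 with hε
    have hε0 : 0 < ε := by rw [hε]; linarith
    set R := scale W P β * (∫ ω, W ω ∂P) + 1 with hR
    set δ := √(2 * ε) with hδ
    have hδ0 : 0 < δ := Real.sqrt_pos.2 (by linarith)
    have hδ2 : δ ^ 2 / 2 = ε := by rw [hδ, Real.sq_sqrt (by linarith)]; ring
    obtain ⟨t, -, htf, ht⟩ := (isCompact_Icc (a := -R) (b := R)).finite_cover_balls hδ0
    set G := htf.toFinset with hG
    have hcov : ∀ x ∈ Set.Icc (-R) R, ∃ z ∈ G, |x - z| ≤ δ := by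
      intro x hx
      obtain ⟨z, hz, hxz⟩ := Set.mem_iUnion₂.1 (ht hx)
      exact ⟨z, htf.mem_toFinset.2 hz, (Metric.mem_ball.1 hxz).le⟩
    have e1 : ∀ᶠ N in atTop, ∀ z ∈ G, cwFinite (w N) (a N) B z ≤ F + ε := by
      rw [Filter.eventually_all_finset]
      intro z _
      have h1 : Real.log 2 + cwFn P (fun ω => scale W P β * W ω) B z < F + ε := by
        have : cwFn P (fun ω => scale W P β * W ω) B z ≤ hX.limitPressure B :=
          hX.isMaxOn_maximizer B (Set.mem_univ z)
        linarith
      filter_upwards [(hlim z).eventually_lt_const h1] with N hN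
      exact hN.le
    have e2 : ∀ᶠ N in atTop, a N * (totalWeight (w N) / N) < R :=
      (hat.mul hreg.tendsto_totalWeight_div).eventually_lt_const (by rw [hR]; linarith)
    have e3 : Tendsto (fun N : ℕ => 1 / (N : ℝ) * Real.log (#G)) atTop (𝓝 0) := by
      have := (tendsto_one_div_atTop_nhds_zero_nat (𝕜 := ℝ)).mul_const (Real.log (#G))
      simpa using this
    filter_upwards [e1, e2, e3.eventually_lt_const hε0, eventually_gt_atTop 0] with N h1 h2 h3 hN
    have h4 := log_cwPartition_le (w N) (hpos N) hN (Real.sqrt_nonneg _) (hasq N hN) B h2.le hcov h1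
    rw [hδ2] at h4
    linarith

end CurieWeissLimit
end AnnealedGRG

namespace AnnealedGRG

section Asymptotics

variable {N : ℕ} {w : Fin N → ℝ}

/-- The constant in the expansion of `log (1 + p (e^b - 1))`. -/
noncomputable def logErr (b : ℝ) : ℝ :=
  Real.exp |b| * (Real.exp b - 1) ^ 2 + |Real.exp b - 1|

theorem logErr_nonneg (b : ℝ) : 0 ≤ logErr b := by unfold logErr; positivity

theorem abs_log_one_add_sub_le {y : ℝ} (hy : 0 < 1 + y) :
    |Real.log (1 + y) - y| ≤ y ^ 2 / (1 + y) := by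
  have h1 := Real.log_le_sub_one_of_pos hy
  have h2 := Real.one_sub_inv_le_log_of_pos hy
  have h3 : 1 - (1 + y)⁻¹ = y - y ^ 2 / (1 + y) := by field_simp; ring
  have h4 : 0 ≤ y ^ 2 / (1 + y) := by positivity
  rw [abs_le]
  constructor <;> linarith

theorem abs_log_edge_sub_le (hw : ∀ i, 0 < w i) (i j : Fin N) (b : ℝ) :
    |Real.log (1 + edgeProb w i j * (Real.exp b - 1)) - edgeOdds w i j * (Real.exp b - 1)| ≤
      logErr b * edgeOdds w i j ^ 2 := by
  have hp := edgeProb_pos hw i j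
  have hp1 := edgeProb_lt_one hw i j
  have hpx := edgeProb_le_odds hw i j
  have hxp := odds_sub_edgeProb_le hw i j
  set p := edgeProb w i j with hpdef
  set x := edgeOdds w i j with hxdef
  have hpos := one_add_edgeProb_mul_pos hw i j b
  rw [← hpdef] at hpos
  have h1 := abs_log_one_add_sub_le hpos
  have hlow : Real.exp (-|b|) ≤ 1 + p * (Real.exp b - 1) := by
    have e1 : Real.exp (-|b|) ≤ 1 := Real.exp_le_one_iff.2 (neg_nonpos.2 (abs_nonneg b))
    have e2 : Real.exp (-|b|) ≤ Real.exp b := Real.exp_le_exp.2 (neg_abs_le b)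
    nlinarith
  have h2 : (p * (Real.exp b - 1)) ^ 2 / (1 + p * (Real.exp b - 1)) ≤
      Real.exp |b| * (Real.exp b - 1) ^ 2 * x ^ 2 := by
    calc (p * (Real.exp b - 1)) ^ 2 / (1 + p * (Real.exp b - 1))
        ≤ (p * (Real.exp b - 1)) ^ 2 / Real.exp (-|b|) := by gcongr
      _ = Real.exp |b| * (Real.exp b - 1) ^ 2 * p ^ 2 := by
          rw [Real.exp_neg, div_inv_eq_mul]; ring
      _ ≤ Real.exp |b| * (Real.exp b - 1) ^ 2 * x ^ 2 := by gcongr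
  have h3 : |p * (Real.exp b - 1) - x * (Real.exp b - 1)| ≤ |Real.exp b - 1| * x ^ 2 := by
    rw [← sub_mul, abs_mul, mul_comm, abs_sub_comm p x, abs_of_nonneg (by linarith : 0 ≤ x - p)]
    gcongr
  have h4 := abs_sub_le (Real.log (1 + p * (Real.exp b - 1))) (p * (Real.exp b - 1))
    (x * (Real.exp b - 1))
  unfold logErr
  linarith

theorem sum_pairs_symm {f : Fin N → Fin N → ℝ} (hf : ∀ i j, f i j = f j i) :
    ∑ e ∈ pairs N, f e.1 e.2 = ((∑ i, ∑ j, f i j) - ∑ i, f i i) / 2 := by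
  have h1 : ∑ i, ∑ j, f i j = (∑ i, ∑ j, if i < j then f i j else 0) +
      (∑ i, ∑ j, if j < i then f i j else 0) + ∑ i, ∑ j, if i = j then f i j else 0 := by
    simp only [← Finset.sum_add_distrib]
    refine Finset.sum_congr rfl fun i _ => Finset.sum_congr rfl fun j _ => ?_
    rcases lt_trichotomy i j with h | h | h
    · simp [h, h.ne, not_lt_of_gt h]
    · simp [h]
    · simp [h, h.ne', not_lt_of_gt h]
  have h2 : (∑ i, ∑ j, if j < i then f i j else 0) = ∑ i, ∑ j, if i < j then f i j else 0 := by
    rw [Finset.sum_comm]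
    exact Finset.sum_congr rfl fun i _ => Finset.sum_congr rfl fun j _ => by rw [hf]
  have h3 : (∑ i, ∑ j, if i = j then f i j else 0) = ∑ i, f i i :=
    Finset.sum_congr rfl fun i _ => by simp
  have h4 : ∑ e ∈ pairs N, f e.1 e.2 = ∑ i, ∑ j, if i < j then f i j else 0 := by
    rw [pairs, Finset.sum_filter, Fintype.sum_prod_type]
  rw [h4, h1, h2, h3]
  ring

theorem sum_edgeOdds_self (w : Fin N → ℝ) :
    ∑ i, edgeOdds w i i = (∑ i, w i ^ 2) / totalWeight w := by
  rw [Finset.sum_div]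
  exact Finset.sum_congr rfl fun i _ => by rw [edgeOdds, sq]

theorem sum_edgeOdds_mul (w s : Fin N → ℝ) :
    ∑ i, ∑ j, edgeOdds w i j * (s i * s j) = (∑ i, w i * s i) ^ 2 / totalWeight w := by
  rw [sq, Finset.sum_mul_sum, Finset.sum_div]
  refine Finset.sum_congr rfl fun i _ => ?_
  rw [Finset.sum_div]
  exact Finset.sum_congr rfl fun j _ => by rw [edgeOdds]; ring

theorem sum_edgeOdds (hl : 0 < totalWeight w) :
    ∑ i, ∑ j, edgeOdds w i j = totalWeight w := by
  have h := sum_edgeOdds_mul w (fun _ => 1)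
  simp only [mul_one] at h
  rw [h, show ∑ i, w i = totalWeight w from rfl, sq, mul_div_assoc, div_self hl.ne', mul_one]

theorem sum_edgeOdds_sq (w : Fin N → ℝ) :
    ∑ i, ∑ j, edgeOdds w i j ^ 2 = ((∑ i, w i ^ 2) / totalWeight w) ^ 2 := by
  rw [div_pow, sq (∑ i, w i ^ 2), Finset.sum_mul_sum, Finset.sum_div]
  refine Finset.sum_congr rfl fun i _ => ?_
  rw [Finset.sum_div]
  exact Finset.sum_congr rfl fun j _ => by rw [edgeOdds]; ring

theorem sum_pairs_edgeOdds_sq_le (w : Fin N → ℝ) :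
    ∑ e ∈ pairs N, edgeOdds w e.1 e.2 ^ 2 ≤ ((∑ i, w i ^ 2) / totalWeight w) ^ 2 := by
  rw [← sum_edgeOdds_sq, sum_pairs_symm (f := fun i j => edgeOdds w i j ^ 2)
    (fun i j => by rw [edgeOdds_comm])]
  have h1 : 0 ≤ ∑ i, edgeOdds w i i ^ 2 := by positivity
  have h2 : 0 ≤ ∑ i, ∑ j, edgeOdds w i j ^ 2 := by positivity
  linarith

/-- The constant in the comparison of the annealed model with the Curie–Weiss model. -/
noncomputable def compErr (β : ℝ) : ℝ :=
  logErr β + logErr (-β) + (Real.cosh β - 1) + |Real.sinh β|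

theorem abs_log_annealedWeight_sub_le (hw : ∀ i, 0 < w i) (hN : 0 < N) (β : ℝ) (σ : Spins N) :
    |Real.log (annealedWeight w β σ) - ((Real.cosh β - 1) / 2 * totalWeight w +
      Real.sinh β / (2 * totalWeight w) * (∑ i, w i * spin σ i) ^ 2)| ≤
    compErr β * (((∑ i, w i ^ 2) / totalWeight w) ^ 2 + (∑ i, w i ^ 2) / totalWeight w) := by
  have hl := totalWeight_pos hw ⟨0, hN⟩
  set c := Real.cosh β - 1 with hc
  set s := Real.sinh β with hs
  set ν := (∑ i, w i ^ 2) / totalWeight w with hν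
  have hν0 : 0 ≤ ν := by positivity
  have hc0 : 0 ≤ c := sub_nonneg.2 (Real.one_le_cosh β)
  have h1 : Real.log (annealedWeight w β σ) = ∑ e ∈ pairs N,
      Real.log (1 + edgeProb w e.1 e.2 * (Real.exp (β * (spin σ e.1 * spin σ e.2)) - 1)) := by
    unfold annealedWeight
    rw [prod_Ioi_eq_prod_pairs, Real.log_prod]
    exact fun e _ => (one_add_edgeProb_mul_pos hw _ _ _).ne'
  have hexp : ∀ i j, Real.exp (β * (spin σ i * spin σ j)) - 1 =
      c + s * (spin σ i * spin σ j) := by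
    intro i j
    rcases spin_mul_eq σ i j with h | h
    · rw [h, mul_one, mul_one, ← Real.cosh_add_sinh]; ring
    · rw [h, mul_neg_one, mul_neg_one, ← Real.cosh_sub_sinh]; ring
  have h2 : ∑ e ∈ pairs N, edgeOdds w e.1 e.2 *
      (Real.exp (β * (spin σ e.1 * spin σ e.2)) - 1) = c / 2 * totalWeight w +
        s / (2 * totalWeight w) * (∑ i, w i * spin σ i) ^ 2 - (c + s) * ν / 2 := by
    simp_rw [hexp]
    rw [sum_pairs_symm (f := fun i j => edgeOdds w i j * (c + s * (spin σ i * spin σ j)))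
      (fun i j => by rw [edgeOdds_comm, mul_comm (spin σ i)])]
    have e1 : ∑ i, ∑ j, edgeOdds w i j * (c + s * (spin σ i * spin σ j)) =
        c * totalWeight w + s * ((∑ i, w i * spin σ i) ^ 2 / totalWeight w) := by
      rw [← sum_edgeOdds_mul w (spin σ)]
      conv_rhs => rw [← sum_edgeOdds hl]
      simp only [Finset.mul_sum, ← Finset.sum_add_distrib]
      exact Finset.sum_congr rfl fun i _ => Finset.sum_congr rfl fun j _ => by ring
    have e2 : ∑ i, edgeOdds w i i * (c + s * (spin σ i * spin σ i)) = (c + s) * ν := by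
      simp_rw [spin_mul_self, mul_one]
      rw [← Finset.sum_mul, sum_edgeOdds_self, mul_comm]
    rw [e1, e2]
    field_simp
  have h3 : |∑ e ∈ pairs N, (Real.log (1 + edgeProb w e.1 e.2 *
      (Real.exp (β * (spin σ e.1 * spin σ e.2)) - 1)) - edgeOdds w e.1 e.2 *
      (Real.exp (β * (spin σ e.1 * spin σ e.2)) - 1))| ≤ (logErr β + logErr (-β)) * ν ^ 2 := by
    calc _ ≤ ∑ e ∈ pairs N, (logErr β + logErr (-β)) * edgeOdds w e.1 e.2 ^ 2 := by
          refine (Finset.abs_sum_le_sum_abs _ _).trans (Finset.sum_le_sum fun e _ => ?_)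
          refine (abs_log_edge_sub_le hw _ _ _).trans (mul_le_mul_of_nonneg_right ?_ (sq_nonneg _))
          have := logErr_nonneg β
          have := logErr_nonneg (-β)
          rcases spin_mul_eq σ e.1 e.2 with h | h
          · rw [h, mul_one]; linarith
          · rw [h, mul_neg_one]; linarith
      _ ≤ _ := by
          rw [← Finset.mul_sum]
          exact mul_le_mul_of_nonneg_left (sum_pairs_edgeOdds_sq_le w)
            (add_nonneg (logErr_nonneg _) (logErr_nonneg _))
  rw [Finset.sum_sub_distrib, ← h1, h2] at h3
  have h4 : |(c + s) * ν / 2| ≤ (c + |s|) * ν := by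
    rw [abs_div, abs_mul, abs_of_nonneg hν0, abs_two]
    have := abs_add_le c s
    rw [abs_of_nonneg hc0] at this
    have h5 := mul_le_mul_of_nonneg_right this hν0
    have h6 : 0 ≤ (c + |s|) * ν := by positivity
    linarith
  have h5 : 0 ≤ (logErr β + logErr (-β)) * ν :=
    mul_nonneg (add_nonneg (logErr_nonneg _) (logErr_nonneg _)) hν0
  have h6 : 0 ≤ (c + |s|) * ν ^ 2 := by positivity
  have e : compErr β * (ν ^ 2 + ν) = (logErr β + logErr (-β)) * ν ^ 2 +
      (logErr β + logErr (-β)) * ν + (c + |s|) * ν ^ 2 + (c + |s|) * ν := by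
    unfold compErr; ring
  rw [e]
  rw [abs_le] at h3 h4 ⊢
  constructor <;> linarith [h3.1, h3.2, h4.1, h4.2]

theorem abs_log_prefactor_sub_le (hw : ∀ i, 0 < w i) (hN : 0 < N) (β : ℝ) :
    |Real.log (prefactor w β) - (Real.cosh β - 1) / 2 * totalWeight w| ≤
      compErr β * (((∑ i, w i ^ 2) / totalWeight w) ^ 2 + (∑ i, w i ^ 2) / totalWeight w) := by
  have hl := totalWeight_pos hw ⟨0, hN⟩
  set c := Real.cosh β - 1 with hc
  set s := Real.sinh β with hs
  set ν := (∑ i, w i ^ 2) / totalWeight w with hν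
  have hν0 : 0 ≤ ν := by positivity
  have hc0 : 0 ≤ c := sub_nonneg.2 (Real.one_le_cosh β)
  set Lp : Fin N → Fin N → ℝ := fun i j =>
    Real.log (1 + edgeProb w i j * (Real.exp β - 1)) with hLp
  set Lm : Fin N → Fin N → ℝ := fun i j =>
    Real.log (1 + edgeProb w i j * (Real.exp (-β) - 1)) with hLm
  have h1 : Real.log (prefactor w β) =
      ∑ e ∈ pairs N, (Lp e.1 e.2 + Lm e.1 e.2) / 2 - (∑ i, (Lp i i - Lm i i) / 2) / 2 := by
    unfold prefactor
    rw [Real.log_mul, prod_Ioi_eq_prod_pairs, Real.log_prod, Real.log_prod]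
    · simp_rw [Real.log_exp, effConst_eq hw, Real.log_exp, effCoupling_eq hw]
      have h : ∑ i, -((Lp i i - Lm i i) / 2) / 2 = -((∑ i, (Lp i i - Lm i i) / 2) / 2) := by
        rw [Finset.sum_div, ← Finset.sum_neg_distrib]
        exact Finset.sum_congr rfl fun i _ => neg_div _ _
      exact (congrArg _ h).trans (sub_eq_add_neg _ _).symm
    · exact fun i _ => (Real.exp_pos _).ne'
    · exact fun e _ => by rw [effConst_eq hw]; exact (Real.exp_pos _).ne'
    · refine Finset.prod_ne_zero_iff.2 fun i _ => Finset.prod_ne_zero_iff.2 fun j _ => ?_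
      rw [effConst_eq hw]; exact (Real.exp_pos _).ne'
    · exact Finset.prod_ne_zero_iff.2 fun i _ => (Real.exp_pos _).ne'
  set K := logErr β + logErr (-β) with hK
  have hK0 : 0 ≤ K := add_nonneg (logErr_nonneg _) (logErr_nonneg _)
  have hp : ∀ i j, |Lp i j - edgeOdds w i j * (Real.exp β - 1)| ≤
      logErr β * edgeOdds w i j ^ 2 := fun i j => abs_log_edge_sub_le hw i j β
  have hm : ∀ i j, |Lm i j - edgeOdds w i j * (Real.exp (-β) - 1)| ≤
      logErr (-β) * edgeOdds w i j ^ 2 := fun i j => abs_log_edge_sub_le hw i j (-β)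
  have hch : Real.cosh β = (Real.exp β + Real.exp (-β)) / 2 := Real.cosh_eq β
  have hsh : Real.sinh β = (Real.exp β - Real.exp (-β)) / 2 := Real.sinh_eq β
  have hsum : ∀ i j, |(Lp i j + Lm i j) / 2 - edgeOdds w i j * c| ≤
      K / 2 * edgeOdds w i j ^ 2 := by
    intro i j
    have a := abs_le.1 (hp i j)
    have b := abs_le.1 (hm i j)
    rw [abs_le, hc, hch, hK]
    constructor <;> nlinarith [a.1, a.2, b.1, b.2]
  have hdiff : ∀ i j, |(Lp i j - Lm i j) / 2 - edgeOdds w i j * s| ≤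
      K / 2 * edgeOdds w i j ^ 2 := by
    intro i j
    have a := abs_le.1 (hp i j)
    have b := abs_le.1 (hm i j)
    rw [abs_le, hs, hsh, hK]
    constructor <;> nlinarith [a.1, a.2, b.1, b.2]
  have h2 : |∑ e ∈ pairs N, ((Lp e.1 e.2 + Lm e.1 e.2) / 2 - edgeOdds w e.1 e.2 * c)| ≤
      K / 2 * ν ^ 2 := by
    calc _ ≤ ∑ e ∈ pairs N, K / 2 * edgeOdds w e.1 e.2 ^ 2 :=
          (Finset.abs_sum_le_sum_abs _ _).trans (Finset.sum_le_sum fun e _ => hsum _ _)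
      _ ≤ _ := by
          rw [← Finset.mul_sum]
          exact mul_le_mul_of_nonneg_left (sum_pairs_edgeOdds_sq_le w) (by positivity)
  have h3 : |∑ i, ((Lp i i - Lm i i) / 2 - edgeOdds w i i * s)| ≤ K / 2 * ν ^ 2 := by
    calc _ ≤ ∑ i, K / 2 * edgeOdds w i i ^ 2 :=
          (Finset.abs_sum_le_sum_abs _ _).trans (Finset.sum_le_sum fun i _ => hdiff _ _)
      _ ≤ _ := by
          rw [← Finset.mul_sum, hν, ← sum_edgeOdds_sq]
          refine mul_le_mul_of_nonneg_left (Finset.sum_le_sum fun i _ => ?_) (by positivity)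
          exact Finset.single_le_sum (f := fun j => edgeOdds w i j ^ 2)
            (fun _ _ => sq_nonneg _) (Finset.mem_univ i)
  rw [Finset.sum_sub_distrib, ← Finset.sum_mul,
    sum_pairs_symm (f := fun i j => edgeOdds w i j) (fun i j => edgeOdds_comm i j),
    sum_edgeOdds hl, sum_edgeOdds_self] at h2
  rw [Finset.sum_sub_distrib, ← Finset.sum_mul, sum_edgeOdds_self] at h3
  rw [h1]
  rw [← hν] at h2 h3
  have h5 : 0 ≤ K * ν := mul_nonneg hK0 hν0
  have h6 : 0 ≤ (c + |s|) * ν ^ 2 := by positivity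
  have h7 : 0 ≤ K * ν ^ 2 := by positivity
  have h8 : 0 ≤ c * ν := by positivity
  have h9 : |s| * ν = |s * ν| := by rw [abs_mul, abs_of_nonneg hν0]
  have h10 := abs_nonneg (s * ν)
  have h11 := le_abs_self (s * ν)
  have h12 := neg_abs_le (s * ν)
  have e : compErr β * (ν ^ 2 + ν) = K * ν ^ 2 + K * ν + (c + |s|) * ν ^ 2 + c * ν + |s * ν| := by
    rw [← h9]; unfold compErr; ring
  rw [e]
  rw [abs_le] at h2 h3 ⊢
  constructor <;> nlinarith [h2.1, h2.2, h3.1, h3.2]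

theorem abs_log_partition_sub_le (hw : ∀ i, 0 < w i) (hN : 0 < N) (β B : ℝ) :
    |Real.log (fieldMoment (annealedWeight w β) 0 B) - ((Real.cosh β - 1) / 2 * totalWeight w +
      Real.log (cwPartition w (Real.sinh β) B))| ≤
    compErr β * (((∑ i, w i ^ 2) / totalWeight w) ^ 2 + (∑ i, w i ^ 2) / totalWeight w) := by
  set E := compErr β * (((∑ i, w i ^ 2) / totalWeight w) ^ 2 + (∑ i, w i ^ 2) / totalWeight w)
    with hE
  have hA := annealedWeight_pos hw β
  have hZ := cwPartition_pos w (Real.sinh β) B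
  have hF := fieldMoment_zero_pos hA B
  have hterm : ∀ t : ℝ, ∀ σ : Spins N, Real.exp ((Real.cosh β - 1) / 2 * totalWeight w + t) *
      Real.exp (Real.sinh β / (2 * totalWeight w) * (∑ i, w i * spin σ i) ^ 2 +
        B * totalSpin σ) = Real.exp ((Real.cosh β - 1) / 2 * totalWeight w +
      Real.sinh β / (2 * totalWeight w) * (∑ i, w i * spin σ i) ^ 2 + t) *
        Real.exp (B * totalSpin σ) := by
    intro t σ
    rw [← Real.exp_add, ← Real.exp_add]
    congr 1; ring
  have hup : fieldMoment (annealedWeight w β) 0 B ≤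
      Real.exp ((Real.cosh β - 1) / 2 * totalWeight w + E) * cwPartition w (Real.sinh β) B := by
    unfold fieldMoment cwPartition
    rw [Finset.mul_sum]
    refine Finset.sum_le_sum fun σ _ => ?_
    rw [pow_zero, mul_one, hterm]
    refine mul_le_mul_of_nonneg_right ?_ (Real.exp_pos _).le
    rw [← Real.log_le_iff_le_exp (hA σ)]
    linarith [(abs_le.1 (abs_log_annealedWeight_sub_le hw hN β σ)).2]
  have hlo : Real.exp ((Real.cosh β - 1) / 2 * totalWeight w + -E) *
      cwPartition w (Real.sinh β) B ≤ fieldMoment (annealedWeight w β) 0 B := by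
    unfold fieldMoment cwPartition
    rw [Finset.mul_sum]
    refine Finset.sum_le_sum fun σ _ => ?_
    rw [pow_zero, mul_one, hterm]
    refine mul_le_mul_of_nonneg_right ?_ (Real.exp_pos _).le
    rw [← Real.le_log_iff_exp_le (hA σ)]
    linarith [(abs_le.1 (abs_log_annealedWeight_sub_le hw hN β σ)).1]
  have h1 := Real.log_le_log hF hup
  have h2 := Real.log_le_log (by positivity) hlo
  rw [Real.log_mul (Real.exp_pos _).ne' hZ.ne', Real.log_exp] at h1 h2
  rw [abs_le]
  constructor <;> linarith

end Asymptotics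

section Limits

variable {Ω : Type*} [MeasurableSpace Ω] {P : Measure Ω} [IsProbabilityMeasure P] {W : Ω → ℝ}
  {w : (N : ℕ) → Fin N → ℝ}

theorem WeightRegularity.tendsto_error (hreg : WeightRegularity w W P) (β : ℝ) :
    Tendsto (fun N : ℕ => 1 / (N : ℝ) * (compErr β *
      (((∑ i, w N i ^ 2) / totalWeight (w N)) ^ 2 + (∑ i, w N i ^ 2) / totalWeight (w N))))
      atTop (𝓝 0) := by
  have h := hreg.tendsto_sq_div_totalWeight
  have := (tendsto_one_div_atTop_nhds_zero_nat (𝕜 := ℝ)).mul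
    (((h.pow 2).add h).const_mul (compErr β))
  simpa using this

theorem tendsto_of_abs_sub_le {u v e : ℕ → ℝ} {l : ℝ}
    (h : ∀ᶠ N : ℕ in atTop, |u N - v N| ≤ e N)
    (hv : Tendsto (fun N : ℕ => 1 / (N : ℝ) * v N) atTop (𝓝 l))
    (he : Tendsto (fun N : ℕ => 1 / (N : ℝ) * e N) atTop (𝓝 0)) :
    Tendsto (fun N : ℕ => 1 / (N : ℝ) * u N) atTop (𝓝 l) := by
  have h1 : Tendsto (fun N : ℕ => 1 / (N : ℝ) * u N - 1 / (N : ℝ) * v N) atTop (𝓝 0) := by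
    refine squeeze_zero_norm' ?_ he
    filter_upwards [h] with N hN
    rw [← mul_sub, Real.norm_eq_abs, abs_mul, abs_of_nonneg (by positivity : 0 ≤ 1 / (N : ℝ))]
    exact mul_le_mul_of_nonneg_left hN (by positivity)
  simpa using h1.add hv

theorem WeightRegularity.tendsto_const_mul_totalWeight (hreg : WeightRegularity w W P) (c : ℝ) :
    Tendsto (fun N : ℕ => 1 / (N : ℝ) * (c * totalWeight (w N))) atTop
      (𝓝 (c * ∫ ω, W ω ∂P)) := by
  refine (hreg.tendsto_totalWeight_div.const_mul c).congr fun N => ?_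
  ring

theorem WeightRegularity.tendsto_log_prefactor (hreg : WeightRegularity w W P)
    (hpos : ∀ N i, 0 < w N i) (β : ℝ) :
    Tendsto (fun N : ℕ => 1 / (N : ℝ) * Real.log (prefactor (w N) β)) atTop
      (𝓝 ((Real.cosh β - 1) / 2 * ∫ ω, W ω ∂P)) := by
  refine tendsto_of_abs_sub_le ?_ (hreg.tendsto_const_mul_totalWeight _) (hreg.tendsto_error β)
  filter_upwards [eventually_gt_atTop 0] with N hN
  exact abs_log_prefactor_sub_le (hpos N) hN β

theorem WeightRegularity.tendsto_annealedPressure (hreg : WeightRegularity w W P)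
    (hpos : ∀ N i, 0 < w N i) {β : ℝ} (hβ : 0 ≤ β) (B : ℝ)
    (hX : NonnegSq (fun ω => scale W P β * W ω) P) :
    Tendsto (fun N => annealedPressure (w N) β B) atTop
      (𝓝 (Real.log 2 + (Real.cosh β - 1) / 2 * (∫ ω, W ω ∂P) + hX.limitPressure B)) := by
  unfold annealedPressure
  simp_rw [graphExpect_partitionFn]
  refine tendsto_of_abs_sub_le (v := fun N => (Real.cosh β - 1) / 2 * totalWeight (w N) +
    Real.log (cwPartition (w N) (Real.sinh β) B)) ?_ ?_ (hreg.tendsto_error β)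
  · filter_upwards [eventually_gt_atTop 0] with N hN
    exact abs_log_partition_sub_le (hpos N) hN β B
  · have h := (hreg.tendsto_const_mul_totalWeight ((Real.cosh β - 1) / 2)).add
      (hreg.tendsto_log_cwPartition hpos hβ B hX)
    simp_rw [mul_add]
    convert h using 2
    ring

/-- Convergence of derivatives of convex functions. -/
theorem tendsto_of_tangent {f : ℕ → ℝ → ℝ} {d : ℕ → ℝ} {F : ℝ → ℝ} {m x : ℝ} {U : Set ℝ}
    (hU : U ∈ 𝓝 x) (h : ∀ᶠ N in atTop, ∀ y ∈ U, f N x + d N * (y - x) ≤ f N y)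
    (hf : ∀ y ∈ U, Tendsto (fun N => f N y) atTop (𝓝 (F y))) (hF : HasDerivAt F m x) :
    Tendsto d atTop (𝓝 m) := by
  have hx := hf x (mem_of_mem_nhds hU)
  have hs := hasDerivAt_iff_tendsto_slope.1 hF
  have hlim : ∀ y ∈ U, Tendsto (fun N => (f N y - f N x) / (y - x)) atTop (𝓝 (slope F x y)) := by
    intro y hy
    rw [slope_def_field]
    exact ((hf y hy).sub hx).div_const _
  have hUr : ∀ᶠ y in 𝓝[>] x, y ∈ U := mem_nhdsWithin_of_mem_nhds hU
  have hUl : ∀ᶠ y in 𝓝[<] x, y ∈ U := mem_nhdsWithin_of_mem_nhds hU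
  rw [tendsto_order]
  constructor
  · intro c hc
    have h1 := (hs.mono_left (nhdsWithin_mono x (s := Set.Iio x) (fun y hy => ne_of_lt hy))).eventually_const_lt hc
    obtain ⟨y, hy1, hy2, hy3⟩ := (h1.and (hUl.and self_mem_nhdsWithin)).exists
    have hyx : y - x < 0 := sub_neg.2 hy3
    filter_upwards [h, (hlim y hy2).eventually_const_lt hy1] with N hN1 hN2
    refine hN2.trans_le ?_
    rw [div_le_iff_of_neg hyx]
    linarith [hN1 y hy2]
  · intro c hc
    have h1 := (hs.mono_left (nhdsWithin_mono x (s := Set.Ioi x) (fun y hy => ne_of_gt hy))).eventually_lt_const hc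
    obtain ⟨y, hy1, hy2, hy3⟩ := (h1.and (hUr.and self_mem_nhdsWithin)).exists
    have hyx : 0 < y - x := sub_pos.2 hy3
    filter_upwards [h, (hlim y hy2).eventually_lt_const hy1] with N hN1 hN2
    refine lt_of_le_of_lt ?_ hN2
    rw [le_div_iff₀ hyx]
    linarith [hN1 y hy2]

theorem annealedPressure_tangent {N : ℕ} {w : Fin N → ℝ} (hw : ∀ i, 0 < w i) (β x y : ℝ) :
    annealedPressure w β x + annealedMagn w β x * (y - x) ≤ annealedPressure w β y := by
  unfold annealedPressure
  rw [graphExpect_partitionFn, graphExpect_partitionFn, annealedMagn_eq]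
  have h := mul_le_mul_of_nonneg_left (log_fieldMoment_tangent (annealedWeight_pos hw β) x y)
    (show 0 ≤ 1 / (N : ℝ) by positivity)
  refine le_trans (le_of_eq ?_) h
  ring

theorem WeightRegularity.tendsto_annealedMagn (hreg : WeightRegularity w W P)
    (hpos : ∀ N i, 0 < w N i) {β : ℝ} (hβ : 0 ≤ β) {B : ℝ}
    (hX : NonnegSq (fun ω => scale W P β * W ω) P) (hu : hX.UniqueAt B) :
    Tendsto (fun N => annealedMagn (w N) β B) atTop (𝓝 (hX.limitMagn B)) :=
  tendsto_of_tangent (f := fun N => annealedPressure (w N) β) Filter.univ_mem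
    (Eventually.of_forall fun N y _ => annealedPressure_tangent (hpos N) β B y)
    (fun y _ => hreg.tendsto_annealedPressure hpos hβ y hX)
    ((hX.hasDerivAt_limitPressure hu).const_add _)

theorem WeightRegularity.tendsto_annealedSusc_of_ne (hreg : WeightRegularity w W P)
    (hpos : ∀ N i, 0 < w N i) {β : ℝ} (hβ : 0 ≤ β) {B : ℝ} (hB : B ≠ 0)
    (hX : NonnegSq (fun ω => scale W P β * W ω) P) :
    Tendsto (fun N => annealedSusc (w N) β B) atTop (𝓝 (hX.limitSusc B)) := by
  have hd := hX.hasDerivAt_limitMagn (hX.uniqueAt_of_ne hB) (hX.cwSlope_maximizer_lt_one hB)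
  rcases lt_or_gt_of_ne hB with h | h
  · refine tendsto_of_tangent (f := fun N => annealedMagn (w N) β) (Iio_mem_nhds h)
      (Eventually.of_forall fun N y hy => ?_)
      (fun y hy => hreg.tendsto_annealedMagn hpos hβ hX (hX.uniqueAt_of_ne (ne_of_lt hy))) hd
    have ht := annealedMagn_tangent (hpos N) hβ (x := -B) (y := -y) (by linarith)
      (by linarith [Set.mem_Iio.1 hy])
    rw [annealedMagn_neg, annealedMagn_neg, annealedSusc_neg (hpos N)] at ht
    linarith
  · have := tendsto_of_tangent (f := fun N y => -annealedMagn (w N) β y)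
      (d := fun N => -annealedSusc (w N) β B) (Ioi_mem_nhds h)
      (Eventually.of_forall fun N y hy => by
        linarith [annealedMagn_tangent (hpos N) hβ (x := B) (y := y) h.le (le_of_lt hy)])
      (fun y hy => (hreg.tendsto_annealedMagn hpos hβ hX
        (hX.uniqueAt_of_ne (ne_of_gt hy))).neg) hd.neg
    simpa using this.neg

theorem WeightRegularity.integral_scale_sq (hreg : WeightRegularity w W P) {β : ℝ} (hβ : 0 ≤ β) :
    ∫ ω, (scale W P β * W ω) ^ 2 ∂P = Real.sinh β * nu W P := by
  simp_rw [mul_pow]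
  rw [integral_const_mul, scale, Real.sq_sqrt
    (div_nonneg (Real.sinh_nonneg_iff.2 hβ) hreg.mean_pos.le), nu]
  ring

theorem WeightRegularity.nu_pos (hreg : WeightRegularity w W P) : 0 < nu W P := by
  refine div_pos (lt_of_le_of_ne (integral_nonneg fun ω => sq_nonneg _) fun h => ?_) hreg.mean_pos
  have h0 := (integral_eq_zero_iff_of_nonneg (fun ω => sq_nonneg (W ω)) hreg.integrable_sq).1 h.symm
  have : ∫ ω, W ω ∂P = 0 := integral_eq_zero_of_ae (by
    filter_upwards [h0] with ω hω
    exact pow_eq_zero_iff two_ne_zero |>.1 hω)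
  exact hreg.mean_pos.ne' this

theorem WeightRegularity.tendsto_bound (hreg : WeightRegularity w W P) {c : ℝ}
    (hc : c * nu W P < 1) :
    Tendsto (fun N : ℕ => 1 + c * (totalWeight (w N) / N) /
      (1 - c * ((∑ i, w N i ^ 2) / totalWeight (w N)))) atTop
      (𝓝 (1 + c * (∫ ω, W ω ∂P) / (1 - c * nu W P))) :=
  tendsto_const_nhds.add ((hreg.tendsto_totalWeight_div.const_mul c).div
    (tendsto_const_nhds.sub (hreg.tendsto_sq_div_totalWeight.const_mul c)) (by linarith))

theorem annealedMagn_zero {N : ℕ} (w : Fin N → ℝ) (β : ℝ) : annealedMagn w β 0 = 0 := by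
  have := annealedMagn_neg (w := w) β 0
  rw [neg_zero] at this
  linarith

theorem WeightRegularity.tendsto_annealedSusc_zero (hreg : WeightRegularity w W P)
    (hpos : ∀ N i, 0 < w N i) {β : ℝ} (hβ : 0 ≤ β) (hsub : Real.sinh β * nu W P < 1)
    (hX : NonnegSq (fun ω => scale W P β * W ω) P) :
    Tendsto (fun N => annealedSusc (w N) β 0) atTop (𝓝 (hX.limitSusc 0)) := by
  have hX2 := hreg.integral_scale_sq hβ
  have hle : ∫ ω, (scale W P β * W ω) ^ 2 ∂P ≤ 1 := by rw [hX2]; exact hsub.le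
  have hd := hX.hasDerivAt_limitMagn (hX.uniqueAt_zero hle)
    (by rw [hX.maximizer_zero hle, NonnegSq.cwSlope_zero, hX2]; exact hsub)
  have hs0 : hX.limitSusc 0 = 1 + Real.sinh β * (∫ ω, W ω ∂P) / (1 - Real.sinh β * nu W P) := by
    rw [hX.limitSusc_zero hle, hX2, integral_const_mul, mul_pow, scale, Real.sq_sqrt
      (div_nonneg (Real.sinh_nonneg_iff.2 hβ) hreg.mean_pos.le), add_comm]
    have := hreg.mean_pos.ne'
    field_simp
  rw [tendsto_order]
  constructor
  · intro c hc
    have hs := (hasDerivAt_iff_tendsto_slope.1 hd).mono_left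
      (nhdsWithin_mono 0 (s := Set.Ioi 0) (fun y hy => ne_of_gt hy))
    obtain ⟨y, hy1, hy2⟩ := ((hs.eventually_const_lt hc).and self_mem_nhdsWithin).exists
    have hy : 0 < y := hy2
    rw [slope_def_field, hX.limitMagn_zero hle, sub_zero, sub_zero] at hy1
    have hM := (hreg.tendsto_annealedMagn hpos hβ hX (hX.uniqueAt_of_ne hy.ne')).div_const y
    filter_upwards [hM.eventually_const_lt hy1] with N hN
    refine hN.trans_le ?_
    rw [div_le_iff₀ hy]
    have := annealedMagn_tangent (hpos N) hβ le_rfl hy.le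
    rw [annealedMagn_zero] at this
    linarith
  · intro c hc
    have hb := hreg.tendsto_bound hsub
    rw [← hs0] at hb
    have hν := (hreg.tendsto_sq_div_totalWeight.const_mul (Real.sinh β)).eventually_lt_const hsub
    filter_upwards [hb.eventually_lt_const hc, hν, eventually_gt_atTop 0] with N h1 h2 hN
    refine lt_of_le_of_lt ?_ h1
    have hs := (hasDerivAt_iff_tendsto_slope.1 (hasDerivAt_annealedMagn (hpos N) β 0)).mono_left
      (nhdsWithin_mono 0 (s := Set.Ioi 0) (fun y hy => ne_of_gt hy))
    refine le_of_tendsto hs ?_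
    filter_upwards [self_mem_nhdsWithin] with y hy
    have hy : 0 < y := hy
    rw [slope_def_field, annealedMagn_zero, sub_zero, sub_zero, div_le_iff₀ hy]
    refine (annealedMagn_le (hpos N) hβ hy.le hN h2).trans ?_
    rw [mul_comm]
    refine mul_le_mul_of_nonneg_left (tanh_le_self hy.le) ?_
    have := totalWeight_nonneg (hpos N)
    have := Real.sinh_nonneg_iff.2 hβ
    have : 0 ≤ 1 - Real.sinh β * ((∑ i, w N i ^ 2) / totalWeight (w N)) := by linarith
    positivity

theorem sinh_mul_nu_le_one_iff {ν β : ℝ} (hν : 0 < ν) :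
    Real.sinh β * ν ≤ 1 ↔ β ≤ Real.arsinh (1 / ν) := by
  rw [← le_div_iff₀ hν, ← Real.sinh_le_sinh (y := Real.arsinh (1 / ν)), Real.sinh_arsinh]

theorem WeightRegularity.betaAn_eq (hreg : WeightRegularity w W P) (hpos : ∀ N i, 0 < w N i) :
    betaAn w = ((Real.arsinh (1 / nu W P) : ℝ) : EReal) := by
  have hν := hreg.nu_pos
  have hb0 : 0 < Real.arsinh (1 / nu W P) := Real.arsinh_pos_iff.2 (by positivity)
  refine le_antisymm ?_ (le_sInf ?_)
  · refine le_of_forall_gt fun c hc => ?_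
    obtain ⟨r, hr1, hr2⟩ := EReal.lt_iff_exists_real_btwn.1 hc
    refine lt_of_le_of_lt (sInf_le ⟨r, ⟨?_, ?_⟩, rfl⟩) hr2
    · exact hb0.trans (EReal.coe_lt_coe_iff.1 hr1)
    · have hr0 : 0 ≤ r := (hb0.trans (EReal.coe_lt_coe_iff.1 hr1)).le
      have hX := hreg.nonnegSq hpos (a := scale W P r) (Real.sqrt_nonneg _)
      refine ⟨hX.limitMagn, fun B hB => hreg.tendsto_annealedMagn hpos hr0 hX
        (hX.uniqueAt_of_ne hB.ne'), hX.tendsto_limitMagn_pos ?_⟩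
      rw [hreg.integral_scale_sq hr0]
      by_contra hle
      exact absurd ((sinh_mul_nu_le_one_iff hν).1 (not_lt.1 hle))
        (not_le.2 (EReal.coe_lt_coe_iff.1 hr1))
  · rintro _ ⟨β, ⟨hβ, M, hM, m₀, hm₀, hlim⟩, rfl⟩
    rw [EReal.coe_le_coe_iff]
    by_contra hlt
    push Not at hlt
    have hX := hreg.nonnegSq hpos (a := scale W P β) (Real.sqrt_nonneg _)
    have h1 := hX.tendsto_limitMagn_zero (by
      rw [hreg.integral_scale_sq hβ.le]; exact (sinh_mul_nu_le_one_iff hν).2 hlt.le)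
    have h2 : M =ᶠ[𝓝[>] 0] hX.limitMagn := by
      filter_upwards [self_mem_nhdsWithin] with B hB
      exact tendsto_nhds_unique (hM B hB) (hreg.tendsto_annealedMagn hpos hβ.le hX
        (hX.uniqueAt_of_ne (ne_of_gt hB)))
    exact hm₀.ne' (tendsto_nhds_unique hlim (h1.congr' h2.symm))

theorem WeightRegularity.artanh_le_betaQu (hreg : WeightRegularity w W P)
    (hpos : ∀ N i, 0 < w N i) (hν : 1 < nu W P) :
    ((Real.artanh (1 / nu W P) : ℝ) : EReal) ≤ betaQu w := by
  have hν0 := hreg.nu_pos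
  have hmem : 1 / nu W P ∈ Set.Ioo (-1 : ℝ) 1 :=
    ⟨by have : 0 < 1 / nu W P := by positivity
        linarith, (div_lt_one hν0).2 hν⟩
  refine le_sInf ?_
  rintro _ ⟨β, ⟨hβ, M, hM, m₀, hm₀, hlim⟩, rfl⟩
  rw [EReal.coe_le_coe_iff]
  by_contra hlt
  push Not at hlt
  have ht : Real.tanh β * nu W P < 1 := by
    have := tanh_mono hlt
    rwa [Real.tanh_artanh hmem, lt_div_iff₀ hν0] at this
  have hb := hreg.tendsto_bound ht
  have hev := (hreg.tendsto_sq_div_totalWeight.const_mul (Real.tanh β)).eventually_lt_const ht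
  set C := 1 + Real.tanh β * (∫ ω, W ω ∂P) / (1 - Real.tanh β * nu W P) with hC
  have hle : ∀ B, 0 < B → M B ≤ Real.tanh B * C := by
    intro B hB
    refine le_of_tendsto_of_tendsto (hM B hB) (hb.const_mul _) ?_
    filter_upwards [hev, eventually_gt_atTop 0] with N h1 hN
    exact quenchedMagn_le (hpos N) hβ.le hB.le hN h1
  have h0 : Tendsto (fun B => Real.tanh B * C) (𝓝[>] 0) (𝓝 0) := by
    have := ((continuous_tanh.tendsto 0).mul_const C).mono_left
      (nhdsWithin_le_nhds (s := Set.Ioi (0 : ℝ)))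
    simpa using this
  have := le_of_tendsto_of_tendsto hlim h0 (by
    filter_upwards [self_mem_nhdsWithin] with B hB
    exact hle B hB)
  linarith

theorem arsinh_lt_artanh {x : ℝ} (hx0 : 0 < x) (hx1 : x < 1) : Real.arsinh x < Real.artanh x := by
  rw [← tanh_mono.lt_iff_lt, Real.tanh_arsinh, Real.tanh_artanh ⟨by linarith, hx1⟩]
  refine div_lt_self hx0 ?_
  rw [Real.lt_sqrt (by norm_num)]
  nlinarith

end Limits
end AnnealedGRG

namespace AnnealedGRG

section Regime

variable {Ω : Type*} [MeasurableSpace Ω] {P : Measure Ω} [IsProbabilityMeasure P]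
  {W : Ω → ℝ} {w : (N : ℕ) → Fin N → ℝ}

theorem WeightRegularity.sinh_mul_nu_le_one (hreg : WeightRegularity w W P)
    (hpos : ∀ N i, 0 < w N i) {β : ℝ} (h : (β : EReal) ≤ betaAn w) :
    Real.sinh β * nu W P ≤ 1 := by
  rw [hreg.betaAn_eq hpos, EReal.coe_le_coe_iff] at h
  exact (sinh_mul_nu_le_one_iff hreg.nu_pos).2 h

theorem WeightRegularity.one_lt_sinh_mul_nu (hreg : WeightRegularity w W P)
    (hpos : ∀ N i, 0 < w N i) {β : ℝ} (h : betaAn w < (β : EReal)) :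
    1 < Real.sinh β * nu W P := by
  rw [hreg.betaAn_eq hpos, EReal.coe_lt_coe_iff] at h
  exact not_le.1 fun hle => not_le.2 h ((sinh_mul_nu_le_one_iff hreg.nu_pos).1 hle)

theorem WeightRegularity.sinh_mul_nu_lt_one (hreg : WeightRegularity w W P)
    (hpos : ∀ N i, 0 < w N i) {β : ℝ} (h : (β : EReal) < betaAn w) :
    Real.sinh β * nu W P < 1 := by
  rw [hreg.betaAn_eq hpos, EReal.coe_lt_coe_iff] at h
  have := Real.sinh_lt_sinh.2 h
  rwa [Real.sinh_arsinh, lt_div_iff₀ hreg.nu_pos] at this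

/-- In the uniqueness regime, the maximizer is unique and nondegenerate, also for nearby fields,
and the susceptibilities converge. -/
theorem WeightRegularity.uniquenessRegime_spec (hreg : WeightRegularity w W P)
    (hpos : ∀ N i, 0 < w N i) {β B : ℝ} (h : (β, B) ∈ uniquenessRegime w)
    (hX : NonnegSq (fun ω => scale W P β * W ω) P) :
    0 ≤ β ∧ (∀ᶠ b in 𝓝 B, hX.UniqueAt b) ∧
      cwSlope P (fun ω => scale W P β * W ω) B (hX.maximizer B) < 1 ∧
      Tendsto (fun N => annealedSusc (w N) β B) atTop (𝓝 (hX.limitSusc B)) := by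
  rcases h with ⟨hβ, hB⟩ | ⟨hβ, hlt, hB⟩
  · exact ⟨hβ, (eventually_ne_nhds hB).mono fun b hb => hX.uniqueAt_of_ne hb,
      hX.cwSlope_maximizer_lt_one hB, hreg.tendsto_annealedSusc_of_ne hpos hβ hB hX⟩
  · obtain rfl : B = 0 := hB
    have hβ' : 0 ≤ β := le_of_lt hβ
    have hs := hreg.sinh_mul_nu_lt_one hpos hlt
    have hle : ∫ ω, (scale W P β * W ω) ^ 2 ∂P ≤ 1 := by
      rw [hreg.integral_scale_sq hβ']; exact hs.le
    refine ⟨hβ', Eventually.of_forall fun b => ?_, ?_,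
      hreg.tendsto_annealedSusc_zero hpos hβ' hs hX⟩
    · rcases eq_or_ne b 0 with rfl | hb
      · exact hX.uniqueAt_zero hle
      · exact hX.uniqueAt_of_ne hb
    · rwa [hX.maximizer_zero hle, NonnegSq.cwSlope_zero, hreg.integral_scale_sq hβ']

end Regime
end AnnealedGRG

open AnnealedGRG

theorem mainTheorem2 {Ω : Type*} [MeasurableSpace Ω] (P : Measure Ω) [IsProbabilityMeasure P]
    (W : Ω → ℝ) (w : (N : ℕ) → Fin N → ℝ) (hpos : ∀ N i, 0 < w N i)
    (hreg : WeightRegularity w W P) :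
    ∃ (α : ℝ → ℝ) (ψ M zstar : ℝ → ℝ → ℝ),
      -- (i) pressure
      (∀ β, 0 ≤ β →
        Tendsto (fun N : ℕ => 1 / (N : ℝ) * Real.log (prefactor (w N) β)) atTop (𝓝 (α β))) ∧
      (∀ β B, 0 ≤ β →
        Tendsto (fun N => annealedPressure (w N) β B) atTop (𝓝 (ψ β B)) ∧
        ψ β B = Real.log 2 + α β + varFn W P β B (zstar β B) ∧
        IsMaxOn (varFn W P β B) Set.univ (zstar β B) ∧
        zstar β B = fixedPointMap W P β B (zstar β B)) ∧
      -- (ii) magnetization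
      (∀ β B, (β, B) ∈ uniquenessRegime w →
        Tendsto (fun N => annealedMagn (w N) β B) atTop (𝓝 (M β B))) ∧
      (∀ β B, 0 ≤ β → B ≠ 0 →
        HasDerivAt (fun b => ψ β b) (M β B) B ∧
        M β B = ∫ ω, Real.tanh (scale W P β * W ω * zstar β B + B) ∂P ∧
        0 ≤ B * zstar β B ∧
        (∀ z, z = fixedPointMap W P β B z → 0 ≤ B * z → z = zstar β B) ∧
        (∀ z, IsMaxOn (varFn W P β B) Set.univ z → z = zstar β B)) ∧
      -- (iii) spontaneous magnetization and critical inverse temperatures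
      (∀ β : ℝ, 0 ≤ β → (β : EReal) ≤ betaAn w → Tendsto (fun B => M β B) (𝓝[>] 0) (𝓝 0)) ∧
      (∀ β : ℝ, 0 ≤ β → betaAn w < (β : EReal) →
        ∃ m₀, 0 < m₀ ∧ Tendsto (fun B => M β B) (𝓝[>] 0) (𝓝 m₀)) ∧
      betaAn w = ((Real.arsinh (1 / nu W P) : ℝ) : EReal) ∧
      (1 < nu W P →
        betaAn w < betaQu w ∧ betaAn w < ((Real.artanh (1 / nu W P) : ℝ) : EReal)) ∧
      -- (iv) susceptibility
      (∀ β B, (β, B) ∈ uniquenessRegime w →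
        ∃ χ, Tendsto (fun N => annealedSusc (w N) β B) atTop (𝓝 χ) ∧
          (∀ᶠ b in 𝓝 B, DifferentiableAt ℝ (fun b => ψ β b) b) ∧
          HasDerivAt (deriv (fun b => ψ β b)) χ B) := by
  have hX : ∀ β, NonnegSq (fun ω => scale W P β * W ω) P := fun β =>
    hreg.nonnegSq hpos (a := scale W P β) (Real.sqrt_nonneg _)
  have hmax : ∀ β B, IsMaxOn (varFn W P β B) Set.univ ((hX β).maximizer B) := fun β B =>
    (hX β).isMaxOn_maximizer B
  refine ⟨fun β => (Real.cosh β - 1) / 2 * ∫ ω, W ω ∂P,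
    fun β B => Real.log 2 + (Real.cosh β - 1) / 2 * (∫ ω, W ω ∂P) + (hX β).limitPressure B,
    fun β => (hX β).limitMagn, fun β => (hX β).maximizer, fun β hβ => ?_, fun β B hβ => ?_,
    fun β B h => ?_, fun β B hβ hB => ?_, fun β hβ h => ?_, fun β hβ h => ?_,
    hreg.betaAn_eq hpos, fun hν => ?_, fun β B h => ?_⟩
  · exact hreg.tendsto_log_prefactor hpos β
  · exact ⟨hreg.tendsto_annealedPressure hpos hβ B (hX β), rfl, hmax β B,
      (hX β).maximizer_fixed B⟩
  · obtain ⟨hβ, hu, -, -⟩ := hreg.uniquenessRegime_spec hpos h (hX β)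
    exact hreg.tendsto_annealedMagn hpos hβ (hX β) hu.self_of_nhds
  · exact ⟨((hX β).hasDerivAt_limitPressure ((hX β).uniqueAt_of_ne hB)).const_add _, rfl,
      (hX β).maximizer_sign B, fun z => (hX β).eq_maximizer_of_fixed hB z,
      fun z => (hX β).eq_maximizer_of_isMaxOn hB z⟩
  · refine (hX β).tendsto_limitMagn_zero ?_
    rw [hreg.integral_scale_sq hβ]
    exact hreg.sinh_mul_nu_le_one hpos h
  · refine (hX β).tendsto_limitMagn_pos ?_
    rw [hreg.integral_scale_sq hβ]
    exact hreg.one_lt_sinh_mul_nu hpos h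
  · have hlt : betaAn w < ((Real.artanh (1 / nu W P) : ℝ) : EReal) := by
      rw [hreg.betaAn_eq hpos, EReal.coe_lt_coe_iff]
      exact arsinh_lt_artanh (one_div_pos.2 hreg.nu_pos) ((div_lt_one hreg.nu_pos).2 hν)
    exact ⟨hlt.trans_le (hreg.artanh_le_betaQu hpos hν), hlt⟩
  · obtain ⟨hβ, hu, hq, hlim⟩ := hreg.uniquenessRegime_spec hpos h (hX β)
    have hd : ∀ᶠ b in 𝓝 B, HasDerivAt (fun b => Real.log 2 +
        (Real.cosh β - 1) / 2 * (∫ ω, W ω ∂P) + (hX β).limitPressure b)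
        ((hX β).limitMagn b) b :=
      hu.mono fun b hb => ((hX β).hasDerivAt_limitPressure hb).const_add _
    exact ⟨(hX β).limitSusc B, hlim, hd.mono fun b hb => hb.differentiableAt,
      ((hX β).hasDerivAt_limitMagn hu.self_of_nhds hq).congr_of_eventuallyEq
        (hd.mono fun b hb => hb.deriv)⟩
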